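/- **Setting.** Let $M\ge 2$ hypotheses $i=0,\dots,M-1$, finite nonempty sets $\mathcal U$ (controls) and $\mathcal Y$ (observations), a constant initial observation $y_0\in\mathcal Y$, and transition probabilities $p_i^u(y\mid\tilde y)>0$ ($u\in\mathcal U$, $y,\tilde y\in\mathcal Y$) be given. Assume that the hypotheses are pairwise distinct: for all $i\ne j$ there are $u,\tilde y$ with $p_i^u(\cdot\mid\tilde y)\ne p_j^u(\cdot\mid\tilde y)$. A causal control policy $\phi$ chooses $U_k$ according to a conditional pmf $q_k(\cdot\mid Y^{k-1},U^{k-1})$; under hypothesis $i$, given the past and $U_k=u$, $Y_{k-1}=\tilde y$, the observation $Y_k$ has law $p_i^{u}(\cdot\mid\tilde y)$ (with $Y_0=y_0$). Let $p_i(y^n,u^n)$ denote the resulting joint pmf and $\mathbb P_i,\mathbb E_i$ the resulting law and expectation. A test $(\phi,N,\delta)$ consists of a policy $\phi$, a stopping time $N\in\{0,1,\dots,\infty\}$ of the filtration generated by $(Y^k,U^k)$, and a decision $\delta(Y^N,U^N)\in\{0,\dots,M-1\}$, made when $N<\infty$. Put $P_{\max}=\max_i\mathbb P_i\{N<\infty,\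 \delta\neq i\}$ and $R_i=\max_{j\neq i}\mathbb P_j\{N<\infty,\ \delta=i\}$. Let $\mathbb C(\alpha)$ be the class of all tests with $P_{\max}\le\alpha$, and $\mathbb C'(\beta_0,\dots,\beta_{M-1})$ the class of all tests with $R_i\le\beta_i$ for every $i$. Here $-\log 0=\infty$. For a conditional pmf $q(u\mid\tilde y)$ let $\mu_i^q$ be the unique stationary distribution of the transition probabilities $\sum_u q(u\mid\tilde y)p_i^u(y\mid\tilde y)$, and let $D$ denote the Kullback–Leibler distance. Put $$d_i=\max_{q}\ \min_{j\ne i}\ \sum_{\tilde y\in\mathcal Y,\,u\in\mathcal U}\mu_i^q(\tilde y)\,q(u\mid\tilde y)\,D\bigl(p_i^u(\cdot\mid\tilde y)\,\|\,p_j^u(\cdot\mid\tilde y)\bigr).$$ **Proposed test** (parameters $a>1$ and $T>0$). For each $i$ let $q_i^*$ be any maximizer in the definition of $d_i$, and let $\hat i_n$ be a maximum likelihood estimate, i.e. a maximizer of $i\mapsto p_i(Y^n,U^n)$, with any rule for breaking ties. At times $k\in\{\lceil a^\ell\rceil:\ell=0,1,\dots\}$ the control $U_k$ is uniform on $\mathcal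 U$, independently of the past; at all other times $U_k\sim q^*_{\hat i_{k-1}}(\cdot\mid Y_{k-1})$. The test stops at $$N^*=\min\Bigl\{n\ge1:\ \frac{p_{\hat i_n}(Y^n,U^n)}{\max_{j\ne\hat i_n}p_j(Y^n,U^n)}>T\Bigr\}$$ and decides for $\hat i_{N^*}$. Denote its maximal error probability by $P^*_{\max}$ and its risks by $R_i^*$. **Theorem.** The maximum in the definition of $d_i$ is attained, and $d_i>0$, for every $i$. Moreover: 1. (Converse.) Every sequence of tests with $P_{\max}\to0$ satisfies, for every $i$, $$\mathbb E_i[N]\ \ge\ \frac{-\log R_i}{d_i}\,(1+o(1))\ \ge\ \frac{-\log P_{\max}}{d_i}\,(1+o(1)).$$ 2. For all $a>1$ and $T>0$ the proposed test stops almost surely under every hypothesis, and $P^*_{\max}\le (M-1)/T$. 3. (Asymptotic optimality.) There is $a_0>1$, depending only on the model, such that for every $a\in(1,a_0)$, every choice of the maximizers $q_i^*$ and every tie-breaking rule, the proposed test satisfies for every $i$, as $T\to\infty$, $$\mathbb E_i[N^*]=\frac{-\log P^*_{\max}}{d_i}(1+o(1))=\Bigl(\inf_{\mathbb C(P^*_{\max})}\mathbb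 E_i[N]\Bigr)(1+o(1))$$ and $$\mathbb E_i[N^*]=\frac{-\log R^*_i}{d_i}(1+o(1))=\Bigl(\inf_{\mathbb C'(R_0^*,\dots,R_{M-1}^*)}\mathbb E_i[N]\Bigr)(1+o(1)).$$ -/

import Mathlib

open MeasureTheory ProbabilityTheory Filter Topology
open scoped ENNReal

noncomputable section

namespace ControlledSensing

/-- A controlled Markovian observation model with `M` hypotheses, control alphabet `U` and
observation alphabet `Y`: `p i u y'` is the conditional law of the current observation under
hypothesis `i`, given the current control `u` and the previous observation `y'`. All transition
probabilities are positive, and the initial observation `y₀` is a constant. -/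
structure SensingModel (M : ℕ) (U Y : Type*) where
  p : Fin M → U → Y → PMF Y
  p_pos : ∀ i u y' y, 0 < p i u y' y
  y₀ : Y

/-- The first `n` pairs `((u₁, y₁), …, (uₙ, yₙ))` of controls and observations. -/
abbrev History (U Y : Type*) (n : ℕ) := Fin n → U × Y

/-- Infinite trajectories; the entry `ω k` is the pair `(u_{k+1}, y_{k+1})`. -/
abbrev Path (U Y : Type*) := ℕ → U × Y

/-- A (randomized) causal control policy: `φ k h` is the conditional law of `U_{k+1}` given the
first `k` controls and observations `h`. -/
abbrev ControlPolicy (U Y : Type*) := (k : ℕ) → History U Y k → PMF U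

/-- The first `k` entries of a history of length `n`. -/
def History.take {U Y : Type*} {n : ℕ} (h : History U Y n) (k : ℕ) (hk : k ≤ n) :
    History U Y k :=
  fun l => h (Fin.castLE hk l)

/-- The first `n` entries of a trajectory, `(Yⁿ, Uⁿ)`. -/
def Path.take {U Y : Type*} (n : ℕ) (ω : Path U Y) : History U Y n := fun l => ω l

/-- The filtration of the controls and observations: `F n` is generated by `(Yⁿ, Uⁿ)`. -/
def historyFiltration (U Y : Type*) [MeasurableSpace U] [MeasurableSpace Y] :
    Filtration ℕ (inferInstance : MeasurableSpace (Path U Y)) where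
  seq n := MeasurableSpace.comap (Path.take n) inferInstance
  mono' := by
    intro m n hmn
    have h : (Path.take m : Path U Y → History U Y m)
        = (fun g : History U Y n => g.take m hmn) ∘ Path.take n := rfl
    have hm : Measurable (fun g : History U Y n => g.take m hmn) :=
      measurable_pi_lambda _ fun l => measurable_pi_apply _
    show MeasurableSpace.comap (Path.take m) _ ≤ MeasurableSpace.comap (Path.take n) _
    rw [h, ← MeasurableSpace.comap_comp]
    exact MeasurableSpace.comap_mono hm.comap_le
  le' n := by
    have hm : Measurable (Path.take n : Path U Y → History U Y n) :=
      measurable_pi_lambda _ fun l => measurable_pi_apply _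
    exact hm.comap_le

/-- A sequential test `(φ, N, δ)`: a causal control policy, a stopping time of the filtration of
the controls and observations, and a decision rule that is applied to `(Y^N, U^N)`. -/
structure SequentialTest (M : ℕ) (U Y : Type*) [MeasurableSpace U] [MeasurableSpace Y] where
  policy : ControlPolicy U Y
  N : Path U Y → ℕ∞
  isStoppingTime : IsStoppingTime (historyFiltration U Y) N
  δ : (n : ℕ) → History U Y n → Fin M

/-- The event that the test stops and decides for hypothesis `i`. -/
def SequentialTest.decides {M : ℕ} {U Y : Type*} [MeasurableSpace U] [MeasurableSpace Y]
    (γ : SequentialTest M U Y) (i : Fin M) : Set (Path U Y) :=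
  {ω | ∃ n : ℕ, γ.N ω = n ∧ γ.δ n (Path.take n ω) = i}

/-- The Kullback-Leibler distance of two pmfs on a finite set. -/
def klDist {Y : Type*} [Fintype Y] (p₁ p₂ : PMF Y) : ℝ :=
  ∑ y, (p₁ y).toReal * Real.log ((p₁ y).toReal / (p₂ y).toReal)

/-- `t` is a probability vector that is stationary for the transition matrix `P`. -/
def IsStationary {Y : Type*} [Fintype Y] (P : Y → Y → ℝ) (t : Y → ℝ) : Prop :=
  (∀ y, 0 ≤ t y) ∧ ∑ y, t y = 1 ∧ ∀ y, ∑ y', t y' * P y' y = t y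

/-- A positive stochastic matrix has exactly one stationary distribution. -/
theorem existsUnique_isStationary {Y : Type*} [Fintype Y] [Nonempty Y] (P : Y → Y → ℝ)
    (hpos : ∀ y' y, 0 < P y' y) (hsum : ∀ y', ∑ y, P y' y = 1) :
    ∃! t : Y → ℝ, IsStationary P t := by
  classical
  -- if `v` is invariant then so is `|v|`
  have habs : ∀ v : Y → ℝ, (∀ y, ∑ y', v y' * P y' y = v y) →
      ∀ y, ∑ y', |v y'| * P y' y = |v y| := by
    intro v hv
    have hle : ∀ y ∈ Finset.univ, |v y| ≤ ∑ y', |v y'| * P y' y := by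
      intro y _
      conv_lhs => rw [← hv y]
      refine (Finset.abs_sum_le_sum_abs _ _).trans_eq ?_
      exact Finset.sum_congr rfl fun y' _ => by rw [abs_mul, abs_of_pos (hpos y' y)]
    have htot : ∑ y, |v y| = ∑ y, ∑ y', |v y'| * P y' y := by
      rw [Finset.sum_comm]
      exact Finset.sum_congr rfl fun y' _ => by rw [← Finset.mul_sum, hsum, mul_one]
    intro y
    exact ((Finset.sum_eq_sum_iff_of_le hle).1 htot y (Finset.mem_univ y)).symm
  -- a nonzero invariant vector, from the vanishing of `det (P - 1)`
  have hdet : (Matrix.of P - 1).det = 0 := by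
    rw [← Matrix.exists_mulVec_eq_zero_iff]
    refine ⟨fun _ => 1, ?_, ?_⟩
    · intro h
      obtain ⟨y⟩ := ‹Nonempty Y›
      exact one_ne_zero (congrFun h y)
    · rw [Matrix.sub_mulVec, Matrix.one_mulVec]
      funext y
      simp [Matrix.mulVec, dotProduct, hsum]
  obtain ⟨v, hv0, hv⟩ := Matrix.exists_vecMul_eq_zero_iff.2 hdet
  have hv' : ∀ y, ∑ y', v y' * P y' y = v y := by
    intro y
    rw [Matrix.vecMul_sub, Matrix.vecMul_one] at hv
    have := congrFun hv y
    simp only [Pi.sub_apply, Pi.zero_apply, sub_eq_zero] at this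
    exact this
  have hS : 0 < ∑ y, |v y| := by
    obtain ⟨y, hy⟩ := Function.ne_iff.1 hv0
    exact Finset.sum_pos' (fun _ _ => abs_nonneg _) ⟨y, Finset.mem_univ y, abs_pos.2 hy⟩
  refine ⟨fun y => |v y| / ∑ z, |v z|, ⟨fun y => by positivity, ?_, fun y => ?_⟩, ?_⟩
  · rw [← Finset.sum_div, div_self hS.ne']
  · show ∑ y', |v y'| / (∑ z, |v z|) * P y' y = |v y| / ∑ z, |v z|
    rw [← habs v hv' y, Finset.sum_div]
    exact Finset.sum_congr rfl fun y' _ => by ring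
  -- uniqueness
  have huniq : ∀ s t : Y → ℝ, IsStationary P s → IsStationary P t → s = t := by
    intro s t hs ht
    set w : Y → ℝ := fun y => s y - t y with hw
    have hwinv : ∀ y, ∑ y', w y' * P y' y = w y := by
      intro y
      simp only [hw, sub_mul, Finset.sum_sub_distrib, hs.2.2 y, ht.2.2 y]
    have hwabs := habs w hwinv
    have hw0 : ∑ y, w y = 0 := by
      simp only [hw, Finset.sum_sub_distrib, hs.2.1, ht.2.1, sub_self]
    obtain ⟨z⟩ := ‹Nonempty Y›
    -- `|w| - w` and `|w| + w` are nonnegative and invariant, and one of them vanishes at `z`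
    have key : ∀ g : Y → ℝ, (∀ y, 0 ≤ g y) → ∑ y', g y' * P y' z = 0 → ∀ y, g y = 0 := by
      intro g hg h y
      have := (Finset.sum_eq_zero_iff_of_nonneg
        (fun y' _ => mul_nonneg (hg y') (hpos y' z).le)).1 h y (Finset.mem_univ y)
      exact (mul_eq_zero.1 this).resolve_right (hpos y z).ne'
    have hzero : ∑ y, |w y| = 0 := by
      rcases le_total 0 (w z) with hz | hz
      · have := key (fun y => |w y| - w y) (fun y => sub_nonneg.2 (le_abs_self _)) (by
          simp only [sub_mul, Finset.sum_sub_distrib, hwabs, hwinv, abs_of_nonneg hz, sub_self])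
        rw [← hw0]
        exact Finset.sum_congr rfl fun y _ => sub_eq_zero.1 (this y)
      · have := key (fun y => |w y| + w y) (fun y => by linarith [neg_abs_le (w y)]) (by
          simp only [add_mul, Finset.sum_add_distrib, hwabs, hwinv, abs_of_nonpos hz]
          ring)
        have h2 : ∑ y, (|w y| + w y) = 0 := Finset.sum_eq_zero fun y _ => this y
        rw [Finset.sum_add_distrib, hw0, add_zero] at h2
        exact h2
    funext y
    have := (Finset.sum_eq_zero_iff_of_nonneg (fun y _ => abs_nonneg (w y))).1 hzero y
      (Finset.mem_univ y)
    exact sub_eq_zero.1 (abs_eq_zero.1 this)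
  intro t ht
  refine huniq t _ ht ⟨fun y => by positivity, ?_, fun y => ?_⟩
  · rw [← Finset.sum_div, div_self hS.ne']
  · show ∑ y', |v y'| / (∑ z, |v z|) * P y' y = |v y| / ∑ z, |v z|
    rw [← habs v hv' y, Finset.sum_div]
    exact Finset.sum_congr rfl fun y' _ => by ring

/-- The first index at which `c` holds (`⊤` if there is none). -/
def firstTime (c : ℕ → Prop) : ℕ∞ := ⨅ (n : ℕ) (_ : c n), (n : ℕ∞)

theorem firstTime_le_iff (c : ℕ → Prop) (n : ℕ) : firstTime c ≤ n ↔ ∃ k ≤ n, c k := by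
  constructor
  · intro h
    by_contra! hc
    have h1 : ((n + 1 : ℕ) : ℕ∞) ≤ firstTime c :=
      le_iInf₂ fun k hk => by
        have : n + 1 ≤ k := by
          by_contra! hlt
          exact hc k (by omega) hk
        exact_mod_cast this
    have h2 : ((n + 1 : ℕ) : ℕ∞) ≤ (n : ℕ∞) := h1.trans h
    have h3 : n + 1 ≤ n := by exact_mod_cast h2
    omega
  · rintro ⟨k, hkn, hk⟩
    exact (iInf₂_le k hk).trans (by exact_mod_cast hkn)

/-- Time `k` is an exploration time: `k = ⌈a ^ ℓ⌉` for some `ℓ = 0, 1, …`. -/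
def IsExplorationTime (a : ℝ) (k : ℕ) : Prop := ∃ l : ℕ, k = ⌈a ^ l⌉₊

theorem sum_toReal_pmf {α : Type*} [Fintype α] (q : PMF α) : ∑ x, (q x).toReal = 1 := by
  rw [← ENNReal.toReal_sum (fun x _ => q.apply_ne_top x), ← tsum_fintype (L := .unconditional _),
    q.tsum_coe, ENNReal.toReal_one]

namespace SensingModel

variable {M : ℕ} {U Y : Type*}

/-- The last observation `yₙ` of a history of length `n` (for `n = 0`, the constant `y₀`). -/
def lastObs (m : SensingModel M U Y) : {n : ℕ} → History U Y n → Y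
  | 0, _ => m.y₀
  | n + 1, h => (h (Fin.last n)).2

/-- The joint pmf `p_i(yⁿ, uⁿ)` of controls and observations under hypothesis `i` and the
policy `φ`. -/
def jointPMF (m : SensingModel M U Y) (φ : ControlPolicy U Y) (i : Fin M) {n : ℕ}
    (h : History U Y n) : ℝ≥0∞ :=
  ∏ k : Fin n, φ k (h.take k k.2.le) (h k).1 * m.p i (h k).1 (m.lastObs (h.take k k.2.le)) (h k).2

/-- The conditional law of `(U_{n+1}, Y_{n+1})` given the history `h` of length `n`. -/
def stepPMF (m : SensingModel M U Y) (φ : ControlPolicy U Y) (i : Fin M) {n : ℕ}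
    (h : History U Y n) : PMF (U × Y) :=
  (φ n h).bind fun u => (m.p i u (m.lastObs h)).map fun y => (u, y)

section Finite

variable [Fintype U]

/-- The transition probabilities `p_i^q(y | y') = ∑ u, q(u | y') p_i^u(y | y')`. -/
def controlledTransition (m : SensingModel M U Y) (i : Fin M) (q : Y → PMF U) (y' y : Y) : ℝ :=
  ∑ u, (q y' u).toReal * (m.p i u y' y).toReal

theorem controlledTransition_pos (m : SensingModel M U Y) (i : Fin M) (q : Y → PMF U)
    (y' y : Y) : 0 < m.controlledTransition i q y' y := by
  obtain ⟨u, hu⟩ := (q y').support_nonempty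
  refine Finset.sum_pos' (fun _ _ => by positivity) ⟨u, Finset.mem_univ u, mul_pos ?_ ?_⟩
  · exact ENNReal.toReal_pos ((PMF.mem_support_iff _ _).1 hu) (PMF.apply_ne_top _ _)
  · exact ENNReal.toReal_pos (m.p_pos i u y' y).ne' (PMF.apply_ne_top _ _)

variable [Fintype Y]

theorem sum_controlledTransition (m : SensingModel M U Y) (i : Fin M) (q : Y → PMF U) (y' : Y) :
    ∑ y, m.controlledTransition i q y' y = 1 := by
  simp only [controlledTransition]
  rw [Finset.sum_comm]
  simp only [← Finset.mul_sum, sum_toReal_pmf, mul_one]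

theorem existsUnique_stationary (m : SensingModel M U Y) (i : Fin M) (q : Y → PMF U) :
    ∃! t : Y → ℝ, IsStationary (m.controlledTransition i q) t :=
  haveI : Nonempty Y := ⟨m.y₀⟩
  existsUnique_isStationary _ (m.controlledTransition_pos i q) (m.sum_controlledTransition i q)

/-- The unique stationary distribution `μ_i^q` of `p_i^q`. -/
def stationaryDist (m : SensingModel M U Y) (i : Fin M) (q : Y → PMF U) : Y → ℝ :=
  (m.existsUnique_stationary i q).choose

/-- The objective
`min_{j ≠ i} ∑_{y', u} μ_i^q(y') q(u | y') D(p_i^u(· | y') ‖ p_j^u(· | y'))`. -/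
def objective (m : SensingModel M U Y) (i : Fin M) (q : Y → PMF U) : ℝ :=
  ⨅ j : {j : Fin M // j ≠ i}, ∑ y', ∑ u,
    m.stationaryDist i q y' * (q y' u).toReal * klDist (m.p i u y') (m.p j u y')

/-- `q` maximizes the objective for hypothesis `i`. -/
def IsOptimalControl (m : SensingModel M U Y) (i : Fin M) (q : Y → PMF U) : Prop :=
  ∀ q' : Y → PMF U, m.objective i q' ≤ m.objective i q

/-- The coefficient `d_i`, the maximal value of the objective over all `q(· | ·)`. -/
def optCoeff (m : SensingModel M U Y) (i : Fin M) : ℝ :=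
  ⨆ q : Y → PMF U, m.objective i q

end Finite

section Law

variable [Fintype U] [MeasurableSpace U] [MeasurableSingletonClass U]
  [Fintype Y] [MeasurableSpace Y] [MeasurableSingletonClass Y]

/-- The transition kernel of the trajectory: the law of `ω (n + 1)` given `ω 0, …, ω n`. -/
def stepKernel (m : SensingModel M U Y) (φ : ControlPolicy U Y) (i : Fin M) (n : ℕ) :
    Kernel (Finset.Iic n → U × Y) (U × Y) :=
  Kernel.ofFunOfCountable fun g =>
    (m.stepPMF φ i (n := n + 1)
      fun k => g ⟨k, Finset.mem_Iic.2 (Nat.le_of_lt_succ k.2)⟩).toMeasure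

instance (m : SensingModel M U Y) (φ : ControlPolicy U Y) (i : Fin M) (n : ℕ) :
    IsMarkovKernel (m.stepKernel φ i n) :=
  ⟨fun _ => PMF.toMeasure.isProbabilityMeasure _⟩

/-- The law `ℙ_i` of all controls and observations under hypothesis `i` and the policy `φ`. -/
def law (m : SensingModel M U Y) (φ : ControlPolicy U Y) (i : Fin M) : Measure (Path U Y) :=
  Kernel.trajMeasure (X := fun _ => U × Y)
    (m.stepPMF φ i (n := 0) Fin.elim0).toMeasure (m.stepKernel φ i)

/-- `E_i[N]`. -/
def expectedTime (m : SensingModel M U Y) (γ : SequentialTest M U Y) (i : Fin M) : ℝ≥0∞ :=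
  ∫⁻ ω, (γ.N ω : ℝ≥0∞) ∂(m.law γ.policy i)

/-- The maximal probability of error, `max_i ℙ_i{δ ≠ i}`. -/
def maxError (m : SensingModel M U Y) (γ : SequentialTest M U Y) : ℝ≥0∞ :=
  ⨆ i : Fin M, m.law γ.policy i (⋃ j ≠ i, γ.decides j)

/-- The maximal decision risk `R_i = max_{j ≠ i} ℙ_j{δ = i}`. -/
def risk (m : SensingModel M U Y) (γ : SequentialTest M U Y) (i : Fin M) : ℝ≥0∞ :=
  ⨆ (j : Fin M) (_ : j ≠ i), m.law γ.policy j (γ.decides i)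

/-- The class of tests whose maximal probability of error is at most `α`. -/
def errorClass (m : SensingModel M U Y) (α : ℝ≥0∞) : Set (SequentialTest M U Y) :=
  {γ | m.maxError γ ≤ α}

/-- The class of tests whose decision risks satisfy `R_i ≤ β i` for every `i`. -/
def riskClass (m : SensingModel M U Y) (β : Fin M → ℝ≥0∞) : Set (SequentialTest M U Y) :=
  {γ | ∀ i, m.risk γ i ≤ β i}

end Law

/-- The likelihood ratio `p_i(yⁿ, uⁿ) / max_{j ≠ i} p_j(yⁿ, uⁿ)`. -/
def likelihoodRatio (m : SensingModel M U Y) (φ : ControlPolicy U Y) (i : Fin M) {n : ℕ}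
    (h : History U Y n) : ℝ≥0∞ :=
  m.jointPMF φ i h / ⨆ (j : Fin M) (_ : j ≠ i), m.jointPMF φ j h

/-- `φ` is the proposed policy with exploration parameter `a` and exploitation controls `qs`, and
`est` is its maximum likelihood estimate (with an arbitrary rule for breaking ties). -/
structure IsProposedPolicy [Fintype U] [Nonempty U] (m : SensingModel M U Y) (a : ℝ)
    (qs : Fin M → Y → PMF U) (φ : ControlPolicy U Y)
    (est : (n : ℕ) → History U Y n → Fin M) : Prop where
  ml : ∀ n (h : History U Y n) (i : Fin M), m.jointPMF φ i h ≤ m.jointPMF φ (est n h) h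
  explore : ∀ n (h : History U Y n), IsExplorationTime a (n + 1) →
    φ n h = PMF.uniformOfFintype U
  exploit : ∀ n (h : History U Y n), ¬ IsExplorationTime a (n + 1) →
    φ n h = qs (est n h) (m.lastObs h)

/-- The test that follows the policy `φ`, stops at the first `n ≥ 1` at which the likelihood ratio
of the estimate `est` exceeds `T`, and then decides for the estimate. -/
def thresholdTest [Fintype U] [MeasurableSpace U] [MeasurableSingletonClass U]
    [Fintype Y] [MeasurableSpace Y] [MeasurableSingletonClass Y]
    (m : SensingModel M U Y) (φ : ControlPolicy U Y)
    (est : (n : ℕ) → History U Y n → Fin M) (T : ℝ) : SequentialTest M U Y where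
  policy := φ
  N ω := firstTime fun n => 1 ≤ n ∧
    ENNReal.ofReal T < m.likelihoodRatio φ (est n (Path.take n ω)) (Path.take n ω)
  isStoppingTime := by
    intro n
    have h : {ω : Path U Y | firstTime (fun k => 1 ≤ k ∧ ENNReal.ofReal T <
          m.likelihoodRatio φ (est k (Path.take k ω)) (Path.take k ω)) ≤ (n : ℕ∞)}
        = Path.take n ⁻¹' {g : History U Y n | ∃ k, ∃ hk : k ≤ n, 1 ≤ k ∧ ENNReal.ofReal T <
          m.likelihoodRatio φ (est k (g.take k hk)) (g.take k hk)} := by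
      ext ω
      rw [Set.mem_preimage]
      refine (firstTime_le_iff _ n).trans ?_
      constructor
      · rintro ⟨k, hk, h⟩
        exact ⟨k, hk, h⟩
      · rintro ⟨k, hk, h⟩
        exact ⟨k, hk, h⟩
    exact ⟨_, Set.Finite.measurableSet (Set.toFinite _), h.symm⟩
  δ := est

end SensingModel

/-- `f = g (1 + o(1))` along the filter `l`. -/
def AsympEq {α : Type*} (l : Filter α) (f g : α → EReal) : Prop :=
  ∃ ε : α → ℝ, Tendsto ε l (𝓝 0) ∧ ∀ᶠ x in l, f x = g x * ((1 + ε x : ℝ) : EReal)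

/-- `-log x / d`, equal to `∞` for `x = 0`. -/
def negLogDiv (x : ℝ≥0∞) (d : ℝ) : EReal := -ENNReal.log x / (d : EReal)

end ControlledSensing

end

open ControlledSensing

/-! The converse is a change of measure. Up to the stopping time, the expected log-likelihood ratio
of `i` against `j` equals the expected numbers of visits to the observation-control pairs, weighted
by the Kullback–Leibler distances (`leafSum_log_lr`). The visits form a flow that is invariant under
the transitions of `i` except for the two endpoints of the stopped trajectory. Closing this gap
costs bounded mass, and invariant vectors of mass one are exactly the stationary laws `μ_i^q(y) q(u
| y)`. Hence for some `j ≠ i` the information is at most `d_i (E_i[N ∧ n] + C)`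
(`exists_visits_info_le`). Data processing bounds the same information from below by `-log R` times
the probability of stopping by time `n` with decision `i`, minus one (`stopWeight_mul_log_le`).
Letting `n → ∞` gives a converse with an additive constant (`exists_converse`). The same description
of the stationary laws turns `d_i` into the maximum of a continuous function on a compact set.

The error bound of the proposed test is immediate: whenever it decides for `i`, the likelihood of
`i` is at least `T` times that of every other hypothesis.

Its delay is controlled in three steps. Under uniform controls the expected square root of the
likelihood ratio contracts, so it is at most of order `σ` to the number of explorations
(`exists_affinity_le`). There are about `log_a n` explorations up to time `n`, so for `a ^ 4 * σ ≤
1` the estimate errs with probability `O(n⁻⁴)`. Consequently the controls differ from those of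
`q_i^*` at most `ε n` times, except with summable probability (`summable_law_deviations`). On that
event the log-likelihood ratio, corrected by a solution of the Poisson equation, has conditional
drift at least `d_i` at every regular step, and an exponential supermartingale yields exponential
tails (`exists_deviation_bound`). Summing tails gives `E_i[N*] ≤ log T / d + C` for each `d < d_i`
(`exists_expectedTime_le`).

Finally, the error bound, the converse and the delay bound squeeze `E_i[N*] / log T` to `1 / d_i`,
and `-log P_max / log T` and `-log R_i / log T` to `1`. The converse, applied to all competitors in
a class, does the same for the infima. -/

noncomputable section

namespace ControlledSensing

/-! ### Finite histories and their one-step extensions -/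

section Histories

variable {U Y : Type*} {n : ℕ}

/-- A history extended by one more pair. -/
def History.snoc (h : History U Y n) (x : U × Y) : History U Y (n + 1) :=
  Fin.snoc (α := fun _ => U × Y) h x

theorem History.take_snoc (h : History U Y n) (x : U × Y) (k : ℕ) (hk : k ≤ n) :
    (h.snoc x).take k (hk.trans n.le_succ) = h.take k hk := by
  funext l
  exact Fin.snoc_castSucc (α := fun _ => U × Y) x h (Fin.castLE hk l)

theorem History.snoc_last (h : History U Y n) (x : U × Y) : h.snoc x (Fin.last n) = x :=
  Fin.snoc_last (α := fun _ => U × Y) x h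

theorem History.snoc_castSucc (h : History U Y n) (x : U × Y) (k : Fin n) :
    h.snoc x k.castSucc = h k :=
  Fin.snoc_castSucc (α := fun _ => U × Y) x h k

theorem History.snoc_take_last (h : History U Y (n + 1)) :
    (h.take n n.le_succ).snoc (h (Fin.last n)) = h :=
  Fin.snoc_init_self (α := fun _ => U × Y) h

theorem Path.take_succ (ω : Path U Y) : Path.take (n + 1) ω = (Path.take n ω).snoc (ω n) :=
  (History.snoc_take_last (Path.take (n + 1) ω)).symm

theorem History.snoc_inj {h h' : History U Y n} {x x' : U × Y} :
    h.snoc x = h'.snoc x' ↔ h = h' ∧ x = x' :=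
  Fin.snoc_inj (α := fun _ => U × Y)

theorem sum_history_succ [Fintype U] [Fintype Y] {R : Type*} [AddCommMonoid R]
    (F : History U Y (n + 1) → R) : ∑ g, F g = ∑ h : History U Y n, ∑ x, F (h.snoc x) := by
  rw [← (Fin.snocEquiv fun _ => U × Y).sum_comp, Fintype.sum_prod_type_right]
  rfl

theorem measurable_take [MeasurableSpace U] [MeasurableSpace Y] (n : ℕ) :
    Measurable (Path.take n : Path U Y → History U Y n) :=
  measurable_pi_lambda _ fun _ => measurable_pi_apply _

end Histories

/-! ### The trajectory law on finite histories -/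

namespace SensingModel

variable {M : ℕ} {U Y : Type*}

theorem lastObs_snoc (m : SensingModel M U Y) {n : ℕ} (h : History U Y n) (x : U × Y) :
    m.lastObs (h.snoc x) = x.2 := by
  show (h.snoc x (Fin.last n)).2 = x.2
  rw [History.snoc_last]

theorem jointPMF_zero (m : SensingModel M U Y) (φ : ControlPolicy U Y) (i : Fin M)
    (h : History U Y 0) : m.jointPMF φ i h = 1 := by
  simp [jointPMF]

theorem jointPMF_snoc (m : SensingModel M U Y) (φ : ControlPolicy U Y) (i : Fin M) {n : ℕ}
    (h : History U Y n) (x : U × Y) :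
    m.jointPMF φ i (h.snoc x) =
      m.jointPMF φ i h * (φ n h x.1 * m.p i x.1 (m.lastObs h) x.2) := by
  rw [jointPMF, Fin.prod_univ_castSucc]
  congr 1
  · refine Finset.prod_congr rfl fun k _ => ?_
    have : (h.snoc x).take (k.castSucc : ℕ) k.castSucc.2.le = h.take k k.2.le :=
      History.take_snoc h x k k.2.le
    rw [this, History.snoc_castSucc]
    rfl
  · have : (h.snoc x).take (Fin.last n : ℕ) (Fin.last n).2.le = h :=
      History.take_snoc h x n le_rfl
    rw [this, History.snoc_last]
    rfl

theorem stepPMF_apply (m : SensingModel M U Y) (φ : ControlPolicy U Y) (i : Fin M) {n : ℕ}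
    (h : History U Y n) (x : U × Y) :
    m.stepPMF φ i h x = φ n h x.1 * m.p i x.1 (m.lastObs h) x.2 := by
  classical
  obtain ⟨u, y⟩ := x
  rw [stepPMF, PMF.bind_apply, tsum_eq_single u]
  · congr 1
    rw [PMF.map_apply, tsum_eq_single y]
    · simp
    · intro y' hy'
      simp [Prod.ext_iff, hy'.symm]
  · intro u' hu'
    rw [PMF.map_apply]
    simp [Prod.ext_iff, hu'.symm]

section Law

variable [Fintype U] [MeasurableSpace U] [MeasurableSingletonClass U]
  [Fintype Y] [MeasurableSpace Y] [MeasurableSingletonClass Y]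

instance isProbabilityMeasure_law (m : SensingModel M U Y) (φ : ControlPolicy U Y) (i : Fin M) :
    IsProbabilityMeasure (m.law φ i) := by
  have : IsProbabilityMeasure (m.stepPMF φ i (n := 0) Fin.elim0).toMeasure :=
    PMF.toMeasure.isProbabilityMeasure _
  unfold law
  infer_instance

/-- The defining composition property of the Ionescu–Tulcea measure, evaluated on singletons. The
empty history is separate because the first pair is drawn from the initial law and not from
`stepKernel`. -/
theorem law_take_eq_succ (m : SensingModel M U Y) (φ : ControlPolicy U Y) (i : Fin M) {n : ℕ}
    (h : History U Y n) (x : U × Y) :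
    m.law φ i {ω | Path.take (n + 1) ω = h.snoc x} =
      m.law φ i {ω | Path.take n ω = h} * m.stepPMF φ i h x := by
  classical
  have : IsProbabilityMeasure (m.stepPMF φ i (n := 0) Fin.elim0).toMeasure :=
    PMF.toMeasure.isProbabilityMeasure _
  simp only [Path.take_succ, History.snoc_inj]
  cases n with
  | zero =>
    have h0 : h = Fin.elim0 := Subsingleton.elim _ _
    have h1 : ∀ ω : Path U Y, Path.take 0 ω = h := fun ω => Subsingleton.elim _ _
    subst h0
    simp only [h1, true_and, Set.ofPred_true, measure_univ, one_mul]
    have hmap : (m.law φ i).map (fun ω => ω 0) = (m.stepPMF φ i (n := 0) Fin.elim0).toMeasure := by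
      have e0 : (fun ω : Path U Y => ω 0) =
          MeasurableEquiv.piUnique (fun _ : Finset.Iic 0 => U × Y) ∘
            Preorder.frestrictLe (π := fun _ => U × Y) 0 := rfl
      rw [e0, ← Measure.map_map (by fun_prop) (by fun_prop), law, Kernel.trajMeasure,
        Measure.map_comp _ _ (by fun_prop), Kernel.traj_map_frestrictLe, Kernel.partialTraj_self,
        Measure.id_comp, Measure.map_map (by fun_prop) (by fun_prop),
        MeasurableEquiv.self_comp_symm, Measure.map_id]
    have := congrArg (fun ν => ν {x}) hmap
    rw [Measure.map_apply (measurable_pi_apply 0) (measurableSet_singleton x),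
      PMF.toMeasure_apply_singleton _ _ (measurableSet_singleton x)] at this
    exact this
  | succ n =>
    -- Index shift: the coordinates up to `n` make up a history of length `n + 1`.
    set g : Finset.Iic n → U × Y := fun k => h ⟨k, Nat.lt_succ_of_le (Finset.mem_Iic.1 k.2)⟩
    have key := Kernel.map_frestrictLe_trajMeasure_compProd_eq_map_trajMeasure
      (X := fun _ => U × Y) (μ₀ := (m.stepPMF φ i (n := 0) Fin.elim0).toMeasure)
      (κ := m.stepKernel φ i) (a := n)
    have key2 := congrArg (fun ν => ν ({g} ×ˢ {x})) key
    rw [Measure.compProd_apply_prod (measurableSet_singleton g) (measurableSet_singleton x),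
      Measure.restrict_singleton, lintegral_smul_measure, lintegral_dirac,
      Measure.map_apply (by fun_prop) (measurableSet_singleton g),
      Measure.map_apply (by fun_prop) (by measurability)] at key2
    have hg : ∀ ω : Path U Y, Preorder.frestrictLe (π := fun _ => U × Y) n ω = g ↔ Path.take (n + 1) ω = h := by
      intro ω
      constructor
      · intro hω
        funext k
        exact congrFun hω ⟨k, Finset.mem_Iic.2 (Nat.le_of_lt_succ k.2)⟩
      · intro hω
        funext k
        exact congrFun hω ⟨k, Nat.lt_succ_of_le (Finset.mem_Iic.1 k.2)⟩
    have e1 : {ω : Path U Y | Path.take (n + 1) ω = h ∧ ω (n + 1) = x} =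
        (fun x : Path U Y => (Preorder.frestrictLe (π := fun _ => U × Y) n x, x (n + 1))) ⁻¹' ({g} ×ˢ {x}) := by
      ext ω
      simp [← hg]
    have e2 : {ω : Path U Y | Path.take (n + 1) ω = h} =
        (Preorder.frestrictLe (π := fun _ => U × Y) n) ⁻¹' {g} := by
      ext ω
      simp [← hg]
    have e3 : m.stepKernel φ i n g {x} = m.stepPMF φ i h x :=
      PMF.toMeasure_apply_singleton _ _ (measurableSet_singleton x)
    rw [e1, e2, ← e3]
    exact key2.symm

/-- The bridge from the measure on trajectories to finite sums over histories, in which the analysis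
is carried out. -/
theorem law_take_eq (m : SensingModel M U Y) (φ : ControlPolicy U Y) (i : Fin M) {n : ℕ}
    (h : History U Y n) : m.law φ i {ω | Path.take n ω = h} = m.jointPMF φ i h := by
  induction n with
  | zero =>
    have h1 : ∀ ω : Path U Y, Path.take 0 ω = h := fun ω => Subsingleton.elim _ _
    simp [h1, jointPMF_zero]
  | succ n ih =>
    rw [← h.snoc_take_last, law_take_eq_succ, ih, jointPMF_snoc, stepPMF_apply]

theorem law_preimage_take (m : SensingModel M U Y) (φ : ControlPolicy U Y) (i : Fin M) {n : ℕ}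
    (S : Set (History U Y n)) [DecidablePred (· ∈ S)] :
    m.law φ i (Path.take n ⁻¹' S) = ∑ h, if h ∈ S then m.jointPMF φ i h else 0 := by
  have h1 : (m.law φ i).map (Path.take n) S = ∑ h ∈ Finset.univ.filter (· ∈ S),
      (m.law φ i).map (Path.take n) {h} := by
    rw [sum_measure_singleton]
    congr 1
    ext h
    simp
  rw [Measure.map_apply (measurable_take n) (Set.toFinite S).measurableSet] at h1
  rw [h1, Finset.sum_filter]
  refine Finset.sum_congr rfl fun h _ => ?_
  rw [Measure.map_apply (measurable_take n) (measurableSet_singleton h), ← m.law_take_eq φ i h]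
  rfl

end Law

end SensingModel

/-! ### Real-valued likelihoods and expectations over histories -/

namespace SensingModel

variable {M : ℕ} {U Y : Type*}

/-- The transition probabilities as real numbers. -/
def tr (m : SensingModel M U Y) (i : Fin M) (u : U) (y' y : Y) : ℝ := (m.p i u y' y).toReal

theorem tr_pos (m : SensingModel M U Y) (i : Fin M) (u : U) (y' y : Y) : 0 < m.tr i u y' y :=
  ENNReal.toReal_pos (m.p_pos i u y' y).ne' (PMF.apply_ne_top _ _)

theorem sum_tr [Fintype Y] (m : SensingModel M U Y) (i : Fin M) (u : U) (y' : Y) :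
    ∑ y, m.tr i u y' y = 1 :=
  sum_toReal_pmf _

/-- The joint pmf as a real number. -/
def weight (m : SensingModel M U Y) (φ : ControlPolicy U Y) (i : Fin M) {n : ℕ}
    (h : History U Y n) : ℝ :=
  (m.jointPMF φ i h).toReal

theorem jointPMF_ne_top (m : SensingModel M U Y) (φ : ControlPolicy U Y) (i : Fin M) {n : ℕ}
    (h : History U Y n) : m.jointPMF φ i h ≠ ⊤ :=
  ENNReal.prod_ne_top fun _ _ => ENNReal.mul_ne_top (PMF.apply_ne_top _ _) (PMF.apply_ne_top _ _)

theorem ofReal_weight (m : SensingModel M U Y) (φ : ControlPolicy U Y) (i : Fin M) {n : ℕ}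
    (h : History U Y n) : ENNReal.ofReal (m.weight φ i h) = m.jointPMF φ i h :=
  ENNReal.ofReal_toReal (m.jointPMF_ne_top φ i h)

theorem weight_nonneg (m : SensingModel M U Y) (φ : ControlPolicy U Y) (i : Fin M) {n : ℕ}
    (h : History U Y n) : 0 ≤ m.weight φ i h :=
  ENNReal.toReal_nonneg

theorem weight_zero (m : SensingModel M U Y) (φ : ControlPolicy U Y) (i : Fin M)
    (h : History U Y 0) : m.weight φ i h = 1 := by
  simp [weight, jointPMF_zero]

theorem weight_snoc (m : SensingModel M U Y) (φ : ControlPolicy U Y) (i : Fin M) {n : ℕ}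
    (h : History U Y n) (x : U × Y) :
    m.weight φ i (h.snoc x) =
      m.weight φ i h * ((φ n h x.1).toReal * m.tr i x.1 (m.lastObs h) x.2) := by
  simp [weight, jointPMF_snoc, tr, ENNReal.toReal_mul]

/-- The likelihood ratio of hypothesis `j` to hypothesis `i`. -/
def lr (m : SensingModel M U Y) (i j : Fin M) {n : ℕ} (h : History U Y n) : ℝ :=
  ∏ k : Fin n, m.tr j (h k).1 (m.lastObs (h.take k k.2.le)) (h k).2 /
    m.tr i (h k).1 (m.lastObs (h.take k k.2.le)) (h k).2

theorem lr_zero (m : SensingModel M U Y) (i j : Fin M) (h : History U Y 0) : m.lr i j h = 1 := by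
  simp [lr]

theorem lr_snoc (m : SensingModel M U Y) (i j : Fin M) {n : ℕ}
    (h : History U Y n) (x : U × Y) :
    m.lr i j (h.snoc x) =
      m.lr i j h * (m.tr j x.1 (m.lastObs h) x.2 / m.tr i x.1 (m.lastObs h) x.2) := by
  rw [lr, Fin.prod_univ_castSucc]
  congr 1
  · refine Finset.prod_congr rfl fun k _ => ?_
    have : (h.snoc x).take (k.castSucc : ℕ) k.castSucc.2.le = h.take k k.2.le :=
      History.take_snoc h x k k.2.le
    rw [this, History.snoc_castSucc]
  · have : (h.snoc x).take (Fin.last n : ℕ) (Fin.last n).2.le = h :=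
      History.take_snoc h x n le_rfl
    rw [this, History.snoc_last]

theorem lr_pos (m : SensingModel M U Y) (i j : Fin M) {n : ℕ} (h : History U Y n) :
    0 < m.lr i j h :=
  Finset.prod_pos fun _ _ => div_pos (m.tr_pos _ _ _ _) (m.tr_pos _ _ _ _)

/-- The control probabilities cancel in the likelihood ratio, so `lr` does not involve the policy.
It is defined and positive even on histories of weight zero. -/
theorem weight_mul_lr (m : SensingModel M U Y) (φ : ControlPolicy U Y) (i j : Fin M) {n : ℕ}
    (h : History U Y n) : m.weight φ i h * m.lr i j h = m.weight φ j h := by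
  induction n with
  | zero => simp [weight_zero, lr_zero]
  | succ n ih =>
    rw [← h.snoc_take_last, weight_snoc, weight_snoc, lr_snoc, ← ih]
    have := (m.tr_pos i (h (Fin.last n)).1 (m.lastObs (h.take n n.le_succ)) (h (Fin.last n)).2).ne'
    field_simp

section Finite

variable [Fintype U] [Fintype Y]

/-- The expectation of a function of the first `n` controls and observations. -/
def expect (m : SensingModel M U Y) (φ : ControlPolicy U Y) (i : Fin M) (n : ℕ)
    (F : History U Y n → ℝ) : ℝ :=
  ∑ h, m.weight φ i h * F h

theorem expect_zero (m : SensingModel M U Y) (φ : ControlPolicy U Y) (i : Fin M)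
    (F : History U Y 0 → ℝ) : m.expect φ i 0 F = F Fin.elim0 := by
  simp only [expect, weight_zero, one_mul]
  rw [Fintype.sum_subsingleton _ (Fin.elim0 : History U Y 0)]

theorem expect_succ (m : SensingModel M U Y) (φ : ControlPolicy U Y) (i : Fin M) (n : ℕ)
    (F : History U Y (n + 1) → ℝ) :
    m.expect φ i (n + 1) F = m.expect φ i n fun h =>
      ∑ u, (φ n h u).toReal * ∑ y, m.tr i u (m.lastObs h) y * F (h.snoc (u, y)) := by
  rw [expect, sum_history_succ]
  refine Finset.sum_congr rfl fun h _ => ?_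
  rw [Fintype.sum_prod_type, Finset.mul_sum]
  refine Finset.sum_congr rfl fun u _ => ?_
  rw [Finset.mul_sum, Finset.mul_sum]
  refine Finset.sum_congr rfl fun y _ => ?_
  rw [weight_snoc]
  ring

theorem expect_mono (m : SensingModel M U Y) (φ : ControlPolicy U Y) (i : Fin M) (n : ℕ)
    {F G : History U Y n → ℝ} (h : ∀ x, F x ≤ G x) : m.expect φ i n F ≤ m.expect φ i n G :=
  Finset.sum_le_sum fun x _ => mul_le_mul_of_nonneg_left (h x) (m.weight_nonneg φ i x)

theorem expect_nonneg (m : SensingModel M U Y) (φ : ControlPolicy U Y) (i : Fin M) (n : ℕ)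
    {F : History U Y n → ℝ} (h : ∀ x, 0 ≤ F x) : 0 ≤ m.expect φ i n F :=
  Finset.sum_nonneg fun x _ => mul_nonneg (m.weight_nonneg φ i x) (h x)

theorem expect_mul_left (m : SensingModel M U Y) (φ : ControlPolicy U Y) (i : Fin M) (n : ℕ)
    (c : ℝ) (F : History U Y n → ℝ) :
    m.expect φ i n (fun h => c * F h) = c * m.expect φ i n F := by
  simp only [expect, Finset.mul_sum]
  exact Finset.sum_congr rfl fun _ _ => by ring

theorem expect_sub (m : SensingModel M U Y) (φ : ControlPolicy U Y) (i : Fin M) (n : ℕ)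
    (F G : History U Y n → ℝ) :
    m.expect φ i n (fun h => F h - G h) = m.expect φ i n F - m.expect φ i n G := by
  simp only [expect, mul_sub, Finset.sum_sub_distrib]

/-- `sum over controls and observations` of one step, bounded pointwise. -/
theorem step_le (m : SensingModel M U Y) (q : PMF U) (i : Fin M) (y' : Y)
    {F : U → Y → ℝ} {c : ℝ} (h : ∀ u y, F u y ≤ c) :
    ∑ u, (q u).toReal * ∑ y, m.tr i u y' y * F u y ≤ c := by
  calc ∑ u, (q u).toReal * ∑ y, m.tr i u y' y * F u y
      ≤ ∑ u, (q u).toReal * ∑ y, m.tr i u y' y * c := by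
        gcongr with u _ y _
        · exact (m.tr_pos _ _ _ _).le
        · exact h u y
    _ = c := by simp only [← Finset.sum_mul, sum_tr, sum_toReal_pmf, one_mul]

end Finite

section Law

variable [Fintype U] [MeasurableSpace U] [MeasurableSingletonClass U]
  [Fintype Y] [MeasurableSpace Y] [MeasurableSingletonClass Y]

open Classical in
theorem law_preimage_take_eq_expect (m : SensingModel M U Y) (φ : ControlPolicy U Y) (i : Fin M)
    {n : ℕ} (S : Set (History U Y n)) :
    m.law φ i (Path.take n ⁻¹' S) =
      ENNReal.ofReal (m.expect φ i n fun h => if h ∈ S then 1 else 0) := by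
  rw [law_preimage_take, expect, ENNReal.ofReal_sum_of_nonneg]
  · refine Finset.sum_congr rfl fun h _ => ?_
    split_ifs
    · rw [mul_one, ofReal_weight]
    · simp
  · intro h _
    have := m.weight_nonneg φ i h
    positivity

open Classical in
theorem law_real_preimage_take (m : SensingModel M U Y) (φ : ControlPolicy U Y) (i : Fin M)
    {n : ℕ} (S : Set (History U Y n)) :
    (m.law φ i).real (Path.take n ⁻¹' S) = m.expect φ i n fun h => if h ∈ S then 1 else 0 := by
  rw [Measure.real, law_preimage_take_eq_expect, ENNReal.toReal_ofReal]
  refine m.expect_nonneg φ i n fun h => ?_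
  positivity

end Law

end SensingModel

/-! ### Positive stochastic matrices: harmonic functions, Poisson equation, flows -/

section Stochastic

variable {Y : Type*} [Fintype Y] {P : Y → Y → ℝ} {μ : Y → ℝ}

theorem IsStationary.pos (hμ : IsStationary P μ) (hpos : ∀ y' y, 0 < P y' y) (y : Y) :
    0 < μ y := by
  rw [← hμ.2.2 y]
  have h : ∃ z ∈ Finset.univ, 0 < μ z := by
    by_contra! hc
    have := Finset.sum_nonpos hc
    rw [hμ.2.1] at this
    linarith
  obtain ⟨z, hz, hz'⟩ := h
  exact Finset.sum_pos' (fun y' _ => mul_nonneg (hμ.1 y') (hpos y' y).le)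
    ⟨z, hz, mul_pos hz' (hpos z y)⟩

/-- Harmonic functions of a positive stochastic matrix are constant. -/
theorem eq_of_harmonic (hpos : ∀ y' y, 0 < P y' y) (hsum : ∀ y', ∑ y, P y' y = 1)
    {g : Y → ℝ} (hg : ∀ y', ∑ y, P y' y * g y = g y') (y z : Y) : g y = g z := by
  -- Maximum principle: at a maximizer `x` the average of the nonnegative `g x - g w` with positive
  -- weights vanishes.
  obtain ⟨x, -, hx⟩ := Finset.exists_max_image Finset.univ g ⟨y, Finset.mem_univ y⟩
  have h0 : ∑ w, P x w * (g x - g w) = 0 := by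
    simp only [mul_sub, Finset.sum_sub_distrib, ← Finset.sum_mul, hsum, hg]
    ring
  have h1 : ∀ w, g w = g x := by
    intro w
    have := (Finset.sum_eq_zero_iff_of_nonneg fun w _ =>
      mul_nonneg (hpos x w).le (sub_nonneg.2 (hx w (Finset.mem_univ w)))).1 h0 w (Finset.mem_univ w)
    linarith [(mul_eq_zero.1 this).resolve_left (hpos x w).ne']
  rw [h1 y, h1 z]

/-- The matrix `1 - P + 1 μᵀ` of a positive stochastic matrix `P` is invertible. -/
theorem IsStationary.isUnit_fundamental [DecidableEq Y] (hμ : IsStationary P μ)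
    (hpos : ∀ y' y, 0 < P y' y) (hsum : ∀ y', ∑ y, P y' y = 1) :
    IsUnit (1 - Matrix.of P + Matrix.of fun _ y => μ y : Matrix Y Y ℝ) := by
  rw [← Matrix.mulVec_injective_iff_isUnit]
  refine (injective_iff_map_eq_zero
    (Matrix.mulVecLin (1 - Matrix.of P + Matrix.of fun _ y => μ y : Matrix Y Y ℝ))).2 fun g hg => ?_
  have h1 : ∀ y', g y' - ∑ y, P y' y * g y + ∑ y, μ y * g y = 0 := by
    intro y'
    have := congrFun hg y'
    simpa [Matrix.add_mulVec, Matrix.sub_mulVec, Matrix.mulVec, dotProduct] using this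
  -- Averaging the kernel equation against the stationary `μ` shows that `g` has mean zero; then `g`
  -- is harmonic, hence constant, hence zero.
  have h2 : ∑ y', μ y' * ∑ y, P y' y * g y = ∑ y, μ y * g y := by
    simp only [Finset.mul_sum]
    rw [Finset.sum_comm]
    refine Finset.sum_congr rfl fun y _ => ?_
    rw [← hμ.2.2 y, Finset.sum_mul]
    exact Finset.sum_congr rfl fun _ _ => by ring
  have h3 : ∑ y, μ y * g y = 0 := by
    have h : ∑ y', μ y' * (g y' - ∑ y, P y' y * g y + ∑ y, μ y * g y) = 0 :=
      Finset.sum_eq_zero fun y' _ => by rw [h1, mul_zero]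
    simp only [mul_add, mul_sub, Finset.sum_add_distrib, Finset.sum_sub_distrib,
      ← Finset.sum_mul, hμ.2.1, h2] at h
    linarith
  have h4 : ∀ y', ∑ y, P y' y * g y = g y' := fun y' => by linarith [h1 y']
  funext y
  have h5 : ∑ z, μ z * g z = g y := by
    rw [← one_mul (g y), ← hμ.2.1, Finset.sum_mul]
    exact Finset.sum_congr rfl fun z _ => by rw [eq_of_harmonic hpos hsum h4 z y]
  rw [← h5, h3]
  rfl

/-- The Poisson equation of a positive stochastic matrix. -/
theorem IsStationary.exists_poisson (hμ : IsStationary P μ)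
    (hpos : ∀ y' y, 0 < P y' y) (hsum : ∀ y', ∑ y, P y' y = 1) (f : Y → ℝ) :
    ∃ g : Y → ℝ, ∀ y', f y' + ∑ y, P y' y * g y - g y' = ∑ y, μ y * f y := by
  classical
  -- The right-hand side is centred, so averaging against `μ` shows that the rank-one term
  -- contributes nothing and `(1 - P) g` remains.
  obtain ⟨g, hg⟩ := Matrix.mulVec_surjective_iff_isUnit.2 (hμ.isUnit_fundamental hpos hsum)
    fun y' => f y' - ∑ y, μ y * f y
  refine ⟨g, fun y' => ?_⟩
  have h1 : ∀ y', g y' - ∑ y, P y' y * g y + ∑ y, μ y * g y = f y' - ∑ y, μ y * f y := by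
    intro y'
    have := congrFun hg y'
    simp only [Matrix.add_mulVec, Matrix.sub_mulVec, Matrix.one_mulVec] at this
    simpa [Matrix.mulVec, dotProduct] using this
  have h2 : ∑ y', μ y' * ∑ y, P y' y * g y = ∑ y, μ y * g y := by
    simp only [Finset.mul_sum]
    rw [Finset.sum_comm]
    refine Finset.sum_congr rfl fun y _ => ?_
    rw [← hμ.2.2 y, Finset.sum_mul]
    exact Finset.sum_congr rfl fun _ _ => by ring
  have h3 : ∑ y, μ y * g y = 0 := by
    have h : ∑ y', μ y' * (g y' - ∑ y, P y' y * g y + ∑ y, μ y * g y) =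
        ∑ y', μ y' * (f y' - ∑ y, μ y * f y) := Finset.sum_congr rfl fun y' _ => by rw [h1]
    simp only [mul_add, mul_sub, Finset.sum_add_distrib, Finset.sum_sub_distrib,
      ← Finset.sum_mul, hμ.2.1, h2] at h
    linarith
  linarith [h1 y']

/-- Every balanced vector is the divergence of a nonnegative vector. -/
theorem IsStationary.exists_flow (hμ : IsStationary P μ)
    (hpos : ∀ y' y, 0 < P y' y) (hsum : ∀ y', ∑ y, P y' y = 1) (b : Y → ℝ) (hb : ∑ y, b y = 0) :
    ∃ w : Y → ℝ, (∀ y, 0 ≤ w y) ∧ ∀ y, ∑ y', w y' * P y' y - w y = -b y := by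
  classical
  obtain ⟨w, hw⟩ := Matrix.vecMul_surjective_iff_isUnit.2 (hμ.isUnit_fundamental hpos hsum) b
  have h1 : ∀ y, w y - ∑ y', w y' * P y' y + (∑ y', w y') * μ y = b y := by
    intro y
    have := congrFun hw y
    simp only [Matrix.vecMul_add, Matrix.vecMul_sub, Matrix.vecMul_one] at this
    simpa [Matrix.vecMul, dotProduct, Finset.sum_mul] using this
  have h2 : ∑ y, ∑ y', w y' * P y' y = ∑ y', w y' := by
    rw [Finset.sum_comm]
    simp only [← Finset.mul_sum, hsum, mul_one]
  have h3 : ∑ y, w y = 0 := by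
    have h : ∑ y, (w y - ∑ y', w y' * P y' y + (∑ y', w y') * μ y) = ∑ y, b y :=
      Finset.sum_congr rfl fun y _ => h1 y
    simp only [Finset.sum_add_distrib, Finset.sum_sub_distrib, ← Finset.mul_sum, hμ.2.1, h2, hb] at h
    linarith
  have hμp := hμ.pos hpos
  -- Adding a multiple of the invariant `μ` leaves the divergence unchanged; this multiple is large
  -- enough to make every entry nonnegative.
  refine ⟨fun y => w y + (∑ z, |w z| / μ z) * μ y, fun y => ?_, fun y => ?_⟩
  · have h4 : |w y| / μ y ≤ ∑ z, |w z| / μ z :=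
      Finset.single_le_sum (f := fun z => |w z| / μ z)
        (fun z _ => div_nonneg (abs_nonneg _) (hμp z).le) (Finset.mem_univ y)
    have h5 : |w y| ≤ (∑ z, |w z| / μ z) * μ y := (div_le_iff₀ (hμp y)).1 h4
    linarith [neg_abs_le (w y)]
  · have h6 := h1 y
    rw [h3] at h6
    have h7 : ∑ y', (w y' + (∑ z, |w z| / μ z) * μ y') * P y' y =
        ∑ y', w y' * P y' y + (∑ z, |w z| / μ z) * μ y := by
      simp only [add_mul, Finset.sum_add_distrib, mul_assoc]
      rw [← Finset.mul_sum, hμ.2.2]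
    rw [h7]
    linarith

end Stochastic

/-! ### Conditional pmfs and positivity of the Kullback–Leibler distance -/

/-- A probability vector as a pmf. -/
def pmfOfReal {U : Type*} [Fintype U] (f : U → ℝ) (hf : ∀ u, 0 ≤ f u) (hs : ∑ u, f u = 1) :
    PMF U :=
  PMF.ofFintype (fun u => ENNReal.ofReal (f u)) (by
    rw [← ENNReal.ofReal_sum_of_nonneg fun u _ => hf u, hs, ENNReal.ofReal_one])

theorem pmfOfReal_toReal {U : Type*} [Fintype U] (f : U → ℝ) (hf : ∀ u, 0 ≤ f u)
    (hs : ∑ u, f u = 1) (u : U) : (pmfOfReal f hf hs u).toReal = f u := by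
  simp [pmfOfReal, ENNReal.toReal_ofReal (hf u)]

/-- Conditional pmfs of a nonnegative function on a product. -/
theorem exists_conditional {U Y : Type*} [Fintype U] [Nonempty U] (ν : Y → U → ℝ)
    (hν : ∀ y u, 0 ≤ ν y u) : ∃ q : Y → PMF U, ∀ y u, ν y u = (∑ v, ν y v) * (q y u).toReal := by
  refine Classical.axiomOfChoice (r := fun y (q : PMF U) => ∀ u, ν y u = (∑ v, ν y v) * (q u).toReal) ?_
  intro y
  rcases eq_or_ne (∑ v, ν y v) 0 with h0 | h0
  · refine ⟨PMF.uniformOfFintype U, fun u => ?_⟩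
    rw [h0, zero_mul]
    exact (Finset.sum_eq_zero_iff_of_nonneg fun v _ => hν y v).1 h0 u (Finset.mem_univ u)
  · refine ⟨pmfOfReal (fun u => ν y u / ∑ v, ν y v)
      (fun u => div_nonneg (hν y u) (Finset.sum_nonneg fun v _ => hν y v)) ?_, fun u => ?_⟩
    · rw [← Finset.sum_div, div_self h0]
    · rw [pmfOfReal_toReal]
      field_simp

/-- Gibbs' inequality: `1 - 1/x ≤ log x` is averaged over `p`, and the lower bound sums to zero as
both pmfs have mass one. It is strict at a point where they differ. -/
theorem klDist_nonneg_of_pos {Y : Type*} [Fintype Y] {p q : PMF Y} (hp : ∀ y, 0 < p y)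
    (hq : ∀ y, 0 < q y) : 0 ≤ klDist p q ∧ (p ≠ q → 0 < klDist p q) := by
  have hp' : ∀ y, 0 < (p y).toReal := fun y => ENNReal.toReal_pos (hp y).ne' (p.apply_ne_top y)
  have hq' : ∀ y, 0 < (q y).toReal := fun y => ENNReal.toReal_pos (hq y).ne' (q.apply_ne_top y)
  have hs : ∑ y, ((p y).toReal - (q y).toReal) = 0 := by
    rw [Finset.sum_sub_distrib, sum_toReal_pmf, sum_toReal_pmf, sub_self]
  have hterm : ∀ y, (p y).toReal - (q y).toReal ≤
      (p y).toReal * Real.log ((p y).toReal / (q y).toReal) := by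
    intro y
    have h := Real.one_sub_inv_le_log_of_pos (div_pos (hp' y) (hq' y))
    have h2 := mul_le_mul_of_nonneg_left h (hp' y).le
    refine le_trans (le_of_eq ?_) h2
    have := (hp' y).ne'
    field_simp
  refine ⟨?_, fun hne => ?_⟩
  · rw [← hs]
    exact Finset.sum_le_sum fun y _ => hterm y
  · rw [← hs]
    obtain ⟨y, hy⟩ : ∃ y, p y ≠ q y := by
      by_contra! hc
      exact hne (PMF.ext hc)
    refine Finset.sum_lt_sum (fun y _ => hterm y) ⟨y, Finset.mem_univ y, ?_⟩
    have hy' : (p y).toReal ≠ (q y).toReal := fun h =>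
      hy ((ENNReal.toReal_eq_toReal_iff' (p.apply_ne_top y) (q.apply_ne_top y)).1 h)
    have hne1 : (q y).toReal / (p y).toReal ≠ 1 := fun h =>
      hy' ((div_eq_one_iff_eq (hp' y).ne').1 h).symm
    have h := Real.log_lt_sub_one_of_pos (div_pos (hq' y) (hp' y)) hne1
    have h3 : Real.log ((p y).toReal / (q y).toReal) = -Real.log ((q y).toReal / (p y).toReal) := by
      rw [← Real.log_inv, inv_div]
    rw [h3]
    have h2 := mul_lt_mul_of_pos_left h (hp' y)
    have h4 : (p y).toReal * ((q y).toReal / (p y).toReal - 1) = (q y).toReal - (p y).toReal := by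
      have := (hp' y).ne'
      field_simp
    linarith

/-! ### Occupation vectors and the optimization problem for `d_i` -/

namespace SensingModel

variable {M : ℕ} {U Y : Type*} [Fintype Y]

/-- The information distance of hypotheses `i` and `j` for control `u` after observation `y'`. -/
def kl (m : SensingModel M U Y) (i j : Fin M) (u : U) (y' : Y) : ℝ :=
  klDist (m.p i u y') (m.p j u y')

theorem kl_nonneg (m : SensingModel M U Y) (i j : Fin M) (u : U) (y' : Y) : 0 ≤ m.kl i j u y' :=
  (klDist_nonneg_of_pos (m.p_pos i u y') (m.p_pos j u y')).1

theorem kl_eq_sum (m : SensingModel M U Y) (i j : Fin M) (u : U) (y' : Y) :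
    m.kl i j u y' = ∑ y, m.tr i u y' y * Real.log (m.tr i u y' y / m.tr j u y' y) :=
  rfl

variable [Fintype U]

/-- A nonnegative vector on observations and controls that is invariant under the transition
probabilities of hypothesis `i`. -/
def Balanced (m : SensingModel M U Y) (i : Fin M) (ν : Y → U → ℝ) : Prop :=
  (∀ y u, 0 ≤ ν y u) ∧ ∀ y, ∑ y', ∑ u, ν y' u * m.tr i u y' y = ∑ u, ν y u

theorem isStationary_stationaryDist (m : SensingModel M U Y) (i : Fin M) (q : Y → PMF U) :
    IsStationary (m.controlledTransition i q) (m.stationaryDist i q) :=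
  (m.existsUnique_stationary i q).choose_spec.1

theorem eq_stationaryDist (m : SensingModel M U Y) (i : Fin M) (q : Y → PMF U) {t : Y → ℝ}
    (ht : IsStationary (m.controlledTransition i q) t) : t = m.stationaryDist i q :=
  (m.existsUnique_stationary i q).choose_spec.2 t ht

theorem stationaryDist_pos (m : SensingModel M U Y) (i : Fin M) (q : Y → PMF U) (y : Y) :
    0 < m.stationaryDist i q y :=
  (m.isStationary_stationaryDist i q).pos (m.controlledTransition_pos i q) y

/-- The stationary law of observation and control. -/
def occupation (m : SensingModel M U Y) (i : Fin M) (q : Y → PMF U) (y : Y) (u : U) : ℝ :=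
  m.stationaryDist i q y * (q y u).toReal

theorem sum_occupation (m : SensingModel M U Y) (i : Fin M) (q : Y → PMF U) (y : Y) :
    ∑ u, m.occupation i q y u = m.stationaryDist i q y := by
  simp only [occupation, ← Finset.mul_sum, sum_toReal_pmf, mul_one]

theorem balanced_occupation (m : SensingModel M U Y) (i : Fin M) (q : Y → PMF U) :
    m.Balanced i (m.occupation i q) := by
  refine ⟨fun y u => mul_nonneg (m.stationaryDist_pos i q y).le ENNReal.toReal_nonneg, fun y => ?_⟩
  rw [sum_occupation, ← (m.isStationary_stationaryDist i q).2.2 y]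
  refine Finset.sum_congr rfl fun y' _ => ?_
  rw [controlledTransition, Finset.mul_sum]
  refine Finset.sum_congr rfl fun u _ => ?_
  simp only [occupation, tr, mul_assoc]

/-- Disintegration: the observation marginal of `ν` is stationary for the conditional pmf `q` of
`ν`, hence equal to `μ_i^q` by uniqueness. With `balanced_occupation`, the nonlinear dependence on
`q` is thus traded for linear constraints on `ν`. -/
theorem Balanced.exists_eq_occupation [Nonempty U] {m : SensingModel M U Y} {i : Fin M}
    {ν : Y → U → ℝ} (hν : m.Balanced i ν) (hs : ∑ y, ∑ u, ν y u = 1) :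
    ∃ q, ν = m.occupation i q := by
  obtain ⟨q, hq⟩ := exists_conditional ν hν.1
  refine ⟨q, ?_⟩
  have h : (fun y => ∑ u, ν y u) = m.stationaryDist i q := by
    refine m.eq_stationaryDist i q ⟨fun y => Finset.sum_nonneg fun u _ => hν.1 y u, hs, fun y => ?_⟩
    beta_reduce
    rw [← hν.2 y]
    refine Finset.sum_congr rfl fun y' _ => ?_
    rw [controlledTransition, Finset.mul_sum]
    refine Finset.sum_congr rfl fun u _ => ?_
    rw [hq y' u, ← mul_assoc]
    rfl
  funext y u
  rw [hq y u, occupation, ← h]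

/-- The information rate of an occupation vector, minimized over the alternatives. -/
def minInfo (m : SensingModel M U Y) (i : Fin M) (ν : Y → U → ℝ) : ℝ :=
  ⨅ j : {j : Fin M // j ≠ i}, ∑ y, ∑ u, ν y u * m.kl i j u y

theorem objective_eq_minInfo (m : SensingModel M U Y) (i : Fin M) (q : Y → PMF U) :
    m.objective i q = m.minInfo i (m.occupation i q) :=
  rfl

theorem nonempty_ne (hM : 2 ≤ M) (i : Fin M) : Nonempty {j : Fin M // j ≠ i} :=
  haveI : Nontrivial (Fin M) := Fin.nontrivial_iff_two_le.2 hM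
  let ⟨j, hj⟩ := exists_ne i
  ⟨⟨j, hj⟩⟩

theorem continuous_minInfo (hM : 2 ≤ M) (m : SensingModel M U Y) (i : Fin M) :
    Continuous (m.minInfo i) := by
  have := nonempty_ne hM i
  have h : m.minInfo i = fun ν => Finset.univ.inf' Finset.univ_nonempty
      fun j : {j : Fin M // j ≠ i} => ∑ y, ∑ u, ν y u * m.kl i j u y := by
    funext ν
    rw [Finset.inf'_univ_eq_ciInf]
    rfl
  rw [h]
  refine Continuous.finset_inf'_apply _ fun j _ => ?_
  fun_prop

theorem minInfo_le (m : SensingModel M U Y) {i j : Fin M} (hj : j ≠ i) (ν : Y → U → ℝ) :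
    m.minInfo i ν ≤ ∑ y, ∑ u, ν y u * m.kl i j u y :=
  ciInf_le (f := fun j : {j : Fin M // j ≠ i} => ∑ y, ∑ u, ν y u * m.kl i j u y)
    (Set.finite_range _).bddBelow ⟨j, hj⟩

theorem exists_minInfo_eq (hM : 2 ≤ M) (m : SensingModel M U Y) (i : Fin M) (ν : Y → U → ℝ) :
    ∃ j ≠ i, ∑ y, ∑ u, ν y u * m.kl i j u y = m.minInfo i ν := by
  have := nonempty_ne hM i
  obtain ⟨j, hj⟩ := exists_eq_ciInf_of_finite
    (f := fun j : {j : Fin M // j ≠ i} => ∑ y, ∑ u, ν y u * m.kl i j u y)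
  exact ⟨j, j.2, hj⟩

theorem isCompact_balanced (m : SensingModel M U Y) (i : Fin M) :
    IsCompact {ν : Y → U → ℝ | m.Balanced i ν ∧ ∑ y, ∑ u, ν y u = 1} := by
  refine (isCompact_Icc (a := (0 : Y → U → ℝ)) (b := 1)).of_isClosed_subset ?_ ?_
  · simp only [Balanced, Set.ofPred_and, Set.ofPred_forall]
    refine ((isClosed_iInter fun y => isClosed_iInter fun u => ?_).inter
      (isClosed_iInter fun y => ?_)).inter ?_
    · exact isClosed_le (by fun_prop) (by fun_prop)
    · exact isClosed_eq (by fun_prop) (by fun_prop)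
    · exact isClosed_eq (by fun_prop) (by fun_prop)
  · rintro ν ⟨hν, hs⟩
    refine ⟨fun y u => hν.1 y u, fun y u => ?_⟩
    show ν y u ≤ 1
    rw [← hs]
    exact (Finset.single_le_sum (f := ν y) (fun u _ => hν.1 y u) (Finset.mem_univ u)).trans
      (Finset.single_le_sum (f := fun y => ∑ u, ν y u)
        (fun y _ => Finset.sum_nonneg fun u _ => hν.1 y u) (Finset.mem_univ y))

theorem sum_sum_occupation (m : SensingModel M U Y) (i : Fin M) (q : Y → PMF U) :
    ∑ y, ∑ u, m.occupation i q y u = 1 := by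
  simp only [sum_occupation, (m.isStationary_stationaryDist i q).2.1]

/-- In terms of occupation vectors the objective is a minimum of finitely many linear functions on a
compact set; a maximizing vector comes from some `q`. -/
theorem exists_isOptimalControl [Nonempty U] (hM : 2 ≤ M) (m : SensingModel M U Y) (i : Fin M) :
    ∃ q, m.IsOptimalControl i q := by
  obtain ⟨ν, ⟨hν, hs⟩, hmax⟩ := (m.isCompact_balanced i).exists_isMaxOn
    ⟨m.occupation i fun _ => PMF.uniformOfFintype U, m.balanced_occupation i _,
      m.sum_sum_occupation i _⟩
    (m.continuous_minInfo hM i).continuousOn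
  obtain ⟨q, rfl⟩ := hν.exists_eq_occupation hs
  exact ⟨q, fun q' => hmax ⟨m.balanced_occupation i q', m.sum_sum_occupation i q'⟩⟩

theorem IsOptimalControl.objective_eq {m : SensingModel M U Y} {i : Fin M} {q : Y → PMF U}
    (hq : m.IsOptimalControl i q) : m.objective i q = m.optCoeff i := by
  have : Nonempty (Y → PMF U) := ⟨q⟩
  exact le_antisymm (le_ciSup (f := m.objective i) ⟨_, Set.forall_mem_range.2 hq⟩ q) (ciSup_le hq)

theorem objective_le_optCoeff [Nonempty U] (hM : 2 ≤ M) (m : SensingModel M U Y) (i : Fin M)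
    (q : Y → PMF U) : m.objective i q ≤ m.optCoeff i := by
  obtain ⟨q', hq'⟩ := m.exists_isOptimalControl hM i
  exact (hq' q).trans_eq hq'.objective_eq

/-- Uniform controls already achieve a positive value: they visit every pair with positive
stationary probability, and each alternative is separated by some pair. -/
theorem optCoeff_pos [Nonempty U] (hM : 2 ≤ M) (m : SensingModel M U Y)
    (hdist : ∀ i j : Fin M, i ≠ j → ∃ u y', m.p i u y' ≠ m.p j u y') (i : Fin M) :
    0 < m.optCoeff i := by
  refine lt_of_lt_of_le ?_ (m.objective_le_optCoeff hM i fun _ => PMF.uniformOfFintype U)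
  rw [objective_eq_minInfo]
  obtain ⟨j, hj, he⟩ := m.exists_minInfo_eq hM i (m.occupation i fun _ => PMF.uniformOfFintype U)
  rw [← he]
  obtain ⟨u, y, huy⟩ := hdist i j hj.symm
  have hnn : ∀ y u, 0 ≤ m.occupation i (fun _ => PMF.uniformOfFintype U) y u * m.kl i j u y :=
    fun y u => mul_nonneg ((m.balanced_occupation i _).1 y u) (m.kl_nonneg i j u y)
  refine Finset.sum_pos' (fun y _ => Finset.sum_nonneg fun u _ => hnn y u)
    ⟨y, Finset.mem_univ y, Finset.sum_pos' (fun u _ => hnn y u) ⟨u, Finset.mem_univ u, ?_⟩⟩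
  refine mul_pos (mul_pos (m.stationaryDist_pos i _ y) ?_)
    ((klDist_nonneg_of_pos (m.p_pos i u y) (m.p_pos j u y)).2 huy)
  simp [PMF.uniformOfFintype_apply, ENNReal.toReal_inv, Fintype.card_pos]

/-- Both sides are homogeneous in `ν`, so this is the optimality of `d_i` after normalization; the
zero vector cannot be normalized and is trivial. -/
theorem Balanced.exists_info_le [Nonempty U] (hM : 2 ≤ M) {m : SensingModel M U Y} {i : Fin M}
    {ν : Y → U → ℝ} (hν : m.Balanced i ν) :
    ∃ j ≠ i, ∑ y, ∑ u, ν y u * m.kl i j u y ≤ m.optCoeff i * ∑ y, ∑ u, ν y u := by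
  set s := ∑ y, ∑ u, ν y u with hs
  have hs0 : 0 ≤ s := Finset.sum_nonneg fun y _ => Finset.sum_nonneg fun u _ => hν.1 y u
  obtain ⟨j, hj, he⟩ := m.exists_minInfo_eq hM i ν
  refine ⟨j, hj, ?_⟩
  rcases hs0.eq_or_lt with h0 | h0
  · have hz : ∀ y u, ν y u = 0 := by
      intro y u
      have h1 := (Finset.sum_eq_zero_iff_of_nonneg
        fun y _ => Finset.sum_nonneg fun u _ => hν.1 y u).1 h0.symm y (Finset.mem_univ y)
      exact (Finset.sum_eq_zero_iff_of_nonneg fun u _ => hν.1 y u).1 h1 u (Finset.mem_univ u)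
    simp [hz, ← h0]
  · have hb : m.Balanced i fun y u => s⁻¹ * ν y u := by
      refine ⟨fun y u => mul_nonneg (inv_nonneg.2 hs0) (hν.1 y u), fun y => ?_⟩
      simp only [mul_assoc, ← Finset.mul_sum, hν.2 y]
    obtain ⟨q, hq⟩ := hb.exists_eq_occupation (by
      simp only [← Finset.mul_sum, ← hs]
      exact inv_mul_cancel₀ h0.ne')
    have h1 := m.objective_le_optCoeff hM i q
    rw [objective_eq_minInfo, ← hq] at h1
    obtain ⟨k, hk, hke⟩ := m.exists_minInfo_eq hM i fun y u => s⁻¹ * ν y u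
    rw [← hke] at h1
    simp only [mul_assoc, ← Finset.mul_sum] at h1
    have h2 := m.minInfo_le hk ν
    rw [he]
    refine h2.trans ?_
    rwa [inv_mul_le_iff₀ h0, mul_comm] at h1

end SensingModel

/-! ### Stopping rules on the tree of histories -/

section Stopping

variable {U Y : Type*}

/-- `S k` is the set of histories of length `k` at which a stopping rule has stopped: once it has
stopped, it does not start again. -/
def IsStoppingRule (S : (k : ℕ) → Set (History U Y k)) : Prop :=
  ∀ k (h : History U Y k) (x : U × Y), h ∈ S k → h.snoc x ∈ S (k + 1)

/-- The histories at which the stopping rule `S` stops. -/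
def stopSet (S : (k : ℕ) → Set (History U Y k)) : (k : ℕ) → Set (History U Y k)
  | 0 => S 0
  | k + 1 => {h | h.take k k.le_succ ∉ S k ∧ h ∈ S (k + 1)}

open Classical in
/-- The indicator of the histories at which the rule `S` has not stopped yet. -/
def alive (S : (k : ℕ) → Set (History U Y k)) (k : ℕ) (h : History U Y k) : ℝ :=
  if h ∈ S k then 0 else 1

open Classical in
/-- The indicator of the histories at which the rule `S` stops. -/
def stopInd (S : (k : ℕ) → Set (History U Y k)) (k : ℕ) (h : History U Y k) : ℝ :=
  if h ∈ stopSet S k then 1 else 0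

variable {S : (k : ℕ) → Set (History U Y k)}

theorem alive_nonneg (k : ℕ) (h : History U Y k) : 0 ≤ alive S k h := by
  unfold alive; positivity

theorem stopInd_nonneg (k : ℕ) (h : History U Y k) : 0 ≤ stopInd S k h := by
  unfold stopInd; positivity

theorem stopInd_zero_add (h : History U Y 0) : stopInd S 0 h + alive S 0 h = 1 := by
  by_cases h0 : h ∈ S 0 <;> simp [stopInd, alive, stopSet, h0]

/-- Conservation along the tree: each child of a running history either stops or keeps running, and
nothing happens below a stopped one. -/
theorem stopInd_succ_add (hS : IsStoppingRule S) {k : ℕ} (h : History U Y k) (x : U × Y) :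
    stopInd S (k + 1) (h.snoc x) + alive S (k + 1) (h.snoc x) = alive S k h := by
  have e : (h.snoc x).take k k.le_succ = h := History.take_snoc h x k le_rfl
  by_cases h0 : h ∈ S k
  · simp [stopInd, alive, stopSet, h0, e, hS k h x h0]
  · by_cases h1 : h.snoc x ∈ S (k + 1) <;> simp [stopInd, alive, stopSet, h0, e, h1]

variable [Fintype U] [Fintype Y]

/-- The sum of `F` over all histories at which the rule `S`, truncated at `n`, stops. -/
def leafSum (S : (k : ℕ) → Set (History U Y k)) (F : (k : ℕ) → History U Y k → ℝ) (n : ℕ) : ℝ :=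
  ∑ k ∈ Finset.range (n + 1), ∑ h, stopInd S k h * F k h + ∑ h, alive S n h * F n h

theorem leafSum_zero (F : (k : ℕ) → History U Y k → ℝ) : leafSum S F 0 = F 0 Fin.elim0 := by
  simp only [leafSum, zero_add, Finset.sum_range_one]
  rw [← Finset.sum_add_distrib]
  simp only [← add_mul, stopInd_zero_add, one_mul]
  rw [Fintype.sum_subsingleton _ (Fin.elim0 : History U Y 0)]

theorem leafSum_succ (hS : IsStoppingRule S) (F : (k : ℕ) → History U Y k → ℝ) (n : ℕ) :
    leafSum S F (n + 1) = leafSum S F n +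
      ∑ h, alive S n h * (∑ x, F (n + 1) (h.snoc x) - F n h) := by
  have h1 : ∑ h, stopInd S (n + 1) h * F (n + 1) h + ∑ h, alive S (n + 1) h * F (n + 1) h =
      ∑ h, alive S n h * ∑ x, F (n + 1) (h.snoc x) := by
    rw [← Finset.sum_add_distrib, sum_history_succ]
    refine Finset.sum_congr rfl fun h _ => ?_
    rw [Finset.mul_sum]
    refine Finset.sum_congr rfl fun x _ => ?_
    rw [← add_mul, stopInd_succ_add hS]
  rw [leafSum, Finset.sum_range_succ, add_assoc, h1, leafSum]
  simp only [mul_sub, Finset.sum_sub_distrib]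
  ring

/-- Optional stopping as a telescoping identity: the value at the truncated stopping time is the
initial value plus all one-step drifts at running histories. Probability weights are part of `F`. -/
theorem leafSum_eq (hS : IsStoppingRule S) (F : (k : ℕ) → History U Y k → ℝ) (n : ℕ) :
    leafSum S F n = F 0 Fin.elim0 + ∑ k ∈ Finset.range n,
      ∑ h, alive S k h * (∑ x, F (k + 1) (h.snoc x) - F k h) := by
  induction n with
  | zero => simp [leafSum_zero]
  | succ n ih => rw [leafSum_succ hS, ih, Finset.sum_range_succ, add_assoc]

theorem leafSum_mono {F G : (k : ℕ) → History U Y k → ℝ} (hFG : ∀ k h, F k h ≤ G k h) (n : ℕ) :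
    leafSum S F n ≤ leafSum S G n := by
  unfold leafSum
  gcongr with k _ h _ h _
  · exact stopInd_nonneg k h
  · exact hFG k h
  · exact alive_nonneg n h
  · exact hFG n h

theorem leafSum_sum {ι : Type*} (s : Finset ι) (F : ι → (k : ℕ) → History U Y k → ℝ) (n : ℕ) :
    leafSum S (fun k h => ∑ i ∈ s, F i k h) n = ∑ i ∈ s, leafSum S (F i) n := by
  simp only [leafSum, Finset.mul_sum, Finset.sum_add_distrib]
  congr 1
  · rw [Finset.sum_comm]
    conv_rhs => rw [Finset.sum_comm]
    rw [Finset.sum_comm]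
    refine Finset.sum_congr rfl fun k _ => Finset.sum_comm
  · exact Finset.sum_comm

end Stopping

/-! ### Wald-type identities, data processing and the information bound -/

namespace SensingModel

variable {M : ℕ} {U Y : Type*} [Fintype U] [Fintype Y] {S : (k : ℕ) → Set (History U Y k)}

theorem sum_weight_snoc (m : SensingModel M U Y) (φ : ControlPolicy U Y) (i : Fin M) {n : ℕ}
    (h : History U Y n) (G : U → Y → ℝ) :
    ∑ x, m.weight φ i (h.snoc x) * G x.1 x.2 =
      m.weight φ i h * ∑ u, (φ n h u).toReal * ∑ y, m.tr i u (m.lastObs h) y * G u y := by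
  rw [Fintype.sum_prod_type, Finset.mul_sum]
  refine Finset.sum_congr rfl fun u _ => ?_
  rw [Finset.mul_sum, Finset.mul_sum]
  refine Finset.sum_congr rfl fun y _ => ?_
  rw [weight_snoc]
  ring

theorem sum_weight_snoc_one (m : SensingModel M U Y) (φ : ControlPolicy U Y) (i : Fin M) {n : ℕ}
    (h : History U Y n) : ∑ x, m.weight φ i (h.snoc x) = m.weight φ i h := by
  have := m.sum_weight_snoc φ i h fun _ _ => 1
  simpa only [mul_one, sum_tr, sum_toReal_pmf] using this

theorem leafSum_weight (m : SensingModel M U Y) (φ : ControlPolicy U Y) (i : Fin M)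
    (hS : IsStoppingRule S) (n : ℕ) : leafSum S (fun _ h => m.weight φ i h) n = 1 := by
  simp [leafSum_eq hS, weight_zero, sum_weight_snoc_one]

/-- The expected number of visits, before stopping or time `n`, to an observation and a control. -/
def visits (m : SensingModel M U Y) (φ : ControlPolicy U Y) (i : Fin M)
    (S : (k : ℕ) → Set (History U Y k)) (n : ℕ) (y : Y) (u : U) : ℝ :=
  ∑ k ∈ Finset.range n, ∑ h, alive S k h * (m.weight φ i h *
    open Classical in if m.lastObs h = y then (φ k h u).toReal else 0)

theorem visits_nonneg (m : SensingModel M U Y) (φ : ControlPolicy U Y) (i : Fin M) (n : ℕ) (y : Y)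
    (u : U) : 0 ≤ m.visits φ i S n y u := by
  refine Finset.sum_nonneg fun k _ => Finset.sum_nonneg fun h _ => ?_
  refine mul_nonneg (alive_nonneg k h) (mul_nonneg (m.weight_nonneg φ i h) ?_)
  split_ifs <;> positivity

open Classical in
theorem sum_visits_mul (m : SensingModel M U Y) (φ : ControlPolicy U Y) (i : Fin M) (n : ℕ)
    (c : Y → U → ℝ) :
    ∑ y, ∑ u, m.visits φ i S n y u * c y u = ∑ k ∈ Finset.range n, ∑ h, alive S k h *
      (m.weight φ i h * ∑ u, (φ k h u).toReal * c (m.lastObs h) u) := by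
  simp only [visits, Finset.sum_mul]
  have h1 : ∀ y, ∑ u, ∑ k ∈ Finset.range n, ∑ h, alive S k h * (m.weight φ i h *
      (if m.lastObs h = y then (φ k h u).toReal else 0)) * c y u = ∑ k ∈ Finset.range n, ∑ h, ∑ u,
      alive S k h * (m.weight φ i h * (if m.lastObs h = y then (φ k h u).toReal else 0)) * c y u := by
    intro y
    rw [Finset.sum_comm]
    exact Finset.sum_congr rfl fun k _ => Finset.sum_comm
  rw [Finset.sum_congr rfl fun y _ => h1 y, Finset.sum_comm]
  refine Finset.sum_congr rfl fun k _ => ?_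
  rw [Finset.sum_comm]
  refine Finset.sum_congr rfl fun h _ => ?_
  rw [Finset.sum_comm, Finset.mul_sum, Finset.mul_sum]
  refine Finset.sum_congr rfl fun u _ => ?_
  rw [Finset.sum_eq_single (m.lastObs h)]
  · simp only [if_true]
    ring
  · intro y _ hy
    simp [hy.symm]
  · simp

/-- The expected stopping time truncated at `n`. -/
def meanTime (m : SensingModel M U Y) (φ : ControlPolicy U Y) (i : Fin M)
    (S : (k : ℕ) → Set (History U Y k)) (n : ℕ) : ℝ :=
  ∑ k ∈ Finset.range n, ∑ h, alive S k h * m.weight φ i h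

theorem sum_visits (m : SensingModel M U Y) (φ : ControlPolicy U Y) (i : Fin M) (n : ℕ) :
    ∑ y, ∑ u, m.visits φ i S n y u = m.meanTime φ i S n := by
  simpa only [mul_one, sum_toReal_pmf, meanTime] using m.sum_visits_mul (S := S) φ i n fun _ _ => 1

-- Flow balance: every visit passes its mass on through the transition law, so the only mismatch
-- comes from the endpoints of the stopped trajectory, namely the law of its last observation and
-- the point mass at the initial one.
open Classical in
theorem sum_visits_tr (m : SensingModel M U Y) (φ : ControlPolicy U Y) (i : Fin M)
    (hS : IsStoppingRule S) (n : ℕ) (y : Y) :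
    ∑ y', ∑ u, m.visits φ i S n y' u * m.tr i u y' y - ∑ u, m.visits φ i S n y u =
      leafSum S (fun _ h => m.weight φ i h * if m.lastObs h = y then 1 else 0) n -
        if m.y₀ = y then 1 else 0 := by
  have h1 : ∑ u, m.visits φ i S n y u = ∑ k ∈ Finset.range n, ∑ h, alive S k h *
      (m.weight φ i h * if m.lastObs h = y then 1 else 0) := by
    have := m.sum_visits_mul (S := S) φ i n fun y' _ => if y' = y then 1 else 0
    rw [Finset.sum_eq_single y (fun b _ hb => by simp [hb]) (by simp)] at this
    simpa only [if_true, mul_one, ← Finset.sum_mul, sum_toReal_pmf, one_mul] using this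
  rw [leafSum_eq hS, h1, sum_visits_mul, ← Finset.sum_sub_distrib, weight_zero, one_mul,
    show m.lastObs (Fin.elim0 : History U Y 0) = m.y₀ from rfl, add_sub_cancel_left]
  refine Finset.sum_congr rfl fun k _ => ?_
  rw [← Finset.sum_sub_distrib]
  refine Finset.sum_congr rfl fun h _ => ?_
  have h2 := m.sum_weight_snoc φ i h fun _ y' => if y' = y then 1 else 0
  simp only [lastObs_snoc]
  rw [h2, ← mul_sub]
  simp

/-- The expected log-likelihood ratio at the stopping time truncated at `n`. -/
theorem leafSum_log_lr (m : SensingModel M U Y) (φ : ControlPolicy U Y) (i j : Fin M)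
    (hS : IsStoppingRule S) (n : ℕ) :
    leafSum S (fun _ h => -(m.weight φ i h * Real.log (m.lr i j h))) n =
      ∑ y, ∑ u, m.visits φ i S n y u * m.kl i j u y := by
  rw [leafSum_eq hS, lr_zero, Real.log_one, mul_zero, neg_zero, zero_add, sum_visits_mul]
  refine Finset.sum_congr rfl fun k _ => Finset.sum_congr rfl fun h _ => ?_
  have h1 : ∑ x, -(m.weight φ i (h.snoc x) * Real.log (m.lr i j (h.snoc x))) =
      ∑ x, m.weight φ i (h.snoc x) * (-Real.log (m.lr i j h) +
        Real.log (m.tr i x.1 (m.lastObs h) x.2 / m.tr j x.1 (m.lastObs h) x.2)) := by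
    refine Finset.sum_congr rfl fun x _ => ?_
    have hi := m.tr_pos i x.1 (m.lastObs h) x.2
    have hj := m.tr_pos j x.1 (m.lastObs h) x.2
    rw [lr_snoc, Real.log_mul (m.lr_pos i j h).ne' (div_pos hj hi).ne', Real.log_div hj.ne' hi.ne',
      Real.log_div hi.ne' hj.ne']
    ring
  rw [h1]
  simp only [mul_add, Finset.sum_add_distrib, ← Finset.sum_mul, sum_weight_snoc_one]
  rw [m.sum_weight_snoc φ i h fun u y =>
    Real.log (m.tr i u (m.lastObs h) y / m.tr j u (m.lastObs h) y)]
  simp only [kl_eq_sum]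
  ring

open Classical in
/-- The weight, under hypothesis `i`, of stopping at time `k` in the set `A`. -/
def stopTerm (m : SensingModel M U Y) (φ : ControlPolicy U Y) (i : Fin M)
    (S A : (k : ℕ) → Set (History U Y k)) (k : ℕ) : ℝ :=
  ∑ h, stopInd S k h * if h ∈ A k then m.weight φ i h else 0

theorem stopTerm_nonneg (m : SensingModel M U Y) (φ : ControlPolicy U Y) (i : Fin M)
    (A : (k : ℕ) → Set (History U Y k)) (k : ℕ) : 0 ≤ m.stopTerm φ i S A k := by
  refine Finset.sum_nonneg fun h _ => ?_
  have h1 := stopInd_nonneg (S := S) k h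
  have h2 := m.weight_nonneg φ i h
  positivity

/-- The weight, under hypothesis `i`, of stopping by time `n` in the set `A`. -/
def stopWeight (m : SensingModel M U Y) (φ : ControlPolicy U Y) (i : Fin M)
    (S A : (k : ℕ) → Set (History U Y k)) (n : ℕ) : ℝ :=
  ∑ k ∈ Finset.range (n + 1), m.stopTerm φ i S A k

theorem stopWeight_nonneg (m : SensingModel M U Y) (φ : ControlPolicy U Y) (i : Fin M)
    (A : (k : ℕ) → Set (History U Y k)) (n : ℕ) : 0 ≤ m.stopWeight φ i S A n :=
  Finset.sum_nonneg fun k _ => m.stopTerm_nonneg φ i A k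

/-- Data processing: the information collected bounds the log of an error probability. -/
theorem stopWeight_mul_log_le (m : SensingModel M U Y) (φ : ControlPolicy U Y) (i j : Fin M)
    (hS : IsStoppingRule S) (A : (k : ℕ) → Set (History U Y k)) (n : ℕ) {r : ℝ} (hr : 0 < r)
    (hb : r * m.stopWeight φ j S A n ≤ 1) :
    m.stopWeight φ i S A n * Real.log r - 1 ≤ ∑ y, ∑ u, m.visits φ i S n y u * m.kl i j u y := by
  classical
  rw [← m.leafSum_log_lr φ i j hS n]
  -- This is `log (s * lr) ≤ s * lr - 1` times the weight. It is used with `s = r` on histories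
  -- stopping in `A` and with `s = 1` on all others.
  have hlog : ∀ (s : ℝ), 0 < s → ∀ k (h : History U Y k),
      m.weight φ i h * Real.log s + m.weight φ i h - s * m.weight φ j h ≤
        -(m.weight φ i h * Real.log (m.lr i j h)) := by
    intro s hs k h
    have hl := m.lr_pos i j h
    have h1 := Real.log_le_sub_one_of_pos (mul_pos hs hl)
    rw [Real.log_mul hs.ne' hl.ne'] at h1
    have h2 := mul_le_mul_of_nonneg_left h1 (m.weight_nonneg φ i h)
    rw [← m.weight_mul_lr φ i j h]
    linarith
  have hlog1 : ∀ k (h : History U Y k), m.weight φ i h - m.weight φ j h ≤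
        -(m.weight φ i h * Real.log (m.lr i j h)) := fun k h => by
    simpa using hlog 1 one_pos k h
  -- Both hypotheses have total mass one on the leaves, so the linear terms cancel and only the
  -- contribution of `A` survives.
  have hw : ∑ k ∈ Finset.range (n + 1), ∑ h, stopInd S k h * (m.weight φ i h - m.weight φ j h) +
      ∑ h, alive S n h * (m.weight φ i h - m.weight φ j h) = 0 := by
    have e1 := m.leafSum_weight φ i hS n
    have e2 := m.leafSum_weight φ j hS n
    simp only [leafSum] at e1 e2
    simp only [mul_sub, Finset.sum_sub_distrib]
    linarith
  have hmain : ∑ k ∈ Finset.range (n + 1), ∑ h, (stopInd S k h * (m.weight φ i h - m.weight φ j h) +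
      ((stopInd S k h * if h ∈ A k then m.weight φ i h else 0) * Real.log r -
        (r - 1) * (stopInd S k h * if h ∈ A k then m.weight φ j h else 0))) +
      ∑ h, alive S n h * (m.weight φ i h - m.weight φ j h) ≤
      leafSum S (fun _ h => -(m.weight φ i h * Real.log (m.lr i j h))) n := by
    unfold leafSum
    refine add_le_add (Finset.sum_le_sum fun k _ => Finset.sum_le_sum fun h _ => ?_)
      (Finset.sum_le_sum fun h _ => mul_le_mul_of_nonneg_left (hlog1 n h) (alive_nonneg n h))
    by_cases hA : h ∈ A k
    · have h1 := mul_le_mul_of_nonneg_left (hlog r hr k h) (stopInd_nonneg (S := S) k h)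
      simp only [hA, if_true]
      linarith
    · have h1 := mul_le_mul_of_nonneg_left (hlog1 k h) (stopInd_nonneg (S := S) k h)
      simpa only [hA, if_false, mul_zero, zero_mul, sub_zero, add_zero] using h1
  refine le_trans ?_ hmain
  simp only [Finset.sum_add_distrib, Finset.sum_sub_distrib, ← Finset.sum_mul, ← Finset.mul_sum]
  have hb0 := m.stopWeight_nonneg (S := S) φ j A n
  have ha : m.stopWeight φ i S A n = ∑ k ∈ Finset.range (n + 1), ∑ h,
    stopInd S k h * if h ∈ A k then m.weight φ i h else 0 := rfl
  have hb' : m.stopWeight φ j S A n = ∑ k ∈ Finset.range (n + 1), ∑ h,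
    stopInd S k h * if h ∈ A k then m.weight φ j h else 0 := rfl
  rw [← ha, ← hb']
  linarith

/-- The information collected against some alternative is at most `d_i` times the expected time,
up to a constant. -/
theorem exists_visits_info_le [Nonempty U] (hM : 2 ≤ M) (m : SensingModel M U Y) (i : Fin M) :
    ∃ C : ℝ, ∀ (φ : ControlPolicy U Y) (S : (k : ℕ) → Set (History U Y k)), IsStoppingRule S →
      ∀ n, ∃ j ≠ i, ∑ y, ∑ u, m.visits φ i S n y u * m.kl i j u y ≤
        m.optCoeff i * (m.meanTime φ i S n + C) := by
  classical
  set q : Y → PMF U := fun _ => PMF.uniformOfFintype U with hq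
  -- The vector `w y₁` plays the role of the visits on a trajectory from `y₁` back to `m.y₀`.
  -- Appending it closes a trajectory that was stopped at `y₁`.
  have hflow : ∀ y₁ : Y, ∃ w : Y → ℝ, (∀ y, 0 ≤ w y) ∧
      ∀ y, ∑ y', w y' * m.controlledTransition i q y' y - w y =
        -((if y₁ = y then 1 else 0) - if m.y₀ = y then 1 else 0) := fun y₁ =>
    (m.isStationary_stationaryDist i q).exists_flow (m.controlledTransition_pos i q)
      (m.sum_controlledTransition i q) _ (by simp)
  choose w hw0 hw using hflow
  refine ⟨∑ y₁, ∑ y, w y₁ y, fun φ S hS n => ?_⟩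
  set v : Y → ℝ := fun y =>
    leafSum S (fun _ h => m.weight φ i h * if m.lastObs h = y then 1 else 0) n with hv
  have hv0 : ∀ y, 0 ≤ v y := by
    intro y
    have := leafSum_mono (S := S) (F := fun _ _ => 0)
      (G := fun _ h => m.weight φ i h * if m.lastObs h = y then 1 else 0) (fun k h => by
        have := m.weight_nonneg φ i h
        positivity) n
    have h0 : leafSum S (fun _ _ => 0) n = 0 := by simp [leafSum]
    rwa [h0] at this
  have hvs : ∑ y, v y = 1 := by
    rw [← m.leafSum_weight φ i hS n, hv, ← leafSum_sum]
    congr 1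
    funext k h
    simp
  -- The visits, completed by return flows weighted with the law `v` of the last observation. As `v
  -- ≤ 1`, the added mass is at most the total mass of all `w y₁`, whatever the policy and the
  -- stopping rule.
  set ν : Y → U → ℝ := fun y u =>
    m.visits φ i S n y u + (∑ y₁, v y₁ * w y₁ y) * (q y u).toReal with hν
  have hx0 : ∀ y u, 0 ≤ (∑ y₁, v y₁ * w y₁ y) * (q y u).toReal := fun y u =>
    mul_nonneg (Finset.sum_nonneg fun y₁ _ => mul_nonneg (hv0 y₁) (hw0 y₁ y)) ENNReal.toReal_nonneg
  have hbal : m.Balanced i ν := by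
    refine ⟨fun y u => add_nonneg (m.visits_nonneg φ i n y u) (hx0 y u), fun y => ?_⟩
    have h1 := m.sum_visits_tr φ i hS n y
    have h2 : ∑ y', ∑ u, (∑ y₁, v y₁ * w y₁ y') * (q y' u).toReal * m.tr i u y' y =
        ∑ y₁, v y₁ * ∑ y', w y₁ y' * m.controlledTransition i q y' y := by
      simp only [Finset.mul_sum]
      conv_rhs => rw [Finset.sum_comm]
      refine Finset.sum_congr rfl fun y' _ => ?_
      simp only [mul_assoc, ← Finset.mul_sum]
      rw [Finset.sum_mul]
      exact Finset.sum_congr rfl fun y₁ _ => by rw [mul_assoc]; rfl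
    have h3 : ∑ y₁, v y₁ * (∑ y', w y₁ y' * m.controlledTransition i q y' y - w y₁ y) =
        -(v y - if m.y₀ = y then 1 else 0) := by
      simp only [hw, mul_neg, mul_sub, Finset.sum_neg_distrib, Finset.sum_sub_distrib,
        ← Finset.sum_mul, hvs]
      simp
    simp only [mul_sub, Finset.sum_sub_distrib] at h3
    simp only [hν, add_mul, Finset.sum_add_distrib, h2, ← Finset.mul_sum, sum_toReal_pmf, mul_one]
    linarith
  obtain ⟨j, hj, hle⟩ := hbal.exists_info_le hM
  refine ⟨j, hj, le_trans ?_ (hle.trans ?_)⟩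
  · refine Finset.sum_le_sum fun y _ => Finset.sum_le_sum fun u _ => ?_
    exact mul_le_mul_of_nonneg_right (le_add_of_nonneg_right (hx0 y u)) (m.kl_nonneg i j u y)
  · have hd : 0 ≤ m.optCoeff i := by
      refine le_trans ?_ (m.objective_le_optCoeff hM i q)
      obtain ⟨k, hk, he⟩ := m.exists_minInfo_eq hM i (m.occupation i q)
      rw [objective_eq_minInfo, ← he]
      exact Finset.sum_nonneg fun y _ => Finset.sum_nonneg fun u _ =>
        mul_nonneg ((m.balanced_occupation i q).1 y u) (m.kl_nonneg i k u y)
    refine mul_le_mul_of_nonneg_left ?_ hd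
    simp only [hν, Finset.sum_add_distrib, sum_visits, ← Finset.mul_sum, sum_toReal_pmf, mul_one]
    refine add_le_add le_rfl ?_
    rw [Finset.sum_comm]
    refine Finset.sum_le_sum fun y₁ _ => ?_
    rw [← Finset.mul_sum]
    refine mul_le_of_le_one_left (Finset.sum_nonneg fun y _ => hw0 y₁ y) ?_
    rw [← hvs]
    exact Finset.single_le_sum (fun y _ => hv0 y) (Finset.mem_univ y₁)

end SensingModel

/-! ### Sequential tests as stopping rules and the nonasymptotic converse -/

theorem exists_take_eq {U Y : Type*} [Nonempty (U × Y)] {n : ℕ} (h : History U Y n) :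
    ∃ ω : Path U Y, Path.take n ω = h := by
  obtain ⟨x⟩ := ‹Nonempty (U × Y)›
  exact ⟨fun l => if hl : l < n then h ⟨l, hl⟩ else x, funext fun l => by simp [Path.take]⟩

/-- The layer-cake formula, which makes the expected stopping time a sum of tail probabilities. -/
theorem toENNReal_eq_tsum (N : ℕ∞) :
    (N : ℝ≥0∞) = ∑' k : ℕ, {n : ℕ∞ | (k : ℕ∞) < n}.indicator 1 N := by
  induction N using ENat.recTopCoe with
  | top => simp [Set.indicator]
  | coe n =>
    rw [tsum_eq_sum (s := Finset.range n)]
    · rw [Finset.sum_congr rfl (g := fun _ => (1 : ℝ≥0∞)) fun k hk => by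
        simpa [Set.indicator] using hk]
      simp
    · intro k hk
      simpa [Set.indicator] using hk

section

variable {M : ℕ} {U Y : Type*} [MeasurableSpace U] [MeasurableSpace Y]

/-- Events at time `k` are pulled back from histories of length `k`. Every history is the prefix of
some path, so monotonicity of `N ω ≤ k` in `k` descends from paths to histories. -/
theorem SequentialTest.exists_stoppingRule [Nonempty (U × Y)] (γ : SequentialTest M U Y) :
    ∃ S : (k : ℕ) → Set (History U Y k), IsStoppingRule S ∧
      ∀ (k : ℕ) ω, γ.N ω ≤ (k : ℕ∞) ↔ Path.take k ω ∈ S k := by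
  have h : ∀ k : ℕ, ∃ s : Set (History U Y k), Path.take k ⁻¹' s = {ω | γ.N ω ≤ (k : ℕ∞)} := by
    intro k
    obtain ⟨s, -, hs⟩ := γ.isStoppingTime k
    exact ⟨s, hs⟩
  choose S hS using h
  have hS' : ∀ (k : ℕ) ω, γ.N ω ≤ (k : ℕ∞) ↔ Path.take k ω ∈ S k := fun k ω => by
    rw [← Set.mem_preimage, hS]
    rfl
  refine ⟨S, fun k h x hh => ?_, hS'⟩
  obtain ⟨ω, hω⟩ := exists_take_eq (h.snoc x)
  have h1 : Path.take k ω = h := by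
    rw [Path.take_succ, History.snoc_inj] at hω
    exact hω.1
  rw [← hω, ← hS']
  rw [← h1, ← hS'] at hh
  exact hh.trans (by exact_mod_cast k.le_succ)

theorem SequentialTest.eq_iff_mem_stopSet {γ : SequentialTest M U Y}
    {S : (k : ℕ) → Set (History U Y k)} (hS : ∀ (k : ℕ) ω, γ.N ω ≤ (k : ℕ∞) ↔ Path.take k ω ∈ S k)
    (k : ℕ) (ω : Path U Y) : γ.N ω = k ↔ Path.take k ω ∈ stopSet S k := by
  cases k with
  | zero =>
    rw [stopSet, ← hS]
    simp
  | succ k =>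
    have e : (Path.take (k + 1) ω).take k k.le_succ = Path.take k ω := rfl
    show _ ↔ (Path.take (k + 1) ω).take k k.le_succ ∉ S k ∧ Path.take (k + 1) ω ∈ S (k + 1)
    rw [e, ← hS, ← hS, not_le, Nat.cast_succ, ← Order.add_one_le_iff_of_not_isMax (by simp)]
    exact ⟨fun h => ⟨h.ge, h.le⟩, fun h => le_antisymm h.2 h.1⟩

theorem SequentialTest.setOf_lt_eq {γ : SequentialTest M U Y}
    {S : (k : ℕ) → Set (History U Y k)} (hS : ∀ (k : ℕ) ω, γ.N ω ≤ (k : ℕ∞) ↔ Path.take k ω ∈ S k)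
    (k : ℕ) : {ω | (k : ℕ∞) < γ.N ω} = Path.take k ⁻¹' (S k)ᶜ := by
  ext ω
  simp [← hS]

end

namespace SensingModel

variable {M : ℕ} {U Y : Type*} [Fintype U] [MeasurableSpace U] [MeasurableSingletonClass U]
  [Fintype Y] [MeasurableSpace Y] [MeasurableSingletonClass Y]

theorem measurableSet_preimage_take {n : ℕ} (S : Set (History U Y n)) :
    MeasurableSet (Path.take n ⁻¹' S) :=
  measurable_take n (Set.toFinite S).measurableSet

theorem expectedTime_eq_tsum (m : SensingModel M U Y) (γ : SequentialTest M U Y) (i : Fin M) :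
    m.expectedTime γ i = ∑' k : ℕ, m.law γ.policy i {ω | (k : ℕ∞) < γ.N ω} := by
  have : Nonempty (U × Y) := by
    obtain ⟨ω⟩ := nonempty_of_isProbabilityMeasure (m.law γ.policy i)
    exact ⟨ω 0⟩
  obtain ⟨S, -, hS⟩ := γ.exists_stoppingRule
  have hm : ∀ k : ℕ, MeasurableSet {ω | (k : ℕ∞) < γ.N ω} := fun k => by
    rw [SequentialTest.setOf_lt_eq hS]
    exact measurableSet_preimage_take _
  rw [expectedTime]
  simp only [toENNReal_eq_tsum]
  rw [lintegral_tsum]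
  · refine tsum_congr fun k => ?_
    rw [← lintegral_indicator_one (hm k)]
    rfl
  · intro k
    exact (measurable_one.indicator (hm k)).aemeasurable

theorem law_lt_N (m : SensingModel M U Y) (φ : ControlPolicy U Y) (i : Fin M)
    {γ : SequentialTest M U Y} {S : (k : ℕ) → Set (History U Y k)}
    (hS : ∀ (k : ℕ) ω, γ.N ω ≤ (k : ℕ∞) ↔ Path.take k ω ∈ S k) (k : ℕ) :
    m.law φ i {ω | (k : ℕ∞) < γ.N ω} = ENNReal.ofReal (∑ h, alive S k h * m.weight φ i h) := by
  classical
  rw [SequentialTest.setOf_lt_eq hS, law_preimage_take_eq_expect, expect]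
  congr 1
  refine Finset.sum_congr rfl fun h _ => ?_
  by_cases h0 : h ∈ S k <;> simp [alive, h0]

theorem ofReal_meanTime_le (m : SensingModel M U Y) (γ : SequentialTest M U Y) (i : Fin M)
    {S : (k : ℕ) → Set (History U Y k)} (hS : ∀ (k : ℕ) ω, γ.N ω ≤ (k : ℕ∞) ↔ Path.take k ω ∈ S k)
    (n : ℕ) : ENNReal.ofReal (m.meanTime γ.policy i S n) ≤ m.expectedTime γ i := by
  rw [expectedTime_eq_tsum, meanTime, ENNReal.ofReal_sum_of_nonneg]
  · simp only [← m.law_lt_N γ.policy i hS]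
    exact ENNReal.sum_le_tsum _
  · exact fun k _ => Finset.sum_nonneg fun h _ =>
      mul_nonneg (alive_nonneg k h) (m.weight_nonneg _ i h)

theorem hasSum_law_decides (m : SensingModel M U Y) (φ : ControlPolicy U Y) (i j : Fin M)
    (γ : SequentialTest M U Y)
    {S : (k : ℕ) → Set (History U Y k)} (hS : ∀ (k : ℕ) ω, γ.N ω ≤ (k : ℕ∞) ↔ Path.take k ω ∈ S k) :
    HasSum (m.stopTerm φ j S fun k => {h | γ.δ k h = i})
      ((m.law φ j).real (γ.decides i)) := by
  classical
  have e : γ.decides i = ⋃ k : ℕ, Path.take k ⁻¹' (stopSet S k ∩ {h | γ.δ k h = i}) := by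
    ext ω
    simp only [SequentialTest.decides, Set.mem_iUnion, Set.mem_preimage, Set.mem_inter_iff,
      ← SequentialTest.eq_iff_mem_stopSet hS]
    rfl
  have hd : Pairwise (Function.onFun Disjoint fun k : ℕ =>
      Path.take k ⁻¹' (stopSet S k ∩ {h | γ.δ k h = i})) := by
    intro k l hkl
    refine Set.disjoint_left.2 fun ω hk hl => hkl ?_
    have h1 := (SequentialTest.eq_iff_mem_stopSet hS k ω).2 hk.1
    have h2 := (SequentialTest.eq_iff_mem_stopSet hS l ω).2 hl.1
    rw [h1] at h2
    exact_mod_cast h2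
  rw [e]
  have hU := measure_iUnion (μ := m.law φ j) hd fun k => measurableSet_preimage_take _
  have hne : ∑' k : ℕ, m.law φ j (Path.take k ⁻¹' (stopSet S k ∩ {h | γ.δ k h = i})) ≠ ⊤ := by
    rw [← hU]
    exact measure_ne_top _ _
  have h := ENNReal.hasSum_toReal hne
  rw [← ENNReal.tsum_toReal_eq fun k => ENNReal.ne_top_of_tsum_ne_top hne k, ← hU] at h
  convert h using 1
  swap
  · rfl
  funext k
  rw [← Measure.real, law_real_preimage_take, expect, stopTerm]
  refine Finset.sum_congr rfl fun h _ => ?_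
  by_cases h0 : h ∈ stopSet S k <;> by_cases h1 : γ.δ k h = i <;> simp [stopInd, h0, h1]

/-- A finite mean forces termination almost surely, so up to a null set the test either errs or
decides for `i`. -/
theorem one_sub_maxError_le (m : SensingModel M U Y) (γ : SequentialTest M U Y) (i : Fin M)
    (h : m.expectedTime γ i ≠ ⊤) :
    1 - (m.maxError γ).toReal ≤ (m.law γ.policy i).real (γ.decides i) := by
  have : Nonempty (U × Y) := by
    obtain ⟨ω⟩ := nonempty_of_isProbabilityMeasure (m.law γ.policy i)
    exact ⟨ω 0⟩
  obtain ⟨S, -, hS⟩ := γ.exists_stoppingRule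
  have h0 : m.law γ.policy i {ω | γ.N ω = ⊤} = 0 := by
    have h1 : ∀ k : ℕ, m.law γ.policy i {ω | γ.N ω = ⊤} ≤ m.law γ.policy i {ω | (k : ℕ∞) < γ.N ω} :=
      fun k => measure_mono fun ω (hω : γ.N ω = ⊤) => by
        show (k : ℕ∞) < γ.N ω
        rw [hω]
        exact ENat.natCast_lt_top k
    rw [expectedTime_eq_tsum] at h
    by_contra hne
    refine h (top_le_iff.1 ?_)
    rw [← ENNReal.tsum_const_eq_top_of_ne_zero (α := ℕ) hne]
    exact ENNReal.tsum_le_tsum h1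
  have hcov : (Set.univ : Set (Path U Y)) ⊆
      γ.decides i ∪ (⋃ j ≠ i, γ.decides j) ∪ {ω | γ.N ω = ⊤} := by
    intro ω _
    rcases eq_or_ne (γ.N ω) ⊤ with ht | ht
    · exact Or.inr ht
    · obtain ⟨n, hn⟩ := ENat.ne_top_iff_exists.1 ht
      refine Or.inl ?_
      rcases eq_or_ne (γ.δ n (Path.take n ω)) i with hi | hi
      · exact Or.inl ⟨n, hn.symm, hi⟩
      · exact Or.inr (Set.mem_iUnion₂.2 ⟨_, hi, n, hn.symm, rfl⟩)
  have h2 := (measureReal_mono hcov (μ := m.law γ.policy i)).trans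
    ((measureReal_union_le _ _).trans (add_le_add (measureReal_union_le _ _) le_rfl))
  have h3 : (m.law γ.policy i).real {ω | γ.N ω = ⊤} = 0 := by rw [Measure.real, h0]; rfl
  have hle1 : m.maxError γ ≤ 1 := iSup_le fun i => prob_le_one
  have h4 : (m.law γ.policy i).real (⋃ j ≠ i, γ.decides j) ≤ (m.maxError γ).toReal :=
    ENNReal.toReal_mono (ne_top_of_le_ne_top ENNReal.one_ne_top hle1)
      (le_iSup (fun i => m.law γ.policy i (⋃ j ≠ i, γ.decides j)) i)
  rw [probReal_univ, h3] at h2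
  linarith

/-- The converse, in nonasymptotic form. -/
theorem exists_converse [Nonempty U] (hM : 2 ≤ M) (m : SensingModel M U Y) (i : Fin M) :
    ∃ C : ℝ, 0 ≤ C ∧ ∀ (γ : SequentialTest M U Y) (R : ℝ), 0 < R → R ≤ 1 →
      m.risk γ i ≤ ENNReal.ofReal R → m.expectedTime γ i ≠ ⊤ →
      (1 - (m.maxError γ).toReal) * -Real.log R ≤
        m.optCoeff i * (m.expectedTime γ i).toReal + C := by
  obtain ⟨C, hC⟩ := m.exists_visits_info_le hM i
  refine ⟨|m.optCoeff i * C| + 1, by positivity, fun γ R hR hR1 hrisk hE => ?_⟩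
  have : Nonempty (U × Y) := ⟨(Classical.arbitrary U, m.y₀)⟩
  obtain ⟨S, hSr, hS⟩ := γ.exists_stoppingRule
  have hd : 0 ≤ m.optCoeff i := by
    refine le_trans ?_ (m.objective_le_optCoeff hM i fun _ => PMF.uniformOfFintype U)
    obtain ⟨k, hk, he⟩ := m.exists_minInfo_eq hM i (m.occupation i fun _ => PMF.uniformOfFintype U)
    rw [objective_eq_minInfo, ← he]
    exact Finset.sum_nonneg fun y _ => Finset.sum_nonneg fun u _ =>
      mul_nonneg ((m.balanced_occupation i _).1 y u) (m.kl_nonneg i k u y)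
  set A : (k : ℕ) → Set (History U Y k) := fun k => {h | γ.δ k h = i} with hA
  have hsum : ∀ j, HasSum (m.stopTerm γ.policy j S A)
      ((m.law γ.policy j).real (γ.decides i)) := fun j => m.hasSum_law_decides γ.policy i j γ hS
  have hlogR : 0 ≤ -Real.log R := neg_nonneg.2 (Real.log_nonpos hR.le hR1)
  have hn : ∀ n, m.stopWeight γ.policy i S A n * -Real.log R ≤
      m.optCoeff i * (m.expectedTime γ i).toReal + (|m.optCoeff i * C| + 1) := by
    intro n
    -- The alternative `j` may change with `n`; this is harmless because the risk bound is uniform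
    -- over the alternatives.
    obtain ⟨j, hj, hle⟩ := hC γ.policy S hSr n
    have hb : R⁻¹ * m.stopWeight γ.policy j S A n ≤ 1 := by
      rw [inv_mul_le_iff₀ hR, mul_one]
      have h1 : m.stopWeight γ.policy j S A n ≤ (m.law γ.policy j).real (γ.decides i) :=
        sum_le_hasSum _ (fun k _ => m.stopTerm_nonneg _ j A k) (hsum j)
      refine h1.trans (ENNReal.toReal_le_of_le_ofReal hR.le (le_trans ?_ hrisk))
      exact le_iSup₂ (f := fun (j : Fin M) (_ : j ≠ i) => m.law γ.policy j (γ.decides i)) j hj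
    have h2 := m.stopWeight_mul_log_le γ.policy i j hSr A n (inv_pos.2 hR) hb
    rw [Real.log_inv] at h2
    have h3 : m.meanTime γ.policy i S n ≤ (m.expectedTime γ i).toReal :=
      (ENNReal.ofReal_le_iff_le_toReal hE).1 (m.ofReal_meanTime_le γ i hS n)
    have h4 := mul_le_mul_of_nonneg_left h3 hd
    have h5 := le_abs_self (m.optCoeff i * C)
    linarith
  -- The truncation is removed only here: the probabilities of deciding for `i` by time `n` increase
  -- to that of ever doing so.
  have hlim : Tendsto (fun n => m.stopWeight γ.policy i S A n * -Real.log R) atTop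
      (𝓝 ((m.law γ.policy i).real (γ.decides i) * -Real.log R)) :=
    (((hsum i).tendsto_sum_nat).comp (tendsto_add_atTop_nat 1)).mul_const _
  exact (mul_le_mul_of_nonneg_right (m.one_sub_maxError_le γ i hE) hlogR).trans
    (le_of_tendsto' hlim hn)

end SensingModel

/-! ### The threshold test: error bounds and continuation events -/

theorem firstTime_eq {c : ℕ → Prop} {n : ℕ} (h : firstTime c = n) : c n := by
  obtain ⟨k, hk, hc⟩ := (firstTime_le_iff c n).1 h.le
  have h1 : firstTime c ≤ k := (firstTime_le_iff c k).2 ⟨k, le_rfl, hc⟩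
  rw [h] at h1
  have h2 : n ≤ k := by exact_mod_cast h1
  rwa [le_antisymm h2 hk]

namespace SensingModel

section Ratio

variable {M : ℕ} {U Y : Type*}

theorem mul_weight_le_of_lt_likelihoodRatio (m : SensingModel M U Y) (φ : ControlPolicy U Y)
    {i j : Fin M} (hj : j ≠ i) {n : ℕ} {h : History U Y n} {T : ℝ} (hT : 0 < T)
    (hlt : ENNReal.ofReal T < m.likelihoodRatio φ i h) : T * m.weight φ j h ≤ m.weight φ i h := by
  have h1 := ENNReal.mul_le_of_le_div hlt.le
  have h2 : ENNReal.ofReal T * m.jointPMF φ j h ≤ m.jointPMF φ i h :=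
    le_trans (by gcongr; exact le_iSup₂ (f := fun (j : Fin M) (_ : j ≠ i) => m.jointPMF φ j h) j hj) h1
  have h3 := ENNReal.toReal_mono (m.jointPMF_ne_top φ i h) h2
  rwa [ENNReal.toReal_mul, ENNReal.toReal_ofReal hT.le] at h3

theorem lt_likelihoodRatio (hM : 2 ≤ M) (m : SensingModel M U Y) (φ : ControlPolicy U Y)
    {i : Fin M} {n : ℕ} {h : History U Y n} {T : ℝ} (hT : 0 < T)
    (hlt : ∀ j ≠ i, T * m.weight φ j h < m.weight φ i h) :
    ENNReal.ofReal T < m.likelihoodRatio φ i h := by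
  have := nonempty_ne hM i
  obtain ⟨j, hj⟩ := exists_eq_ciSup_of_finite (f := fun j : {j : Fin M // j ≠ i} => m.jointPMF φ j h)
  have e : ⨆ (j : Fin M) (_ : j ≠ i), m.jointPMF φ j h = m.jointPMF φ j h := by
    rw [hj, iSup_subtype']
  rw [likelihoodRatio, e, ENNReal.lt_div_iff_mul_lt (Or.inr ENNReal.ofReal_ne_top)
    (Or.inl (m.jointPMF_ne_top φ j h)), ← ofReal_weight, ← ofReal_weight, ← ENNReal.ofReal_mul hT.le]
  exact (ENNReal.ofReal_lt_ofReal_iff_of_nonneg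
    (mul_nonneg hT.le (m.weight_nonneg φ j h))).2 (hlt j j.2)

theorem IsProposedPolicy.weight_le [Fintype U] [Nonempty U] {m : SensingModel M U Y} {a : ℝ}
    {qs : Fin M → Y → PMF U} {φ : ControlPolicy U Y} {est : (n : ℕ) → History U Y n → Fin M}
    (hφ : m.IsProposedPolicy a qs φ est) {n : ℕ} (h : History U Y n) (i : Fin M) :
    m.weight φ i h ≤ m.weight φ (est n h) h :=
  ENNReal.toReal_mono (m.jointPMF_ne_top φ _ h) (hφ.ml n h i)

end Ratio

variable {M : ℕ} {U Y : Type*} [Fintype U] [MeasurableSpace U] [MeasurableSingletonClass U]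
  [Fintype Y] [MeasurableSpace Y] [MeasurableSingletonClass Y]

theorem policy_thresholdTest (m : SensingModel M U Y) (φ : ControlPolicy U Y)
    (est : (n : ℕ) → History U Y n → Fin M) (T : ℝ) : (m.thresholdTest φ est T).policy = φ := rfl

/-- Change of measure on the stopping event: each history stopping with decision `i` has a weight
under `j` that is at most `1 / T` times its weight under `i`, and the latter weights sum to at most
one. -/
theorem law_decides_thresholdTest_le (m : SensingModel M U Y) (φ : ControlPolicy U Y)
    (est : (n : ℕ) → History U Y n → Fin M) {T : ℝ} (hT : 0 < T) {i j : Fin M} (hij : i ≠ j) :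
    m.law φ j ((m.thresholdTest φ est T).decides i) ≤ ENNReal.ofReal (1 / T) := by
  have : Nonempty (U × Y) := by
    obtain ⟨ω⟩ := nonempty_of_isProbabilityMeasure (m.law φ j)
    exact ⟨ω 0⟩
  set γ := m.thresholdTest φ est T with hγ
  obtain ⟨S, -, hS⟩ := γ.exists_stoppingRule
  have hj := m.hasSum_law_decides φ i j γ hS
  have hi := m.hasSum_law_decides φ i i γ hS
  have hle : (m.law φ j).real (γ.decides i) ≤ 1 / T * (m.law φ i).real (γ.decides i) := by
    refine hasSum_le (fun k => ?_) hj (hi.mul_left (1 / T))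
    rw [stopTerm, stopTerm, Finset.mul_sum]
    refine Finset.sum_le_sum fun h _ => ?_
    by_cases hs : h ∈ stopSet S k
    · by_cases hd : γ.δ k h = i
      · obtain ⟨ω, rfl⟩ := exists_take_eq h
        have hN := (SequentialTest.eq_iff_mem_stopSet hS k ω).2 hs
        have hc := firstTime_eq hN
        have hd' : est k (Path.take k ω) = i := hd
        rw [hd'] at hc
        have h1 := m.mul_weight_le_of_lt_likelihoodRatio φ hij.symm hT hc.2
        have h2 : m.weight φ j (Path.take k ω) ≤ 1 / T * m.weight φ i (Path.take k ω) := by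
          rw [one_div, le_inv_mul_iff₀ hT]
          exact h1
        simpa [stopInd, hs, hd] using h2
      · simp [hd]
    · simp [stopInd, hs]
  have h1 : 1 / T * (m.law φ i).real (γ.decides i) ≤ 1 / T :=
    mul_le_of_le_one_right (by positivity) measureReal_le_one
  rw [← ENNReal.ofReal_toReal (measure_ne_top (m.law φ j) _)]
  exact ENNReal.ofReal_le_ofReal (hle.trans h1)

theorem maxError_thresholdTest_le (m : SensingModel M U Y) (φ : ControlPolicy U Y)
    (est : (n : ℕ) → History U Y n → Fin M) {T : ℝ} (hT : 0 < T) :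
    m.maxError (m.thresholdTest φ est T) ≤ ENNReal.ofReal (((M : ℝ) - 1) / T) := by
  classical
  refine iSup_le fun j => ?_
  have h1 : ⋃ i ≠ j, (m.thresholdTest φ est T).decides i =
      ⋃ i ∈ Finset.univ.erase j, (m.thresholdTest φ est T).decides i := by simp
  rw [h1]
  refine (measure_biUnion_finset_le _ _).trans ?_
  refine (Finset.sum_le_sum fun i hi =>
    m.law_decides_thresholdTest_le φ est hT (Finset.ne_of_mem_erase hi)).trans ?_
  have hM : 1 ≤ M := Nat.one_le_iff_ne_zero.2 fun h => by subst h; exact j.elim0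
  rw [Finset.sum_const, Finset.card_erase_of_mem (Finset.mem_univ j), Finset.card_univ,
    Fintype.card_fin, nsmul_eq_mul, ← ENNReal.ofReal_natCast, ← ENNReal.ofReal_mul (by positivity),
    Nat.cast_sub hM]
  refine ENNReal.ofReal_le_ofReal (le_of_eq ?_)
  rw [Nat.cast_one]
  ring

/-- The test continues only if some likelihood ratio is at least `1 / max T 1`. -/
theorem exists_lr_ge_of_lt_N [Nonempty U] (hM : 2 ≤ M) {m : SensingModel M U Y} {a : ℝ}
    {qs : Fin M → Y → PMF U} {φ : ControlPolicy U Y} {est : (n : ℕ) → History U Y n → Fin M}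
    (hφ : m.IsProposedPolicy a qs φ est) (i : Fin M) {T : ℝ} (hT : 0 < T) {n : ℕ} (hn : 1 ≤ n)
    {ω : Path U Y} (hω : (n : ℕ∞) < (m.thresholdTest φ est T).N ω)
    (hw : 0 < m.weight φ i (Path.take n ω)) :
    ∃ j ≠ i, 1 ≤ max T 1 * m.lr i j (Path.take n ω) := by
  by_contra! hc
  have hc' : ∀ j ≠ i, max T 1 * m.weight φ j (Path.take n ω) < m.weight φ i (Path.take n ω) := by
    intro j hj
    rw [← m.weight_mul_lr φ i j]
    nlinarith [hc j hj]
  -- A different estimate would have at least the weight of `i`. The factor `max T 1 ≥ 1` excludes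
  -- this even for thresholds below one.
  have hest : est n (Path.take n ω) = i := by
    by_contra hne
    have h1 := hc' _ hne
    have h2 := hφ.weight_le (Path.take n ω) i
    have h3 := m.weight_nonneg φ (est n (Path.take n ω)) (Path.take n ω)
    have h4 : (1 : ℝ) ≤ max T 1 := le_max_right _ _
    nlinarith
  have hlt : ENNReal.ofReal T < m.likelihoodRatio φ i (Path.take n ω) :=
    m.lt_likelihoodRatio hM φ hT fun j hj =>
      lt_of_le_of_lt (mul_le_mul_of_nonneg_right (le_max_left T 1) (m.weight_nonneg φ j _)) (hc' j hj)
  refine not_le_of_gt hω ((firstTime_le_iff _ n).2 ⟨n, le_rfl, hn, ?_⟩)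
  rw [hest]
  exact hlt

open Classical in
theorem law_lt_N_thresholdTest_le [Nonempty U] (hM : 2 ≤ M) {m : SensingModel M U Y} {a : ℝ}
    {qs : Fin M → Y → PMF U} {φ : ControlPolicy U Y} {est : (n : ℕ) → History U Y n → Fin M}
    (hφ : m.IsProposedPolicy a qs φ est) (i : Fin M) {T : ℝ} (hT : 0 < T) {n : ℕ} (hn : 1 ≤ n) :
    (m.law φ i).real {ω | (n : ℕ∞) < (m.thresholdTest φ est T).N ω} ≤
      ∑ j ∈ Finset.univ.erase i,
        (m.law φ i).real (Path.take n ⁻¹' {h | 1 ≤ max T 1 * m.lr i j h}) := by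
  have hz : (m.law φ i).real (Path.take n ⁻¹' {h | m.weight φ i h = 0}) = 0 := by
    rw [law_real_preimage_take, expect]
    refine Finset.sum_eq_zero fun h _ => ?_
    by_cases h0 : m.weight φ i h = 0 <;> simp [h0]
  have hsub : {ω | (n : ℕ∞) < (m.thresholdTest φ est T).N ω} ⊆
      (Path.take n ⁻¹' {h | m.weight φ i h = 0}) ∪
      ⋃ j ∈ Finset.univ.erase i, Path.take n ⁻¹' {h | 1 ≤ max T 1 * m.lr i j h} := by
    intro ω hω
    rcases (m.weight_nonneg φ i (Path.take n ω)).eq_or_lt with h0 | h0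
    · exact Or.inl h0.symm
    · obtain ⟨j, hj, hle⟩ := exists_lr_ge_of_lt_N hM hφ i hT hn hω h0
      exact Or.inr (Set.mem_iUnion₂.2 ⟨j, Finset.mem_erase.2 ⟨hj, Finset.mem_univ j⟩, hle⟩)
  refine (measureReal_mono hsub).trans ((measureReal_union_le _ _).trans ?_)
  rw [hz, zero_add]
  exact measureReal_biUnion_finset_le _ _

-- A wrong estimate at least matches the likelihood of `i`, so some ratio `lr i j` is at least one.
-- Histories of weight zero are discarded first: all weights vanish there, and the estimate says
-- nothing about `lr`.
open Classical in
theorem law_est_ne_le [Nonempty U] {m : SensingModel M U Y} {a : ℝ}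
    {qs : Fin M → Y → PMF U} {φ : ControlPolicy U Y} {est : (n : ℕ) → History U Y n → Fin M}
    (hφ : m.IsProposedPolicy a qs φ est) (i : Fin M) (n : ℕ) :
    (m.law φ i).real (Path.take n ⁻¹' {h | est n h ≠ i}) ≤
      ∑ j ∈ Finset.univ.erase i, (m.law φ i).real (Path.take n ⁻¹' {h | 1 ≤ m.lr i j h}) := by
  have hz : (m.law φ i).real (Path.take n ⁻¹' {h | m.weight φ i h = 0}) = 0 := by
    rw [law_real_preimage_take, expect]
    refine Finset.sum_eq_zero fun h _ => ?_
    by_cases h0 : m.weight φ i h = 0 <;> simp [h0]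
  have hsub : Path.take n ⁻¹' {h | est n h ≠ i} ⊆
      (Path.take n ⁻¹' {h | m.weight φ i h = 0}) ∪
      ⋃ j ∈ Finset.univ.erase i, Path.take n ⁻¹' {h | 1 ≤ m.lr i j h} := by
    intro ω hω
    rcases (m.weight_nonneg φ i (Path.take n ω)).eq_or_lt with h0 | h0
    · exact Or.inl h0.symm
    · refine Or.inr (Set.mem_iUnion₂.2 ⟨est n (Path.take n ω),
        Finset.mem_erase.2 ⟨hω, Finset.mem_univ _⟩, ?_⟩)
      have h1 := hφ.weight_le (Path.take n ω) i
      rw [← m.weight_mul_lr φ i (est n (Path.take n ω))] at h1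
      exact (le_mul_iff_one_le_right h0).1 h1
  refine (measureReal_mono hsub).trans ((measureReal_union_le _ _).trans ?_)
  rw [hz, zero_add]
  exact measureReal_biUnion_finset_le _ _

end SensingModel

/-! ### Bhattacharyya affinity and its decay under exploration -/

namespace SensingModel

variable {M : ℕ} {U Y : Type*}

/-- The arithmetic-geometric mean inequality; summed over `y` it bounds the Bhattacharyya
coefficient by one, strictly if the two laws differ. -/
theorem tr_mul_sqrt_le (m : SensingModel M U Y) (i j : Fin M) (u : U) (y' y : Y) :
    m.tr i u y' y * √(m.tr j u y' y / m.tr i u y' y) ≤ (m.tr i u y' y + m.tr j u y' y) / 2 := by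
  have hi := m.tr_pos i u y' y
  have hj := m.tr_pos j u y' y
  have h1 := Real.sq_sqrt (div_nonneg hj.le hi.le)
  have h2 : m.tr i u y' y * √(m.tr j u y' y / m.tr i u y' y) ^ 2 = m.tr j u y' y := by
    rw [h1]; field_simp
  nlinarith [mul_nonneg hi.le (sq_nonneg (√(m.tr j u y' y / m.tr i u y' y) - 1))]

variable [Fintype Y]

/-- The Bhattacharyya coefficient of hypotheses `i` and `j`. -/
def bc (m : SensingModel M U Y) (i j : Fin M) (u : U) (y' : Y) : ℝ :=
  ∑ y, m.tr i u y' y * √(m.tr j u y' y / m.tr i u y' y)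

theorem bc_le_one (m : SensingModel M U Y) (i j : Fin M) (u : U) (y' : Y) : m.bc i j u y' ≤ 1 := by
  refine (Finset.sum_le_sum fun y _ => m.tr_mul_sqrt_le i j u y' y).trans_eq ?_
  rw [← Finset.sum_div, Finset.sum_add_distrib, sum_tr, sum_tr]
  norm_num

theorem bc_lt_one (m : SensingModel M U Y) {i j : Fin M} {u : U} {y' : Y}
    (h : m.p i u y' ≠ m.p j u y') : m.bc i j u y' < 1 := by
  obtain ⟨y, hy⟩ : ∃ y, m.p i u y' y ≠ m.p j u y' y := by
    by_contra! hc
    exact h (PMF.ext hc)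
  have hy' : m.tr i u y' y ≠ m.tr j u y' y := fun he =>
    hy ((ENNReal.toReal_eq_toReal_iff' (PMF.apply_ne_top _ _) (PMF.apply_ne_top _ _)).1 he)
  have hi := m.tr_pos i u y' y
  have hj := m.tr_pos j u y' y
  have hlt : m.tr i u y' y * √(m.tr j u y' y / m.tr i u y' y) <
      (m.tr i u y' y + m.tr j u y' y) / 2 := by
    have h1 := Real.sq_sqrt (div_nonneg hj.le hi.le)
    have h2 : m.tr i u y' y * √(m.tr j u y' y / m.tr i u y' y) ^ 2 = m.tr j u y' y := by
      rw [h1]; field_simp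
    have h3 : √(m.tr j u y' y / m.tr i u y' y) - 1 ≠ 0 := by
      intro h0
      have h4 : √(m.tr j u y' y / m.tr i u y' y) = 1 := by linarith
      rw [h4, one_pow, mul_one] at h2
      exact hy' h2
    nlinarith [mul_pos hi (sq_pos_of_ne_zero h3)]
  refine (Finset.sum_lt_sum (fun y _ => m.tr_mul_sqrt_le i j u y' y)
    ⟨y, Finset.mem_univ y, hlt⟩).trans_eq ?_
  rw [← Finset.sum_div, Finset.sum_add_distrib, sum_tr, sum_tr]
  norm_num

variable [Fintype U]

/-- The expected square root of the likelihood ratio. -/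
def affinity (m : SensingModel M U Y) (φ : ControlPolicy U Y) (i j : Fin M) (n : ℕ) : ℝ :=
  m.expect φ i n fun h => √(m.lr i j h)

theorem affinity_nonneg (m : SensingModel M U Y) (φ : ControlPolicy U Y) (i j : Fin M) (n : ℕ) :
    0 ≤ m.affinity φ i j n :=
  m.expect_nonneg φ i n fun _ => Real.sqrt_nonneg _

/-- Used with `F = 1` for the decay of the affinity, and with `F` an indicator to follow the part of
the affinity carried by one observation. -/
theorem expect_succ_sqrt_lr (m : SensingModel M U Y) (φ : ControlPolicy U Y) (i j : Fin M) (n : ℕ)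
    (F : Y → ℝ) :
    m.expect φ i (n + 1) (fun h => √(m.lr i j h) * F (m.lastObs h)) =
      m.expect φ i n fun h => √(m.lr i j h) * ∑ u, (φ n h u).toReal * ∑ y,
        m.tr i u (m.lastObs h) y *
          √(m.tr j u (m.lastObs h) y / m.tr i u (m.lastObs h) y) * F y := by
  rw [expect_succ]
  congr 1
  funext h
  rw [Finset.mul_sum]
  refine Finset.sum_congr rfl fun u _ => ?_
  rw [Finset.mul_sum, Finset.mul_sum, Finset.mul_sum]
  refine Finset.sum_congr rfl fun y _ => ?_
  rw [lr_snoc, lastObs_snoc, Real.sqrt_mul (m.lr_pos i j h).le]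
  ring

theorem affinity_succ (m : SensingModel M U Y) (φ : ControlPolicy U Y) (i j : Fin M) (n : ℕ) :
    m.affinity φ i j (n + 1) = m.expect φ i n fun h =>
      √(m.lr i j h) * ∑ u, (φ n h u).toReal * m.bc i j u (m.lastObs h) := by
  have := m.expect_succ_sqrt_lr φ i j n fun _ => 1
  simpa only [mul_one, affinity, bc] using this

theorem affinity_succ_le (m : SensingModel M U Y) (φ : ControlPolicy U Y) (i j : Fin M) (n : ℕ) :
    m.affinity φ i j (n + 1) ≤ m.affinity φ i j n := by
  rw [affinity_succ]
  refine m.expect_mono φ i n fun h => mul_le_of_le_one_right (Real.sqrt_nonneg _) ?_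
  rw [← sum_toReal_pmf (φ n h)]
  exact Finset.sum_le_sum fun u _ =>
    mul_le_of_le_one_right ENNReal.toReal_nonneg (m.bc_le_one i j u _)

theorem affinity_zero (m : SensingModel M U Y) (φ : ControlPolicy U Y) (i j : Fin M) :
    m.affinity φ i j 0 = 1 := by
  simp [affinity, expect_zero, lr_zero]

theorem uniformOfFintype_toReal [Nonempty U] (u : U) :
    (PMF.uniformOfFintype U u).toReal = (Fintype.card U : ℝ)⁻¹ := by
  simp [PMF.uniformOfFintype_apply, ENNReal.toReal_inv]

open Classical in
/-- Uniform controls separate two distinct hypotheses at an exponential rate. -/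
theorem exists_affinity_le [Nonempty U] (m : SensingModel M U Y) {i j : Fin M}
    (hij : ∃ u y', m.p i u y' ≠ m.p j u y') :
    ∃ σ : ℝ, 0 < σ ∧ σ < 1 ∧ ∀ (φ : ControlPolicy U Y) (E : ℕ → Prop),
      (∀ n (h : History U Y n), E (n + 1) → φ n h = PMF.uniformOfFintype U) →
      ∀ n, m.affinity φ i j n * σ ≤ σ ^ Nat.count (fun k => E (k + 1)) n := by
  obtain ⟨u₀, y₀, hne⟩ := hij
  have hbc := m.bc_lt_one hne
  have hbc0 : 0 ≤ m.bc i j u₀ y₀ := Finset.sum_nonneg fun y _ =>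
    mul_nonneg (m.tr_pos _ _ _ _).le (Real.sqrt_nonneg _)
  have : Nonempty Y := ⟨y₀⟩
  have hcard : (1 : ℝ) ≤ Fintype.card U := by exact_mod_cast Fintype.card_pos
  -- The relative loss of affinity in a uniform step taken from the separating observation `y₀`,
  -- which need not be the initial one.
  set c : ℝ := (Fintype.card U : ℝ)⁻¹ * (1 - m.bc i j u₀ y₀) with hc
  have hc0 : 0 < c := mul_pos (by positivity) (by linarith)
  have hc1 : c ≤ 1 := mul_le_one₀ (inv_le_one_of_one_le₀ hcard) (by linarith) (by linarith)
  set f : U × Y → ℝ := fun x =>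
    m.tr i x.1 x.2 y₀ * √(m.tr j x.1 x.2 y₀ / m.tr i x.1 x.2 y₀) with hf
  obtain ⟨x₀, hx₀⟩ := Finite.exists_min f
  have hf0 : ∀ x, 0 < f x := fun x =>
    mul_pos (m.tr_pos _ _ _ _) (Real.sqrt_pos.2 (div_pos (m.tr_pos _ _ _ _) (m.tr_pos _ _ _ _)))
  -- Whatever the control and the previous observation, at least the fraction `δ` of the affinity
  -- moves to `y₀` in one step.
  set δ : ℝ := f x₀ with hδ
  have hδ1 : δ ≤ 1 := by
    refine le_trans ?_ (m.bc_le_one i j x₀.1 x₀.2)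
    exact Finset.single_le_sum (f := fun y =>
      m.tr i x₀.1 x₀.2 y * √(m.tr j x₀.1 x₀.2 y / m.tr i x₀.1 x₀.2 y))
      (fun y _ => mul_nonneg (m.tr_pos _ _ _ _).le (Real.sqrt_nonneg _)) (Finset.mem_univ y₀)
  have hδ0 : 0 < δ := hf0 x₀
  have hcδ : c * δ ≤ 1 := mul_le_one₀ hc1 hδ0.le hδ1
  have hcδ0 : 0 < c * δ := mul_pos hc0 hδ0
  -- Two steps ending with an exploration contract by `1 - c * δ ≤ σ ^ 2`. The pair contains at most
  -- two explorations, so `σ` per exploration can be charged.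
  set σ : ℝ := 1 - c * δ / 2 with hσ
  have hσ0 : 0 < σ := by linarith
  have hσ1 : σ < 1 := by linarith
  refine ⟨σ, hσ0, hσ1, fun φ E hφ => ?_⟩
  have hstep : ∀ n, E (n + 2) → m.affinity φ i j (n + 2) ≤ σ ^ 2 * m.affinity φ i j n := by
    intro n hE
    have h1 : m.affinity φ i j (n + 2) ≤ m.affinity φ i j (n + 1) -
        c * m.expect φ i (n + 1) fun h => √(m.lr i j h) * if m.lastObs h = y₀ then 1 else 0 := by
      rw [affinity_succ, affinity, ← expect_mul_left, ← expect_sub]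
      refine m.expect_mono φ i (n + 1) fun h => ?_
      have h2 : ∑ u, (φ (n + 1) h u).toReal * m.bc i j u (m.lastObs h) ≤
          1 - c * if m.lastObs h = y₀ then 1 else 0 := by
        have hsum := sum_toReal_pmf (φ (n + 1) h)
        have h3 : ∑ u, (φ (n + 1) h u).toReal * (1 - m.bc i j u (m.lastObs h)) ≥
            c * if m.lastObs h = y₀ then 1 else 0 := by
          have hnn : ∀ u ∈ Finset.univ,
              0 ≤ (φ (n + 1) h u).toReal * (1 - m.bc i j u (m.lastObs h)) := fun u _ =>
            mul_nonneg ENNReal.toReal_nonneg (sub_nonneg.2 (m.bc_le_one i j u _))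
          split_ifs with hl
          · have h4 := Finset.single_le_sum hnn (Finset.mem_univ u₀)
            rw [hφ (n + 1) h hE, uniformOfFintype_toReal, hl] at h4
            rw [mul_one, hφ (n + 1) h hE, hl]
            exact h4
          · rw [mul_zero]
            exact Finset.sum_nonneg hnn
        simp only [mul_sub, mul_one, Finset.sum_sub_distrib, hsum] at h3
        linarith
      have h5 := mul_le_mul_of_nonneg_left h2 (Real.sqrt_nonneg (m.lr i j h))
      linarith
    have h6 : δ * m.affinity φ i j n ≤
        m.expect φ i (n + 1) fun h => √(m.lr i j h) * if m.lastObs h = y₀ then 1 else 0 := by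
      rw [m.expect_succ_sqrt_lr φ i j n fun y => if y = y₀ then 1 else 0, affinity,
        ← expect_mul_left]
      refine m.expect_mono φ i n fun h => ?_
      rw [mul_comm]
      refine mul_le_mul_of_nonneg_left ?_ (Real.sqrt_nonneg _)
      have e : δ = ∑ u, (φ n h u).toReal * δ := by
        rw [← Finset.sum_mul, sum_toReal_pmf, one_mul]
      rw [e]
      refine Finset.sum_le_sum fun u _ => mul_le_mul_of_nonneg_left ?_ ENNReal.toReal_nonneg
      rw [Finset.sum_eq_single y₀ (fun y _ hy => by simp [hy]) (by simp), if_pos rfl, mul_one]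
      exact hx₀ (u, m.lastObs h)
    have h7 := m.affinity_succ_le φ i j n
    have h8 := m.affinity_nonneg φ i j n
    have h9 := mul_le_mul_of_nonneg_left h6 hc0.le
    have h10 : m.affinity φ i j (n + 2) ≤ (1 - c * δ) * m.affinity φ i j n := by linarith
    refine h10.trans (mul_le_mul_of_nonneg_right ?_ h8)
    nlinarith [sq_nonneg (c * δ)]
  intro n
  induction n using Nat.strong_induction_on with
  | _ n ih =>
    rcases n with _ | _ | n
    · simpa [affinity_zero] using hσ1.le
    -- An exploration at time one has no preceding step that could reach `y₀`; the extra factor `σ`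
    -- in the statement pays for it.
    · have h1 := m.affinity_succ_le φ i j 0
      rw [affinity_zero] at h1
      have h2 : Nat.count (fun k => E (k + 1)) 1 ≤ 1 := Nat.count_le _
      calc m.affinity φ i j 1 * σ ≤ σ ^ 1 := by rw [pow_one]; exact mul_le_of_le_one_left hσ0.le h1
        _ ≤ _ := pow_le_pow_of_le_one hσ0.le hσ1.le h2
    · by_cases hE : E (n + 2)
      · have h1 : Nat.count (fun k => E (k + 1)) (n + 2) ≤ 2 + Nat.count (fun k => E (k + 1)) n := by
          rw [Nat.count_add, add_comm]
          exact Nat.add_le_add_right (Nat.count_le _) _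
        calc m.affinity φ i j (n + 2) * σ ≤ σ ^ 2 * m.affinity φ i j n * σ :=
              mul_le_mul_of_nonneg_right (hstep n hE) hσ0.le
          _ = σ ^ 2 * (m.affinity φ i j n * σ) := by ring
          _ ≤ σ ^ 2 * σ ^ Nat.count (fun k => E (k + 1)) n :=
              mul_le_mul_of_nonneg_left (ih n (by omega)) (by positivity)
          _ ≤ _ := by
              rw [← pow_add]
              exact pow_le_pow_of_le_one hσ0.le hσ1.le h1
      · have h1 : Nat.count (fun k => E (k + 1)) (n + 2) = Nat.count (fun k => E (k + 1)) (n + 1) := by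
          rw [Nat.count_succ, if_neg hE, add_zero]
        rw [h1]
        exact (mul_le_mul_of_nonneg_right (m.affinity_succ_le φ i j (n + 1)) hσ0.le).trans
          (ih (n + 1) (by omega))

/-- Markov's inequality for the square root of the likelihood ratio. -/
theorem law_lr_ge_le [MeasurableSpace U] [MeasurableSingletonClass U]
    [MeasurableSpace Y] [MeasurableSingletonClass Y] (m : SensingModel M U Y)
    (φ : ControlPolicy U Y) (i j : Fin M) (n : ℕ) {T : ℝ} (hT : 0 ≤ T) :
    (m.law φ i).real (Path.take n ⁻¹' {h | 1 ≤ T * m.lr i j h}) ≤ √T * m.affinity φ i j n := by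
  classical
  rw [law_real_preimage_take, affinity, ← expect_mul_left]
  refine m.expect_mono φ i n fun h => ?_
  rw [← Real.sqrt_mul hT]
  split_ifs with h1
  · exact Real.one_le_sqrt.2 h1
  · positivity

end SensingModel

/-! ### Counting exploration times -/

open Classical in
/-- The number of exploration times up to `n`. -/
def explorationCount (a : ℝ) (n : ℕ) : ℕ := Nat.count (fun k => IsExplorationTime a (k + 1)) n

/-- Rounding up can merge powers only while their gaps are small: from `a ^ L * (a - 1) > 1` on,
consecutive powers differ by more than one and give distinct exploration times. -/
theorem exists_le_explorationCount_add {a : ℝ} (ha : 1 < a) :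
    ∃ L : ℕ, ∀ l n : ℕ, a ^ l ≤ n → l ≤ explorationCount a n + L := by
  classical
  obtain ⟨L, hL⟩ := pow_unbounded_of_one_lt (1 / (a - 1)) ha
  have ha1 : 0 < a - 1 := sub_pos.2 ha
  rw [div_lt_iff₀ ha1] at hL
  refine ⟨L, fun l n hln => ?_⟩
  have hpos : ∀ k : ℕ, 1 ≤ ⌈a ^ k⌉₊ := fun k => Nat.one_le_ceil_iff.2 (by positivity)
  have hcard : (Finset.Ico L l).card ≤ explorationCount a n := by
    rw [explorationCount, Nat.count_eq_card_filter_range]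
    refine Finset.card_le_card_of_injOn (fun k => ⌈a ^ k⌉₊ - 1) ?_ ?_
    · intro k hk
      have hk2 := (Finset.mem_Ico.1 hk).2
      have h1 : ⌈a ^ k⌉₊ ≤ n := Nat.ceil_le.2 ((pow_le_pow_right₀ ha.le hk2.le).trans hln)
      have h2 := hpos k
      refine Finset.mem_filter.2 ⟨Finset.mem_range.2 ?_, k, ?_⟩
      · show ⌈a ^ k⌉₊ - 1 < n
        omega
      show ⌈a ^ k⌉₊ - 1 + 1 = ⌈a ^ k⌉₊
      omega
    · have hlt : ∀ k k' : ℕ, L ≤ k → k < k' → ⌈a ^ k⌉₊ < ⌈a ^ k'⌉₊ := by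
        intro k k' hk hkk'
        have h1 : a ^ k + 1 ≤ a ^ k' := by
          have h2 : a ^ (k + 1) ≤ a ^ k' := pow_le_pow_right₀ ha.le hkk'
          have h3 : a ^ L * (a - 1) ≤ a ^ k * (a - 1) :=
            mul_le_mul_of_nonneg_right (pow_le_pow_right₀ ha.le hk) ha1.le
          rw [pow_succ] at h2
          linarith
        have h4 := Nat.ceil_mono h1
        rw [Nat.ceil_add_one (by positivity)] at h4
        omega
      intro k hk k' hk' he
      have hk1 := (Finset.mem_Ico.1 hk).1
      have hk1' := (Finset.mem_Ico.1 hk').1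
      have h1 := hpos k
      have h2 := hpos k'
      have he' : ⌈a ^ k⌉₊ = ⌈a ^ k'⌉₊ := by
        have : ⌈a ^ k⌉₊ - 1 = ⌈a ^ k'⌉₊ - 1 := he
        omega
      rcases lt_trichotomy k k' with h | h | h
      · exact absurd he' (hlt k k' hk1 h).ne
      · exact h
      · exact absurd he'.symm (hlt k' k hk1' h).ne
  rw [Nat.card_Ico] at hcard
  omega

theorem explorationCount_le {a : ℝ} (ha : 1 < a) {l n : ℕ} (h : (n : ℝ) < a ^ l) :
    explorationCount a n ≤ l := by
  classical
  rw [explorationCount, Nat.count_eq_card_filter_range, ← Finset.card_range l]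
  refine (Finset.card_le_card ?_).trans (Finset.card_image_le (f := fun k => ⌈a ^ k⌉₊ - 1))
  intro k hk
  obtain ⟨hkn, t, ht⟩ := Finset.mem_filter.1 hk
  refine Finset.mem_image.2 ⟨t, Finset.mem_range.2 ?_, by omega⟩
  have h1 : ⌈a ^ t⌉₊ ≤ n := by rw [← ht]; exact Finset.mem_range.1 hkn
  exact (pow_lt_pow_iff_right₀ ha).1 ((Nat.ceil_le.1 h1).trans_lt h)

theorem tendsto_explorationCount {a : ℝ} (ha : 1 < a) :
    Tendsto (explorationCount a) atTop atTop := by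
  obtain ⟨L, hL⟩ := exists_le_explorationCount_add ha
  refine tendsto_atTop.2 fun b => ?_
  filter_upwards [eventually_ge_atTop ⌈a ^ (b + L)⌉₊] with n hn
  have := hL (b + L) n (Nat.ceil_le.1 hn)
  omega

theorem eventually_explorationCount_le {a : ℝ} (ha : 1 < a) {ε : ℝ} (hε : 0 < ε) :
    ∀ᶠ n : ℕ in atTop, (explorationCount a n : ℝ) ≤ ε * n := by
  have ha0 : 0 < a := one_pos.trans ha
  have hr0 : 0 < a ^ (-ε) := Real.rpow_pos_of_pos ha0 _
  have hr1 : a ^ (-ε) < 1 := Real.rpow_lt_one_of_one_lt_of_neg ha (by linarith)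
  have h := tendsto_pow_const_mul_const_pow_of_abs_lt_one 1 (abs_lt.2 ⟨by linarith, hr1⟩)
  filter_upwards [h.eventually (gt_mem_nhds (inv_pos.2 ha0))] with n hn
  rw [pow_one, ← Real.rpow_natCast, ← Real.rpow_mul ha0.le] at hn
  have h1 : (n : ℝ) < a ^ ⌊ε * n⌋₊ := by
    have h2 : a ^ (ε * n - 1) ≤ a ^ ((⌊ε * n⌋₊ : ℕ) : ℝ) :=
      Real.rpow_le_rpow_of_exponent_le ha.le (Nat.sub_one_lt_floor _).le
    rw [Real.rpow_natCast, Real.rpow_sub ha0, Real.rpow_one] at h2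
    refine lt_of_lt_of_le ?_ h2
    rw [neg_mul, Real.rpow_neg ha0.le] at hn
    have h3 : 0 < a ^ (ε * (n : ℝ)) := Real.rpow_pos_of_pos ha0 _
    rw [← div_eq_mul_inv, div_lt_iff₀ h3] at hn
    rw [lt_div_iff₀ ha0]
    calc (n : ℝ) * a < a⁻¹ * a ^ (ε * (n : ℝ)) * a := mul_lt_mul_of_pos_right hn ha0
      _ = a ^ (ε * (n : ℝ)) := by field_simp
  have h4 := explorationCount_le ha h1
  exact (Nat.cast_le.2 h4).trans (Nat.floor_le (by positivity))

/-- With `a ^ l ≤ n < a ^ (l + 1)` there are at least `l - L` explorations, so the product is at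
most a constant times `(a ^ 4 * σ) ^ l ≤ 1`. -/
theorem exists_pow_mul_pow_explorationCount_le {a σ : ℝ} (ha : 1 < a) (hσ0 : 0 < σ) (hσ1 : σ < 1)
    (h : a ^ 4 * σ ≤ 1) : ∃ C : ℝ, ∀ n : ℕ, (n : ℝ) ^ 4 * σ ^ explorationCount a n ≤ C := by
  obtain ⟨L, hL⟩ := exists_le_explorationCount_add ha
  refine ⟨a ^ 4 / σ ^ L, fun n => ?_⟩
  rw [le_div_iff₀ (by positivity), mul_assoc, ← pow_add]
  rcases Nat.eq_zero_or_pos n with rfl | hn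
  · simp only [Nat.cast_zero]
    have : 0 < a := one_pos.trans ha
    simp only [ne_eq, OfNat.ofNat_ne_zero, not_false_eq_true, zero_pow, zero_mul]
    positivity
  · obtain ⟨l, hl, hl'⟩ := exists_nat_pow_near (show (1 : ℝ) ≤ n by exact_mod_cast hn) ha
    have h1 : σ ^ (explorationCount a n + L) ≤ σ ^ l :=
      pow_le_pow_of_le_one hσ0.le hσ1.le (hL l n hl)
    calc (n : ℝ) ^ 4 * σ ^ (explorationCount a n + L) ≤ (a ^ (l + 1)) ^ 4 * σ ^ l := by gcongr
      _ = a ^ 4 * (a ^ 4 * σ) ^ l := by ring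
      _ ≤ a ^ 4 * 1 := by
          refine mul_le_mul_of_nonneg_left (pow_le_one₀ ?_ h) ?_ <;> positivity
      _ = a ^ 4 := mul_one _

/-! ### Termination and consistency of the estimate -/

namespace SensingModel

variable {M : ℕ} {U Y : Type*} [Fintype U] [Nonempty U] [Fintype Y]

theorem IsProposedPolicy.affinity_le {m : SensingModel M U Y} {a : ℝ} {qs : Fin M → Y → PMF U}
    {φ : ControlPolicy U Y} {est : (n : ℕ) → History U Y n → Fin M}
    (hφ : m.IsProposedPolicy a qs φ est) {i j : Fin M} {σ : ℝ}
    (hσ : ∀ (φ : ControlPolicy U Y) (E : ℕ → Prop),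
      (∀ n (h : History U Y n), E (n + 1) → φ n h = PMF.uniformOfFintype U) →
      ∀ n, m.affinity φ i j n * σ ≤ σ ^ (open Classical in Nat.count (fun k => E (k + 1)) n)) (n : ℕ) :
    m.affinity φ i j n * σ ≤ σ ^ explorationCount a n :=
  hσ φ (IsExplorationTime a) hφ.explore n

theorem IsProposedPolicy.tendsto_affinity {m : SensingModel M U Y} {a : ℝ} (ha : 1 < a)
    {qs : Fin M → Y → PMF U} {φ : ControlPolicy U Y} {est : (n : ℕ) → History U Y n → Fin M}
    (hφ : m.IsProposedPolicy a qs φ est) {i j : Fin M} (hij : ∃ u y', m.p i u y' ≠ m.p j u y') :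
    Tendsto (m.affinity φ i j) atTop (𝓝 0) := by
  obtain ⟨σ, hσ0, hσ1, hσ⟩ := m.exists_affinity_le hij
  have h1 : Tendsto (fun n => σ ^ explorationCount a n / σ) atTop (𝓝 (0 / σ)) :=
    ((tendsto_pow_atTop_nhds_zero_of_lt_one hσ0.le hσ1).comp
      (tendsto_explorationCount ha)).div_const σ
  rw [zero_div] at h1
  refine squeeze_zero (m.affinity_nonneg φ i j) (fun n => ?_) h1
  rw [le_div_iff₀ hσ0]
  exact hφ.affinity_le hσ n

variable [MeasurableSpace U] [MeasurableSingletonClass U]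
  [MeasurableSpace Y] [MeasurableSingletonClass Y]

/-- Explorations never cease, so the affinities tend to zero, and with them the probability of
continuing. No rate is needed, hence every `a > 1` is allowed. -/
theorem IsProposedPolicy.ae_N_lt_top (hM : 2 ≤ M) {m : SensingModel M U Y}
    (hdist : ∀ i j : Fin M, i ≠ j → ∃ u y', m.p i u y' ≠ m.p j u y') {a : ℝ} (ha : 1 < a)
    {qs : Fin M → Y → PMF U} {φ : ControlPolicy U Y} {est : (n : ℕ) → History U Y n → Fin M}
    (hφ : m.IsProposedPolicy a qs φ est) {T : ℝ} (hT : 0 < T) (i : Fin M) :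
    ∀ᵐ ω ∂(m.law φ i), (m.thresholdTest φ est T).N ω < ⊤ := by
  classical
  have hlim : Tendsto (fun n => ∑ j ∈ Finset.univ.erase i, √(max T 1) * m.affinity φ i j n) atTop
      (𝓝 (∑ j ∈ Finset.univ.erase i, √(max T 1) * 0)) :=
    tendsto_finsetSum _ fun j hj => (hφ.tendsto_affinity ha
      (hdist i j (Finset.ne_of_mem_erase hj).symm)).const_mul _
  simp only [mul_zero, Finset.sum_const_zero] at hlim
  have h0 : (m.law φ i).real {ω | ¬ (m.thresholdTest φ est T).N ω < ⊤} ≤ 0 := by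
    refine ge_of_tendsto hlim ?_
    filter_upwards [eventually_ge_atTop 1] with n hn
    refine le_trans (measureReal_mono fun ω hω => ?_) ((law_lt_N_thresholdTest_le hM hφ i hT hn).trans
      (Finset.sum_le_sum fun j _ => m.law_lr_ge_le φ i j n (by positivity)))
    have h1 : (m.thresholdTest φ est T).N ω = ⊤ := not_lt_top_iff.1 hω
    show (n : ℕ∞) < _
    rw [h1]
    exact ENat.natCast_lt_top n
  rw [ae_iff]
  have h1 := le_antisymm h0 measureReal_nonneg
  exact (measureReal_eq_zero_iff).1 h1

/-- The probability that the estimate is wrong decays like a fourth power. -/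
theorem IsProposedPolicy.exists_law_est_ne_le {m : SensingModel M U Y} {a : ℝ} (ha : 1 < a)
    {qs : Fin M → Y → PMF U} {φ : ControlPolicy U Y} {est : (n : ℕ) → History U Y n → Fin M}
    (hφ : m.IsProposedPolicy a qs φ est) {i : Fin M} {σ : ℝ} (hσ0 : 0 < σ) (hσ1 : σ < 1)
    (haσ : a ^ 4 * σ ≤ 1) (hσ : ∀ j ≠ i, ∀ n, m.affinity φ i j n * σ ≤ σ ^ explorationCount a n) :
    ∃ C : ℝ, 0 ≤ C ∧ ∀ n : ℕ,
      (n : ℝ) ^ 4 * (m.law φ i).real (Path.take n ⁻¹' {h | est n h ≠ i}) ≤ C := by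
  classical
  obtain ⟨C, hC⟩ := exists_pow_mul_pow_explorationCount_le ha hσ0 hσ1 haσ
  refine ⟨|∑ j ∈ Finset.univ.erase i, C / σ|, abs_nonneg _, fun n => ?_⟩
  refine le_trans ?_ (le_abs_self _)
  refine (mul_le_mul_of_nonneg_left (law_est_ne_le hφ i n) (by positivity)).trans ?_
  rw [Finset.mul_sum]
  refine Finset.sum_le_sum fun j hj => ?_
  have h1 := m.law_lr_ge_le φ i j n zero_le_one
  simp only [one_mul, Real.sqrt_one] at h1
  have h2 := hσ j (Finset.ne_of_mem_erase hj) n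
  rw [le_div_iff₀ hσ0, mul_assoc]
  refine le_trans (mul_le_mul_of_nonneg_left ?_ (by positivity)) (hC n)
  exact (mul_le_mul_of_nonneg_right h1 hσ0.le).trans h2

end SensingModel

/-! ### The exponential supermartingale with Poisson-corrected increments -/

open Classical in
/-- The number of times `k < n` at which the history is in the set `B k`. -/
def badCount {U Y : Type*} (B : (k : ℕ) → Set (History U Y k)) {n : ℕ} (h : History U Y n) : ℝ :=
  ∑ k : Fin n, if h.take k k.2.le ∈ B k then 1 else 0

open Classical in
theorem badCount_snoc {U Y : Type*} (B : (k : ℕ) → Set (History U Y k)) {n : ℕ}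
    (h : History U Y n) (x : U × Y) :
    badCount B (h.snoc x) = badCount B h + if h ∈ B n then 1 else 0 := by
  rw [badCount, Fin.sum_univ_castSucc]
  congr 1
  · refine Finset.sum_congr rfl fun k _ => ?_
    have : (h.snoc x).take (k.castSucc : ℕ) k.castSucc.2.le = h.take k k.2.le :=
      History.take_snoc h x k k.2.le
    rw [this]
    rfl
  · have : (h.snoc x).take (Fin.last n : ℕ) (Fin.last n).2.le = h :=
      History.take_snoc h x n le_rfl
    rw [this]
    rfl

namespace SensingModel

variable {M : ℕ} {U Y : Type*}

/-- The increment of the log-likelihood ratio, corrected by the potential `g`. -/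
def correctedIncrement (m : SensingModel M U Y) (i j : Fin M) (g : Y → ℝ) (u : U) (y' y : Y) : ℝ :=
  Real.log (m.tr i u y' y / m.tr j u y' y) + g y - g y'

open Classical in
/-- The exponential supermartingale. -/
def expWeight (m : SensingModel M U Y) (i j : Fin M) (g : Y → ℝ) (B : (k : ℕ) → Set (History U Y k))
    (η c D : ℝ) {n : ℕ} (h : History U Y n) : ℝ :=
  Real.exp (η * (Real.log (m.lr i j h) - g (m.lastObs h) + c * n - D * badCount B h))

open Classical in
theorem expWeight_snoc (m : SensingModel M U Y) (i j : Fin M) (g : Y → ℝ)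
    (B : (k : ℕ) → Set (History U Y k)) (η c D : ℝ) {n : ℕ} (h : History U Y n) (u : U) (y : Y) :
    m.expWeight i j g B η c D (h.snoc (u, y)) = m.expWeight i j g B η c D h *
      (Real.exp (-(η * m.correctedIncrement i j g u (m.lastObs h) y)) *
        Real.exp (η * (c - D * if h ∈ B n then 1 else 0))) := by
  rw [expWeight, expWeight, ← Real.exp_add, ← Real.exp_add, lr_snoc, lastObs_snoc, badCount_snoc,
    correctedIncrement]
  have hi := m.tr_pos i u (m.lastObs h) y
  have hj := m.tr_pos j u (m.lastObs h) y
  rw [Real.log_mul (m.lr_pos i j h).ne' (div_pos hj hi).ne', Real.log_div hj.ne' hi.ne',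
    Real.log_div hi.ne' hj.ne']
  congr 1
  push_cast
  ring

variable [Fintype U] [Fintype Y]

/-- After correction by a solution of the Poisson equation, the increments of the log-likelihood
ratio have the same mean in every state. -/
theorem exists_potential (m : SensingModel M U Y) {i j : Fin M} (hij : j ≠ i)
    {q : Y → PMF U} : ∃ g : Y → ℝ, ∀ y', m.objective i q ≤
      ∑ u, (q y' u).toReal * ∑ y, m.tr i u y' y * m.correctedIncrement i j g u y' y := by
  obtain ⟨g, hg⟩ := (m.isStationary_stationaryDist i q).exists_poisson
    (m.controlledTransition_pos i q) (m.sum_controlledTransition i q)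
    fun y' => ∑ u, (q y' u).toReal * m.kl i j u y'
  refine ⟨g, fun y' => ?_⟩
  have h1 : m.objective i q ≤
      ∑ y, m.stationaryDist i q y * ∑ u, (q y u).toReal * m.kl i j u y := by
    refine (m.minInfo_le hij (m.occupation i q)).trans_eq ?_
    refine Finset.sum_congr rfl fun y _ => ?_
    rw [Finset.mul_sum]
    exact Finset.sum_congr rfl fun u _ => by rw [occupation, mul_assoc]
  refine h1.trans_eq ?_
  rw [← hg y']
  have h2 : ∑ y, m.controlledTransition i q y' y * g y =
      ∑ u, (q y' u).toReal * ∑ y, m.tr i u y' y * g y := by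
    simp only [controlledTransition, Finset.sum_mul, Finset.mul_sum]
    rw [Finset.sum_comm]
    exact Finset.sum_congr rfl fun u _ => Finset.sum_congr rfl fun y _ => by rw [mul_assoc]; rfl
  have h3 : g y' = ∑ u, (q y' u).toReal * ∑ y, m.tr i u y' y * g y' := by
    simp only [← Finset.sum_mul, sum_tr, one_mul, sum_toReal_pmf]
  rw [h2]
  rw [h3]
  rw [← Finset.sum_add_distrib, ← Finset.sum_sub_distrib]
  refine Finset.sum_congr rfl fun u _ => ?_
  rw [kl_eq_sum, ← mul_add, ← mul_sub, ← Finset.sum_add_distrib, ← Finset.sum_sub_distrib]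
  congr 1
  refine Finset.sum_congr rfl fun y _ => ?_
  rw [correctedIncrement]
  ring

/-- The supermartingale property, by induction on `n`. A regular step gains the drift `d` up to a
quadratic error; each bad step is compensated by the charge `K + d`. -/
theorem expect_expWeight_le (m : SensingModel M U Y) {i j : Fin M} {q : Y → PMF U} {g : Y → ℝ}
    {d K : ℝ} (hK : ∀ u y' y, |m.correctedIncrement i j g u y' y| ≤ K)
    (hd : ∀ y', d ≤ ∑ u, (q y' u).toReal * ∑ y, m.tr i u y' y * m.correctedIncrement i j g u y' y)
    {φ : ControlPolicy U Y} {B : (k : ℕ) → Set (History U Y k)}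
    (hB : ∀ n (h : History U Y n), h ∉ B n → φ n h = q (m.lastObs h))
    {η : ℝ} (hη : 0 ≤ η) (hηK : η * K ≤ 1) (n : ℕ) :
    m.expect φ i n (m.expWeight i j g B η (d - η * K ^ 2) (K + d)) ≤ Real.exp (-(η * g m.y₀)) := by
  classical
  induction n with
  | zero =>
    rw [expect_zero, expWeight, lr_zero, show m.lastObs (Fin.elim0 : History U Y 0) = m.y₀ from rfl]
    simp [badCount]
  | succ n ih =>
    refine le_trans ?_ ih
    rw [expect_succ]
    refine m.expect_mono φ i n fun h => ?_
    simp only [expWeight_snoc]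
    set w := m.expWeight i j g B η (d - η * K ^ 2) (K + d) h with hw
    have hw0 : 0 ≤ w := (Real.exp_pos _).le
    have e : ∑ u, (φ n h u).toReal * ∑ y, m.tr i u (m.lastObs h) y *
        (w * (Real.exp (-(η * m.correctedIncrement i j g u (m.lastObs h) y)) *
          Real.exp (η * (d - η * K ^ 2 - (K + d) * if h ∈ B n then 1 else 0)))) =
        w * (Real.exp (η * (d - η * K ^ 2 - (K + d) * if h ∈ B n then 1 else 0)) *
          ∑ u, (φ n h u).toReal * ∑ y, m.tr i u (m.lastObs h) y *
            Real.exp (-(η * m.correctedIncrement i j g u (m.lastObs h) y))) := by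
      simp only [Finset.mul_sum]
      exact Finset.sum_congr rfl fun u _ => Finset.sum_congr rfl fun y _ => by ring
    rw [e]
    refine mul_le_of_le_one_right hw0 ?_
    have hX : ∀ u y, |η * m.correctedIncrement i j g u (m.lastObs h) y| ≤ η * K := fun u y => by
      rw [abs_mul, abs_of_nonneg hη]
      exact mul_le_mul_of_nonneg_left (hK u _ y) hη
    -- At a bad history the increment is only bounded by `K`; after the charge `K + d` the remaining
    -- exponent is `-η ^ 2 * K ^ 2 ≤ 0`.
    by_cases hb : h ∈ B n
    · have h1 := m.step_le (φ n h) i (m.lastObs h)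
        (F := fun u y => Real.exp (-(η * m.correctedIncrement i j g u (m.lastObs h) y)))
        (c := Real.exp (η * K)) fun u y => Real.exp_le_exp.2 (by
          linarith [neg_abs_le (η * m.correctedIncrement i j g u (m.lastObs h) y), hX u y])
      refine (mul_le_mul_of_nonneg_left h1 (Real.exp_pos _).le).trans ?_
      rw [← Real.exp_add, if_pos hb]
      refine Real.exp_le_one_iff.2 ?_
      nlinarith [mul_nonneg hη (mul_nonneg hη (sq_nonneg K))]
    -- At a regular history, `exp x ≤ 1 + x + x ^ 2` for `|x| ≤ 1` is averaged, which is where `η *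
    -- K ≤ 1` enters.
    · have h1 : ∑ u, (φ n h u).toReal * ∑ y, m.tr i u (m.lastObs h) y *
          Real.exp (-(η * m.correctedIncrement i j g u (m.lastObs h) y)) ≤
          1 - η * d + η ^ 2 * K ^ 2 := by
        have h2 : ∀ u y, Real.exp (-(η * m.correctedIncrement i j g u (m.lastObs h) y)) ≤
            1 + η ^ 2 * K ^ 2 - η * m.correctedIncrement i j g u (m.lastObs h) y := by
          intro u y
          have h3 := Real.abs_exp_sub_one_sub_id_le
            (x := -(η * m.correctedIncrement i j g u (m.lastObs h) y))
            (by rw [abs_neg]; exact (hX u y).trans hηK)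
          have h4 := (abs_le.1 h3).2
          have h5 := sq_le_sq' (by linarith [abs_le.1 (hX u y)]) (abs_le.1 (hX u y)).2
          rw [neg_sq] at h4
          rw [mul_pow η K] at h5
          linarith
        have h6 : ∑ u, (φ n h u).toReal * ∑ y, m.tr i u (m.lastObs h) y *
            (1 + η ^ 2 * K ^ 2 - η * m.correctedIncrement i j g u (m.lastObs h) y) =
            1 + η ^ 2 * K ^ 2 - η * ∑ u, (φ n h u).toReal * ∑ y, m.tr i u (m.lastObs h) y *
              m.correctedIncrement i j g u (m.lastObs h) y := by
          have h7 : ∑ u, (φ n h u).toReal * ∑ y, m.tr i u (m.lastObs h) y *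
            (1 + η ^ 2 * K ^ 2) = 1 + η ^ 2 * K ^ 2 := by
            simp only [← Finset.sum_mul, sum_tr, sum_toReal_pmf, one_mul]
          conv_rhs => rw [← h7]
          generalize 1 + η ^ 2 * K ^ 2 = c
          simp only [Finset.mul_sum, ← Finset.sum_sub_distrib]
          exact Finset.sum_congr rfl fun u _ => Finset.sum_congr rfl fun y _ => by ring
        have h8 := hd (m.lastObs h)
        rw [← hB n h hb] at h8
        have h9 := mul_le_mul_of_nonneg_left h8 hη
        refine le_trans (Finset.sum_le_sum fun u _ => mul_le_mul_of_nonneg_left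
          (Finset.sum_le_sum fun y _ => mul_le_mul_of_nonneg_left (h2 u y) (m.tr_pos _ _ _ _).le)
          ENNReal.toReal_nonneg) (h6.trans_le ?_)
        linarith
      have h2 : 1 - η * d + η ^ 2 * K ^ 2 ≤ Real.exp (-(η * (d - η * K ^ 2))) := by
        have := Real.add_one_le_exp (-(η * (d - η * K ^ 2)))
        linarith
      rw [if_neg hb, mul_zero, sub_zero]
      refine (mul_le_mul_of_nonneg_left (h1.trans h2) (Real.exp_pos _).le).trans ?_
      rw [← Real.exp_add, add_neg_cancel, Real.exp_zero]

variable [MeasurableSpace U] [MeasurableSingletonClass U]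
  [MeasurableSpace Y] [MeasurableSingletonClass Y]

/-- Large deviations of the log-likelihood ratio on the event that the policy rarely deviates from
the control `q`. -/
theorem exists_deviation_bound (m : SensingModel M U Y) {i j : Fin M} (hij : j ≠ i)
    (q : Y → PMF U) : ∃ K G D : ℝ, 0 ≤ D ∧
      ∀ (φ : ControlPolicy U Y) (B : (k : ℕ) → Set (History U Y k)),
      (∀ n (h : History U Y n), h ∉ B n → φ n h = q (m.lastObs h)) →
      ∀ η : ℝ, 0 ≤ η → η * K ≤ 1 → ∀ (n : ℕ) (τ b : ℝ),
        (m.law φ i).real (Path.take n ⁻¹' {h | 0 ≤ τ + Real.log (m.lr i j h) ∧ badCount B h ≤ b}) ≤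
          Real.exp (η * (τ - (m.objective i q - η * K ^ 2) * n + D * b + G)) := by
  classical
  obtain ⟨g, hg⟩ := m.exists_potential hij (q := q)
  set d := m.objective i q with hd
  obtain ⟨K₀, hK₀⟩ := (Set.finite_range fun x : U × Y × Y =>
      |m.correctedIncrement i j g x.1 x.2.1 x.2.2|).bddAbove
  obtain ⟨G, hG⟩ := (Set.finite_range g).bddAbove
  set K := max K₀ |d| with hKdef
  have hK : ∀ u y' y, |m.correctedIncrement i j g u y' y| ≤ K := fun u y' y =>
    (hK₀ ⟨(u, y', y), rfl⟩).trans (le_max_left _ _)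
  have hKd : 0 ≤ K + d := by linarith [le_max_right K₀ |d|, neg_abs_le d]
  refine ⟨K, G - g m.y₀, K + d, hKd, fun φ B hB η hη hηK n τ b => ?_⟩
  have h1 := m.expect_expWeight_le hK hg hB hη hηK n
  rw [law_real_preimage_take]
  -- Chernoff's argument: on the event the total exponent is nonnegative, because `g ≤ G` and
  -- `badCount B h ≤ b`, so the exponential dominates the indicator.
  refine le_trans (m.expect_mono φ i n (G := fun h =>
    Real.exp (η * (τ + G - (d - η * K ^ 2) * n + (K + d) * b)) *
      m.expWeight i j g B η (d - η * K ^ 2) (K + d) h) fun h => ?_) ?_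
  · rw [expWeight, ← Real.exp_add, ← mul_add]
    split_ifs with hh
    · refine Real.one_le_exp (mul_nonneg hη ?_)
      have h3 : g (m.lastObs h) ≤ G := hG ⟨_, rfl⟩
      have h4 := mul_le_mul_of_nonneg_left hh.2 hKd
      linarith [hh.1]
    · positivity
  rw [expect_mul_left]
  refine (mul_le_mul_of_nonneg_left h1 (Real.exp_pos _).le).trans_eq ?_
  rw [← Real.exp_add]
  congr 1
  ring

end SensingModel

/-! ### Tail bounds and the expected time of the proposed test -/

namespace SensingModel

variable {M : ℕ} {U Y : Type*}

/-- The histories at which the next control is an exploration, or the estimate is not `i`. -/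
def deviations (a : ℝ) (est : (n : ℕ) → History U Y n → Fin M) (i : Fin M) (k : ℕ) :
    Set (History U Y k) :=
  {h | IsExplorationTime a (k + 1) ∨ est k h ≠ i}

/-- If the estimate is correct from time `x` on, deviations are explorations or happen before `x`;
the extra one is the rounding of `x`. -/
theorem badCount_deviations_le {a : ℝ} {est : (n : ℕ) → History U Y n → Fin M} {i : Fin M} {n : ℕ}
    {h : History U Y n} {x : ℝ} (hx : 0 ≤ x)
    (hest : ∀ k (hk : k < n), x ≤ k → est k (h.take k hk.le) = i) :
    badCount (deviations a est i) h ≤ explorationCount a n + (x + 1) := by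
  classical
  have h1 : badCount (deviations a est i) h ≤
      ∑ k : Fin n, ((if IsExplorationTime a ((k : ℕ) + 1) then 1 else 0) +
        if ((k : ℕ) : ℝ) < x then 1 else 0) := by
    refine Finset.sum_le_sum fun k _ => ?_
    by_cases he : IsExplorationTime a ((k : ℕ) + 1)
    · rw [if_pos he]
      split_ifs <;> norm_num
    · by_cases hk : ((k : ℕ) : ℝ) < x
      · rw [if_pos hk]
        split_ifs <;> norm_num
      · have : h.take k k.2.le ∉ deviations a est i k := by
          rintro (h1 | h1)
          · exact he h1
          · exact h1 (hest k k.2 (not_lt.1 hk))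
        rw [if_neg this]
        positivity
  refine h1.trans ?_
  rw [Fin.sum_univ_eq_sum_range (fun k => (if IsExplorationTime a (k + 1) then (1 : ℝ) else 0) +
        if (k : ℝ) < x then 1 else 0), Finset.sum_add_distrib]
  refine add_le_add (le_of_eq ?_) ?_
  · rw [explorationCount, Nat.count_eq_card_filter_range, Finset.sum_boole]
  · rw [Finset.sum_boole]
    have h2 : ((Finset.range n).filter fun k : ℕ => (k : ℝ) < x).card ≤ ⌈x⌉₊ := by
      refine (Finset.card_le_card (t := Finset.range ⌈x⌉₊) fun k hk => ?_).trans_eq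
        (Finset.card_range _)
      exact Finset.mem_range.2 (Nat.lt_ceil.2 (Finset.mem_filter.1 hk).2)
    exact (Nat.cast_le.2 h2).trans (Nat.ceil_lt_add_one hx).le

variable [Fintype U] [Nonempty U] [Fintype Y] [MeasurableSpace U] [MeasurableSingletonClass U]
  [MeasurableSpace Y] [MeasurableSingletonClass Y]

/-- More than `ε n` deviations force an error of the estimate after time `ε n / 4`, since the
explorations number at most `ε n / 2` for large `n`. A union bound over at most `n` times, each of
probability `O(n⁻⁴)`, leaves `O(n⁻³)`. -/
theorem IsProposedPolicy.summable_law_deviations {m : SensingModel M U Y} {a : ℝ} (ha : 1 < a)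
    {qs : Fin M → Y → PMF U} {φ : ControlPolicy U Y} {est : (n : ℕ) → History U Y n → Fin M}
    (hφ : m.IsProposedPolicy a qs φ est) {i : Fin M} {σ : ℝ} (hσ0 : 0 < σ) (hσ1 : σ < 1)
    (haσ : a ^ 4 * σ ≤ 1) (hσ : ∀ j ≠ i, ∀ n, m.affinity φ i j n * σ ≤ σ ^ explorationCount a n)
    {ε : ℝ} (hε : 0 < ε) :
    Summable fun n : ℕ => (m.law φ i).real
      (Path.take n ⁻¹' {h | ε * n < badCount (deviations a est i) h}) := by
  classical
  obtain ⟨C, hC0, hC⟩ := hφ.exists_law_est_ne_le ha hσ0 hσ1 haσ hσ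
  have hsum : Summable fun n : ℕ => C / (ε / 4) ^ 4 * (1 / (n : ℝ) ^ 3) :=
    (Real.summable_one_div_nat_pow.2 (by norm_num)).mul_left _
  refine Summable.of_norm_bounded_eventually_nat hsum ?_
  filter_upwards [eventually_explorationCount_le ha (half_pos hε), eventually_ge_atTop ⌈4 / ε⌉₊,
    eventually_ge_atTop 1] with n hn hn2 hn1
  rw [Real.norm_of_nonneg measureReal_nonneg]
  have hn1' : (0 : ℝ) < n := by exact_mod_cast hn1
  have hn2' : 1 ≤ ε / 4 * n := by
    have := Nat.ceil_le.1 hn2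
    rw [div_le_iff₀ hε] at this
    linarith
  have hsub : Path.take n ⁻¹' {h | ε * n < badCount (deviations a est i) h} ⊆
      ⋃ k ∈ (Finset.range n).filter (fun k : ℕ => ε / 4 * n ≤ k),
        Path.take k ⁻¹' {h | est k h ≠ i} := by
    intro ω hω
    by_contra hc
    simp only [Set.mem_iUnion, not_exists] at hc
    have h1 := badCount_deviations_le (a := a) (est := est) (i := i) (h := Path.take n ω)
      (x := ε / 4 * n) (by positivity) fun k hk hxk => by
        by_contra hne
        exact hc k (Finset.mem_filter.2 ⟨Finset.mem_range.2 hk, hxk⟩) hne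
    have h2 : ε * n < badCount (deviations a est i) (Path.take n ω) := hω
    linarith
  refine (measureReal_mono hsub (measure_ne_top _ _)).trans
    ((measureReal_biUnion_finset_le _ _).trans ?_)
  have hterm : ∀ k ∈ (Finset.range n).filter (fun k : ℕ => ε / 4 * n ≤ k),
      (m.law φ i).real (Path.take k ⁻¹' {h | est k h ≠ i}) ≤ C / (ε / 4 * n) ^ 4 := by
    intro k hk
    have hk2 := (Finset.mem_filter.1 hk).2
    rw [le_div_iff₀ (by positivity), mul_comm]
    exact (mul_le_mul_of_nonneg_right (pow_le_pow_left₀ (by positivity) hk2 4)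
      measureReal_nonneg).trans (hC k)
  refine (Finset.sum_le_card_nsmul _ _ _ hterm).trans ?_
  have hcard : (((Finset.range n).filter fun k : ℕ => ε / 4 * n ≤ k).card : ℝ) ≤ n := by
    exact_mod_cast (Finset.card_filter_le _ _).trans_eq (Finset.card_range n)
  rw [nsmul_eq_mul]
  refine (mul_le_mul_of_nonneg_right hcard (by positivity)).trans_eq ?_
  field_simp

/-- Tail bound for a single alternative. -/
theorem IsProposedPolicy.exists_tail_lr {m : SensingModel M U Y} {a : ℝ} (ha : 1 < a)
    {qs : Fin M → Y → PMF U} {φ : ControlPolicy U Y} {est : (n : ℕ) → History U Y n → Fin M}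
    (hφ : m.IsProposedPolicy a qs φ est) {i : Fin M} {σ : ℝ} (hσ0 : 0 < σ) (hσ1 : σ < 1)
    (haσ : a ^ 4 * σ ≤ 1) (hσ : ∀ j ≠ i, ∀ n, m.affinity φ i j n * σ ≤ σ ^ explorationCount a n)
    {d : ℝ} (hd0 : 0 < d) (hd : d < m.objective i (qs i)) {j : Fin M} (hj : j ≠ i) :
    ∃ f g : ℕ → ℝ, (∀ n, 0 ≤ f n) ∧ (∀ n, 0 ≤ g n) ∧ Summable f ∧ Summable g ∧
      ∀ T : ℝ, 1 ≤ T → ∀ n k : ℕ, Real.log T / d + k ≤ n →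
        (m.law φ i).real (Path.take n ⁻¹' {h | 1 ≤ T * m.lr i j h}) ≤ f n + g k := by
  obtain ⟨K, G, D, hD, hdev⟩ := m.exists_deviation_bound hj (qs i)
  set gap := m.objective i (qs i) - d with hgap
  have hgap0 : 0 < gap := sub_pos.2 hd
  -- The gap between the optimal rate and `d` is split in halves: one absorbs the quadratic error `η
  -- * K ^ 2`, the other, through `ε`, the deviation charge `D * ε`.
  obtain ⟨η, hη0, hηK, hηK2⟩ : ∃ η : ℝ, 0 < η ∧ η * K ≤ 1 ∧ η * K ^ 2 ≤ gap / 2 := by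
    have h1 : ∀ᶠ η : ℝ in 𝓝[>] 0, η * K < 1 := by
      have : Tendsto (fun η : ℝ => η * K) (𝓝[>] 0) (𝓝 0) :=
        ((continuous_id.mul continuous_const).tendsto' 0 0 (by simp)).mono_left nhdsWithin_le_nhds
      exact this.eventually (gt_mem_nhds one_pos)
    have h2 : ∀ᶠ η : ℝ in 𝓝[>] 0, η * K ^ 2 < gap / 2 := by
      have : Tendsto (fun η : ℝ => η * K ^ 2) (𝓝[>] 0) (𝓝 0) :=
        ((continuous_id.mul continuous_const).tendsto' 0 0 (by simp)).mono_left nhdsWithin_le_nhds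
      exact this.eventually (gt_mem_nhds (half_pos hgap0))
    obtain ⟨η, hη, hη1, hη2⟩ := (h1.and (h2.and self_mem_nhdsWithin)).exists
    exact ⟨η, hη2, hη.le, hη1.le⟩
  set ε := gap / (2 * (D + 1)) with hεdef
  have hε : 0 < ε := by positivity
  have hεD : D * ε ≤ gap / 2 := by
    rw [hεdef, ← mul_div_assoc, div_le_div_iff₀ (by positivity) (by positivity)]
    nlinarith
  have hB : ∀ n (h : History U Y n), h ∉ deviations a est i n → φ n h = qs i (m.lastObs h) := by
    intro n h hh
    have h1 : ¬ IsExplorationTime a (n + 1) := fun he => hh (Or.inl he)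
    have h2 : est n h = i := by
      by_contra hne
      exact hh (Or.inr hne)
    rw [hφ.exploit n h h1, h2]
  set r := Real.exp (-(η * d)) with hr
  have hr1 : r < 1 := Real.exp_lt_one_iff.2 (neg_neg_of_pos (mul_pos hη0 hd0))
  refine ⟨_, fun k => Real.exp (η * G) * r ^ k, fun n => measureReal_nonneg, fun k => by positivity,
    hφ.summable_law_deviations ha hσ0 hσ1 haσ hσ hε,
    (summable_geometric_of_lt_one (Real.exp_pos _).le hr1).mul_left _, fun T hT n k hnk => ?_⟩
  have hT0 : 0 < T := one_pos.trans_le hT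
  have hsub : Path.take n ⁻¹' {h | 1 ≤ T * m.lr i j h} ⊆
      Path.take n ⁻¹' {h | ε * n < badCount (deviations a est i) h} ∪
      Path.take n ⁻¹' {h | 0 ≤ Real.log T + Real.log (m.lr i j h) ∧
        badCount (deviations a est i) h ≤ ε * n} := by
    intro ω hω
    have hω' : 1 ≤ T * m.lr i j (Path.take n ω) := hω
    rcases lt_or_ge (ε * n) (badCount (deviations a est i) (Path.take n ω)) with h1 | h1
    · exact Or.inl h1
    · refine Or.inr ⟨?_, h1⟩
      rw [← Real.log_mul hT0.ne' (m.lr_pos i j _).ne']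
      exact Real.log_nonneg hω'
  refine (measureReal_mono hsub).trans ((measureReal_union_le _ _).trans ?_)
  refine add_le_add le_rfl ((hdev φ _ hB η hη0.le hηK n (Real.log T) (ε * n)).trans ?_)
  beta_reduce
  rw [hr, ← Real.exp_nat_mul, ← Real.exp_add]
  refine Real.exp_le_exp.2 ?_
  have h1 : Real.log T + d * k ≤ d * n := by
    have := mul_le_mul_of_nonneg_left hnk hd0.le
    rwa [mul_add, mul_div_cancel₀ _ hd0.ne'] at this
  have hn0 : (0 : ℝ) ≤ n := n.cast_nonneg
  have h2 : D * (ε * n) ≤ gap / 2 * n := by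
    rw [← mul_assoc]
    exact mul_le_mul_of_nonneg_right hεD hn0
  have h3 := mul_le_mul_of_nonneg_right hηK2 hn0
  have h4 : Real.log T - (m.objective i (qs i) - η * K ^ 2) * n + D * (ε * n) + G ≤ G - d * k := by
    have : m.objective i (qs i) = gap + d := by rw [hgap]; ring
    rw [this]
    linarith
  have h5 := mul_le_mul_of_nonneg_left h4 hη0.le
  linarith

/-- Tail bound for the stopping time of the proposed test. -/
theorem IsProposedPolicy.exists_tail_N (hM : 2 ≤ M) {m : SensingModel M U Y} {a : ℝ}
    (ha : 1 < a)
    {qs : Fin M → Y → PMF U} {φ : ControlPolicy U Y} {est : (n : ℕ) → History U Y n → Fin M}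
    (hφ : m.IsProposedPolicy a qs φ est) {i : Fin M} {σ : ℝ} (hσ0 : 0 < σ) (hσ1 : σ < 1)
    (haσ : a ^ 4 * σ ≤ 1) (hσ : ∀ j ≠ i, ∀ n, m.affinity φ i j n * σ ≤ σ ^ explorationCount a n)
    {d : ℝ} (hd0 : 0 < d) (hd : d < m.objective i (qs i)) :
    ∃ F G : ℕ → ℝ, (∀ n, 0 ≤ F n) ∧ (∀ n, 0 ≤ G n) ∧ Summable F ∧ Summable G ∧
      ∀ T : ℝ, 1 ≤ T → ∀ n k : ℕ, 1 ≤ n → Real.log T / d + k ≤ n →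
        m.law φ i {ω | (n : ℕ∞) < (m.thresholdTest φ est T).N ω} ≤
          ENNReal.ofReal (F n) + ENNReal.ofReal (G k) := by
  classical
  have h := fun j : {j : Fin M // j ≠ i} =>
    hφ.exists_tail_lr ha hσ0 hσ1 haσ hσ hd0 hd j.2
  choose f g hf0 hg0 hf hg hfg using h
  have hF0 : ∀ n, 0 ≤ ∑ j, f j n := fun n => Finset.sum_nonneg fun j _ => hf0 j n
  have hG0 : ∀ n, 0 ≤ ∑ j, g j n := fun n => Finset.sum_nonneg fun j _ => hg0 j n
  refine ⟨fun n => ∑ j, f j n, fun n => ∑ j, g j n, hF0, hG0, summable_sum fun j _ => hf j,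
    summable_sum fun j _ => hg j, fun T hT n k hn hnk => ?_⟩
  have hT0 : 0 < T := one_pos.trans_le hT
  rw [← ENNReal.ofReal_add (hF0 _) (hG0 _), ← ENNReal.ofReal_toReal (measure_ne_top (m.law φ i) _)]
  refine ENNReal.ofReal_le_ofReal ?_
  refine (law_lt_N_thresholdTest_le hM hφ i hT0 hn).trans ?_
  rw [max_eq_left hT, ← Finset.sum_add_distrib, Finset.sum_subtype _ (p := fun j => j ≠ i)
    (fun j => by simp)]
  exact Finset.sum_le_sum fun j _ => hfg j T hT n k hnk

/-- The expected time of the proposed test is at most `log T / d + C`, for every `d < d_i`. -/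
theorem IsProposedPolicy.exists_expectedTime_le (hM : 2 ≤ M) {m : SensingModel M U Y} {a : ℝ}
    (ha : 1 < a)
    {qs : Fin M → Y → PMF U} {φ : ControlPolicy U Y} {est : (n : ℕ) → History U Y n → Fin M}
    (hφ : m.IsProposedPolicy a qs φ est) {i : Fin M} {σ : ℝ} (hσ0 : 0 < σ) (hσ1 : σ < 1)
    (haσ : a ^ 4 * σ ≤ 1) (hσ : ∀ j ≠ i, ∀ n, m.affinity φ i j n * σ ≤ σ ^ explorationCount a n)
    {d : ℝ} (hd0 : 0 < d) (hd : d < m.objective i (qs i)) :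
    ∃ C : ℝ, ∀ T : ℝ, 1 ≤ T →
      m.expectedTime (m.thresholdTest φ est T) i ≤ ENNReal.ofReal (Real.log T / d + C) := by
  obtain ⟨F, G, hF0, hG0, hFs, hGs, hFG⟩ := hφ.exists_tail_N hM ha hσ0 hσ1 haσ hσ hd0 hd
  refine ⟨2 + (∑' n, F n + ∑' n, G n), fun T hT => ?_⟩
  have hT0 : 0 < T := one_pos.trans_le hT
  have hlog : 0 ≤ Real.log T / d := div_nonneg (Real.log_nonneg hT) hd0.le
  -- Up to `n₁` each tail probability is bounded by one; the rounding and the requirement `1 ≤ n₁`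
  -- of the tail bound cost at most `2`.
  obtain ⟨n₁, hn₁, hn₁le, hn₁ge⟩ :
      ∃ n₁ : ℕ, 1 ≤ n₁ ∧ (n₁ : ℝ) ≤ Real.log T / d + 2 ∧ Real.log T / d ≤ n₁ := by
    refine ⟨⌈Real.log T / d⌉₊ + 1, by omega, ?_, ?_⟩ <;> rw [Nat.cast_add, Nat.cast_one]
    · linarith [Nat.ceil_lt_add_one hlog]
    · linarith [Nat.le_ceil (Real.log T / d)]
  have htail : ∀ k : ℕ, m.law φ i {ω | ((k + n₁ : ℕ) : ℕ∞) < (m.thresholdTest φ est T).N ω} ≤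
      ENNReal.ofReal (F (k + n₁)) + ENNReal.ofReal (G k) := by
    intro k
    refine hFG T hT (k + n₁) k (by omega) ?_
    rw [Nat.cast_add]
    linarith
  have hE := m.expectedTime_eq_tsum (m.thresholdTest φ est T) i
  rw [policy_thresholdTest] at hE
  have hsplit : ∀ f : ℕ → ℝ≥0∞, ∑' k, f k = ∑ k ∈ Finset.range n₁, f k + ∑' k, f (k + n₁) :=
    fun f => (ENNReal.summable.sum_add_tsum_nat_add' (k := n₁)).symm
  rw [hE, hsplit]
  have h1 : ∑ k ∈ Finset.range n₁, m.law φ i {ω | (k : ℕ∞) < (m.thresholdTest φ est T).N ω} ≤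
      ENNReal.ofReal n₁ := by
    refine (Finset.sum_le_card_nsmul _ _ 1 fun k _ => prob_le_one).trans_eq ?_
    simp
  have h2 : ∑' k : ℕ, m.law φ i {ω | ((k + n₁ : ℕ) : ℕ∞) < (m.thresholdTest φ est T).N ω} ≤
      ENNReal.ofReal (∑' n, F n) + ENNReal.ofReal (∑' n, G n) := by
    refine (ENNReal.tsum_le_tsum htail).trans ?_
    rw [ENNReal.tsum_add, ENNReal.ofReal_tsum_of_nonneg hF0 hFs, ENNReal.ofReal_tsum_of_nonneg hG0 hGs]
    refine add_le_add ?_ le_rfl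
    exact ENNReal.tsum_comp_le_tsum_of_injective (add_left_injective n₁) fun n => ENNReal.ofReal (F n)
  refine (add_le_add h1 h2).trans ?_
  have hFt : 0 ≤ ∑' n, F n := tsum_nonneg hF0
  have hGt : 0 ≤ ∑' n, G n := tsum_nonneg hG0
  rw [← ENNReal.ofReal_add hFt hGt, ← ENNReal.ofReal_add n₁.cast_nonneg (add_nonneg hFt hGt)]
  refine ENNReal.ofReal_le_ofReal ?_
  linarith

end SensingModel

/-! ### Asymptotics of the converse and of the proposed test -/

theorem negLogDiv_antitone {d : ℝ} (hd : 0 ≤ d) {x y : ℝ≥0∞} (h : x ≤ y) :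
    negLogDiv y d ≤ negLogDiv x d :=
  EReal.div_le_div_right_of_nonneg (by exact_mod_cast hd)
    (EReal.neg_le_neg_iff.2 (ENNReal.log_monotone h))

theorem negLogDiv_ofReal {r : ℝ} (hr : 0 < r) (d : ℝ) :
    negLogDiv (ENNReal.ofReal r) d = ((-Real.log r / d : ℝ) : EReal) := by
  rw [negLogDiv, ENNReal.log_ofReal_of_pos hr, EReal.coe_div, EReal.coe_neg]

/-- Two functions with the same positive limit after division by `L` have a quotient tending to one;
this reduces all asymptotic claims to limits of real quotients. -/
theorem asympEq_of_tendsto_div {α : Type*} {l : Filter α} {f g : α → EReal} {F G L : α → ℝ} {c : ℝ}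
    (hc : 0 < c) (hf : ∀ᶠ x in l, f x = F x) (hg : ∀ᶠ x in l, g x = G x)
    (hF : Tendsto (fun x => F x / L x) l (𝓝 c)) (hG : Tendsto (fun x => G x / L x) l (𝓝 c)) :
    AsympEq l f g := by
  have hlim : Tendsto (fun x => F x / L x / (G x / L x) - 1) l (𝓝 (c / c - 1)) :=
    (hF.div hG hc.ne').sub_const 1
  rw [div_self hc.ne', sub_self] at hlim
  refine ⟨_, hlim, ?_⟩
  filter_upwards [hf, hg, hG.eventually (lt_mem_nhds hc)] with x hfx hgx hx
  rw [hfx, hgx, ← EReal.coe_mul]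
  congr 1
  have hL : L x ≠ 0 := fun h => by simp [h] at hx
  have hG0 : G x ≠ 0 := fun h => by simp [h] at hx
  field_simp
  ring

namespace SensingModel

section Rate

variable {M : ℕ} {U Y : Type*} [Fintype U] [Fintype Y]

/-- A common exponential rate for all pairs of hypotheses. -/
theorem exists_common_rate [Nonempty U] (hM : 2 ≤ M) (m : SensingModel M U Y)
    (hdist : ∀ i j : Fin M, i ≠ j → ∃ u y', m.p i u y' ≠ m.p j u y') :
    ∃ σ : ℝ, 0 < σ ∧ σ < 1 ∧ ∀ (a : ℝ) (qs : Fin M → Y → PMF U) (φ : ControlPolicy U Y)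
      (est : (n : ℕ) → History U Y n → Fin M), m.IsProposedPolicy a qs φ est →
      ∀ i j, j ≠ i → ∀ n, m.affinity φ i j n * σ ≤ σ ^ explorationCount a n := by
  have h := fun p : {p : Fin M × Fin M // p.2 ≠ p.1} =>
    m.exists_affinity_le (hdist p.1.1 p.1.2 p.2.symm)
  choose s hs0 hs1 hs using h
  have : Nonempty {p : Fin M × Fin M // p.2 ≠ p.1} := by
    obtain ⟨j, hj⟩ := nonempty_ne hM ⟨0, by omega⟩
    exact ⟨⟨(_, j), hj⟩⟩
  obtain ⟨p₀, hp₀⟩ := Finite.exists_max s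
  refine ⟨s p₀, hs0 p₀, hs1 p₀, fun a qs φ est hφ i j hj n => ?_⟩
  have h1 := hφ.affinity_le (hs ⟨(i, j), hj⟩) n
  have hle := hp₀ ⟨(i, j), hj⟩
  have h0 := hs0 ⟨(i, j), hj⟩
  generalize s ⟨(i, j), hj⟩ = t at h1 hle h0
  have haff : m.affinity φ i j n ≤ 1 := by
    rw [← m.affinity_zero φ i j]
    exact antitone_nat_of_succ_le (m.affinity_succ_le φ i j) (Nat.zero_le n)
  -- The bound has `σ` on both sides, so enlarging `σ` is not immediate: one factor is cancelled
  -- first, and without any exploration the affinity is at most one anyway.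
  rcases Nat.eq_zero_or_pos (explorationCount a n) with hz | hpos
  · rw [hz, pow_zero]
    exact mul_le_one₀ haff (hs0 p₀).le (hs1 p₀).le
  · obtain ⟨k, hk⟩ := Nat.exists_eq_succ_of_ne_zero hpos.ne'
    rw [hk, pow_succ] at h1 ⊢
    have h2 : m.affinity φ i j n ≤ t ^ k := le_of_mul_le_mul_right h1 h0
    exact mul_le_mul_of_nonneg_right (h2.trans (pow_le_pow_left₀ h0.le hle k)) (hs0 p₀).le

end Rate

variable {M : ℕ} {U Y : Type*} [Fintype U] [MeasurableSpace U] [MeasurableSingletonClass U]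
  [Fintype Y] [MeasurableSpace Y] [MeasurableSingletonClass Y]

theorem risk_le_maxError (m : SensingModel M U Y) (γ : SequentialTest M U Y) (i : Fin M) :
    m.risk γ i ≤ m.maxError γ := by
  refine iSup₂_le fun j hj => le_trans (measure_mono ?_)
    (le_iSup (fun j => m.law γ.policy j (⋃ k ≠ j, γ.decides k)) j)
  exact Set.subset_biUnion_of_mem (u := fun k => γ.decides k) (show i ∈ {k | k ≠ j} from hj.symm)

theorem maxError_le_one (m : SensingModel M U Y) (γ : SequentialTest M U Y) : m.maxError γ ≤ 1 :=
  iSup_le fun _ => prob_le_one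

theorem maxError_le_sum_risk (m : SensingModel M U Y) (γ : SequentialTest M U Y) :
    m.maxError γ ≤ ∑ k, m.risk γ k := by
  classical
  refine iSup_le fun j => ?_
  have h1 : ⋃ k ≠ j, γ.decides k = ⋃ k ∈ Finset.univ.erase j, γ.decides k := by simp
  rw [h1]
  refine (measure_biUnion_finset_le _ _).trans ?_
  refine (Finset.sum_le_sum fun k hk => ?_).trans
    (Finset.sum_le_sum_of_subset (Finset.erase_subset j Finset.univ))
  exact le_iSup₂ (f := fun (j : Fin M) (_ : j ≠ k) => m.law γ.policy j (γ.decides k)) j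
    (Finset.ne_of_mem_erase hk).symm

/-- The constant `C` of the nonasymptotic converse for hypothesis `i`. -/
def IsConverseConst (m : SensingModel M U Y) (i : Fin M) (C : ℝ) : Prop :=
  0 ≤ C ∧ ∀ (γ : SequentialTest M U Y) (R : ℝ), 0 < R → R ≤ 1 →
    m.risk γ i ≤ ENNReal.ofReal R → m.expectedTime γ i ≠ ⊤ →
    (1 - (m.maxError γ).toReal) * -Real.log R ≤
      m.optCoeff i * (m.expectedTime γ i).toReal + C

theorem IsConverseConst.ofReal_le {m : SensingModel M U Y} {i : Fin M} {C : ℝ}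
    (hC : m.IsConverseConst i C) (hd : 0 < m.optCoeff i) {γ : SequentialTest M U Y} {r y : ℝ}
    (hr0 : 0 < r) (hr1 : r ≤ 1) (hr : m.risk γ i ≤ ENNReal.ofReal r)
    (hy : (m.maxError γ).toReal ≤ y) :
    ENNReal.ofReal (((1 - y) * -Real.log r - C) / m.optCoeff i) ≤ m.expectedTime γ i := by
  rcases eq_or_ne (m.expectedTime γ i) ⊤ with hE | hE
  · rw [hE]; exact le_top
  · refine ENNReal.ofReal_le_of_le_toReal ?_
    rw [div_le_iff₀ hd]
    have h1 := hC.2 γ r hr0 hr1 hr hE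
    have h2 : 0 ≤ -Real.log r := neg_nonneg.2 (Real.log_nonpos hr0.le hr1)
    have h3 := mul_le_mul_of_nonneg_right (sub_le_sub_left hy 1) h2
    linarith

/-- With zero risk, `R` could be arbitrarily small in the converse, and the expected time would
exceed every bound. -/
theorem IsConverseConst.risk_ne_zero {m : SensingModel M U Y} {i : Fin M} {C : ℝ}
    (hC : m.IsConverseConst i C) {γ : SequentialTest M U Y} (hE : m.expectedTime γ i ≠ ⊤)
    (hx : (m.maxError γ).toReal < 1) : m.risk γ i ≠ 0 := by
  intro h0
  have hlim : Tendsto (fun r : ℝ => (1 - (m.maxError γ).toReal) * -Real.log r) (𝓝[>] 0) atTop :=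
    (tendsto_neg_atBot_atTop.comp Real.tendsto_log_nhdsGT_zero).const_mul_atTop (sub_pos.2 hx)
  obtain ⟨r, hr, hr0, hr1⟩ := ((hlim.eventually_gt_atTop
    (m.optCoeff i * (m.expectedTime γ i).toReal + C)).and
      (Ioo_mem_nhdsGT (zero_lt_one' ℝ))).exists
  exact absurd (hC.2 γ r hr0 hr1.le (by rw [h0]; exact zero_le) hE) (not_le.2 hr)

/-- The correction factor in the converse. -/
def converseError (C x : ℝ) : ℝ := -x - C / -Real.log x

theorem tendsto_converseError (C : ℝ) : Tendsto (converseError C) (𝓝[≥] 0) (𝓝 0) := by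
  have h1 : Tendsto (fun x : ℝ => -Real.log x) (𝓝[>] 0) atTop :=
    tendsto_neg_atBot_atTop.comp Real.tendsto_log_nhdsGT_zero
  have h2 : Tendsto (converseError C) (𝓝[>] 0) (𝓝 0) := by
    have h3 : Tendsto (fun x : ℝ => -x) (𝓝[>] 0) (𝓝 0) :=
      (continuous_neg.tendsto' 0 0 neg_zero).mono_left nhdsWithin_le_nhds
    have h4 := h3.sub (h1.const_div_atTop C)
    rw [sub_zero] at h4
    exact h4
  -- Tests without error are allowed, so the point `0` itself belongs to the filter; there the
  -- conventions `log 0 = 0` and `C / 0 = 0` give the value `0`.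
  rw [← Set.Ioi_insert, nhdsWithin_insert]
  refine Tendsto.sup ?_ h2
  have h0 : converseError C 0 = 0 := by simp [converseError]
  have h3 := tendsto_pure_nhds (converseError C) 0
  rwa [h0] at h3

/-- The additive constant becomes a relative error: the risk is at most the error probability `x`,
so `C ≤ C / (-log x) * (-log R)`, and this error tends to zero with `x`. -/
theorem IsConverseConst.negLogDiv_mul_le {m : SensingModel M U Y} {i : Fin M} {C : ℝ}
    (hC : m.IsConverseConst i C) (hd : 0 < m.optCoeff i) {γ : SequentialTest M U Y}
    (hx : (m.maxError γ).toReal < 1) :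
    negLogDiv (m.risk γ i) (m.optCoeff i) *
      ((1 + converseError C (m.maxError γ).toReal : ℝ) : EReal) ≤ (m.expectedTime γ i : EReal) := by
  rcases eq_or_ne (m.expectedTime γ i) ⊤ with hE | hE
  · rw [hE]; exact le_top
  · have h0 := hC.risk_ne_zero hE hx
    have hxtop : m.maxError γ ≠ ⊤ := ne_top_of_le_ne_top ENNReal.one_ne_top (m.maxError_le_one γ)
    have hRtop : m.risk γ i ≠ ⊤ := ne_top_of_le_ne_top hxtop (m.risk_le_maxError γ i)
    set x := (m.maxError γ).toReal with hxdef
    obtain ⟨r, hr⟩ : ∃ r, r = (m.risk γ i).toReal := ⟨_, rfl⟩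
    have hr0 : 0 < r := hr ▸ ENNReal.toReal_pos h0 hRtop
    have hrx : r ≤ x := hr ▸ ENNReal.toReal_mono hxtop (m.risk_le_maxError γ i)
    have hR : m.risk γ i = ENNReal.ofReal r := by rw [hr, ENNReal.ofReal_toReal hRtop]
    rw [hR, negLogDiv_ofReal hr0, ← EReal.coe_mul, ← EReal.coe_ennreal_toReal hE,
      EReal.coe_le_coe_iff]
    have h1 := hC.2 γ r hr0 (hrx.trans hx.le) hR.le hE
    have hlogx : 0 < -Real.log x := neg_pos.2 (Real.log_neg (hr0.trans_le hrx) hx)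
    have hlog : -Real.log x ≤ -Real.log r := neg_le_neg (Real.log_le_log hr0 hrx)
    rw [div_mul_eq_mul_div, div_le_iff₀ hd, converseError]
    have h2 : C ≤ C / -Real.log x * -Real.log r := by
      rw [div_mul_eq_mul_div, le_div_iff₀ hlogx]
      exact mul_le_mul_of_nonneg_left hlog hC.1
    linarith

/-- The converse for sequences of tests. -/
theorem exists_converse_seq [Nonempty U] (hM : 2 ≤ M) (m : SensingModel M U Y) {i : Fin M}
    (hd : 0 < m.optCoeff i) (γ : ℕ → SequentialTest M U Y)
    (hγ : Tendsto (fun k => m.maxError (γ k)) atTop (𝓝 0)) :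
    ∃ ε : ℕ → ℝ, Tendsto ε atTop (𝓝 0) ∧ ∀ᶠ k in atTop,
      negLogDiv (m.risk (γ k) i) (m.optCoeff i) * ((1 + ε k : ℝ) : EReal)
          ≤ (m.expectedTime (γ k) i : EReal) ∧
      negLogDiv (m.maxError (γ k)) (m.optCoeff i) * ((1 + ε k : ℝ) : EReal)
          ≤ negLogDiv (m.risk (γ k) i) (m.optCoeff i) * ((1 + ε k : ℝ) : EReal) := by
  obtain ⟨C, hC⟩ : ∃ C, m.IsConverseConst i C := m.exists_converse hM i
  have hx : Tendsto (fun k => (m.maxError (γ k)).toReal) atTop (𝓝 0) :=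
    (ENNReal.tendsto_toReal ENNReal.zero_ne_top).comp hγ
  have hx' : Tendsto (fun k => (m.maxError (γ k)).toReal) atTop (𝓝[≥] 0) :=
    tendsto_nhdsWithin_iff.2 ⟨hx, Eventually.of_forall fun k => ENNReal.toReal_nonneg⟩
  have hε := (tendsto_converseError C).comp hx'
  refine ⟨_, hε, ?_⟩
  filter_upwards [hx.eventually (gt_mem_nhds one_pos),
    hε.eventually (lt_mem_nhds (show (-1 : ℝ) < 0 by norm_num))] with k hk hk2
  have hpos : 0 < 1 + converseError C (m.maxError (γ k)).toReal := by
    have : -1 < converseError C (m.maxError (γ k)).toReal := hk2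
    linarith
  exact ⟨hC.negLogDiv_mul_le hd hk, mul_le_mul_of_nonneg_right
    (negLogDiv_antitone hd.le (m.risk_le_maxError (γ k) i)) (by exact_mod_cast hpos.le)⟩

/-- The asymptotics of the expected time, the error probabilities and the optimal expected times
of a family of tests that is asymptotically as fast as the converse permits. -/
theorem asympEq_of_expectedTime_le (m : SensingModel M U Y) {i : Fin M} {C : ℝ}
    (hC : m.IsConverseConst i C) (hd : 0 < m.optCoeff i) (γ : ℝ → SequentialTest M U Y) {K : ℝ}
    (hK : 0 < K) (herr : ∀ T : ℝ, 0 < T → m.maxError (γ T) ≤ ENNReal.ofReal (K / T))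
    (hup : ∀ d : ℝ, 0 < d → d < m.optCoeff i → ∃ C : ℝ, ∀ T : ℝ, 1 ≤ T →
      m.expectedTime (γ T) i ≤ ENNReal.ofReal (Real.log T / d + C)) :
    AsympEq atTop (fun T : ℝ => (m.expectedTime (γ T) i : EReal))
      (fun T => negLogDiv (m.maxError (γ T)) (m.optCoeff i)) ∧
    AsympEq atTop (fun T : ℝ => (m.expectedTime (γ T) i : EReal))
      (fun T => ((⨅ γ' ∈ m.errorClass (m.maxError (γ T)), m.expectedTime γ' i : ENNReal) : EReal)) ∧
    AsympEq atTop (fun T : ℝ => (m.expectedTime (γ T) i : EReal))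
      (fun T => negLogDiv (m.risk (γ T) i) (m.optCoeff i)) ∧
    AsympEq atTop (fun T : ℝ => (m.expectedTime (γ T) i : EReal))
      (fun T => ((⨅ γ' ∈ m.riskClass (m.risk (γ T)), m.expectedTime γ' i : ENNReal) : EReal)) := by
  set d := m.optCoeff i with hddef
  obtain ⟨E, hE⟩ : ∃ E : ℝ → ℝ, ∀ T, E T = (m.expectedTime (γ T) i).toReal := ⟨_, fun _ => rfl⟩
  obtain ⟨x, hx⟩ : ∃ x : ℝ → ℝ, ∀ T, x T = (m.maxError (γ T)).toReal := ⟨_, fun _ => rfl⟩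
  obtain ⟨r, hr⟩ : ∃ r : ℝ → ℝ, ∀ T, r T = (m.risk (γ T) i).toReal := ⟨_, fun _ => rfl⟩
  have hxtop : ∀ T, m.maxError (γ T) ≠ ⊤ := fun T =>
    ne_top_of_le_ne_top ENNReal.one_ne_top (m.maxError_le_one _)
  have hrtop : ∀ T, m.risk (γ T) i ≠ ⊤ := fun T =>
    ne_top_of_le_ne_top (hxtop T) (m.risk_le_maxError _ i)
  have hx0 : ∀ T, 0 ≤ x T := fun T => by rw [hx]; exact ENNReal.toReal_nonneg
  have hxofReal : ∀ T, m.maxError (γ T) = ENNReal.ofReal (x T) := fun T => by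
    rw [hx, ENNReal.ofReal_toReal (hxtop T)]
  have hrofReal : ∀ T, m.risk (γ T) i = ENNReal.ofReal (r T) := fun T => by
    rw [hr, ENNReal.ofReal_toReal (hrtop T)]
  have hrx : ∀ T, r T ≤ x T := fun T => by
    rw [hr, hx]; exact ENNReal.toReal_mono (hxtop T) (m.risk_le_maxError _ i)
  have hxT : ∀ T, 0 < T → x T ≤ K / T := fun T hT => by
    rw [hx]; exact ENNReal.toReal_le_of_le_ofReal (by positivity) (herr T hT)
  have hxlim : Tendsto x atTop (𝓝 0) := by
    have hKT : Tendsto (fun T : ℝ => K / T) atTop (𝓝 0) := tendsto_const_nhds.div_atTop tendsto_id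
    exact squeeze_zero' (Eventually.of_forall hx0) ((eventually_gt_atTop 0).mono hxT) hKT
  have hEfin : ∀ T, 1 ≤ T → m.expectedTime (γ T) i ≠ ⊤ := by
    obtain ⟨C', hC'⟩ := hup (d / 2) (half_pos hd) (half_lt_self hd)
    exact fun T hT => ne_top_of_le_ne_top ENNReal.ofReal_ne_top (hC' T hT)
  have hxlt : ∀ᶠ T in atTop, x T < 1 := hxlim.eventually (gt_mem_nhds one_pos)
  have hr0 : ∀ᶠ T in atTop, 0 < r T := by
    filter_upwards [hxlt, eventually_ge_atTop 1] with T h1 h2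
    rw [hx] at h1
    rw [hr]
    exact ENNReal.toReal_pos (hC.risk_ne_zero (hEfin T h2) h1) (hrtop T)
  have hL : Tendsto Real.log atTop atTop := Real.tendsto_log_atTop
  have hL0 : ∀ᶠ T in atTop, 0 < Real.log T := hL.eventually_gt_atTop 0
  have hlogx : ∀ᶠ T in atTop, Real.log T - Real.log K ≤ -Real.log (x T) := by
    filter_upwards [hr0, eventually_gt_atTop 0] with T h1 hT
    have h2 := Real.log_le_log (h1.trans_le (hrx T)) (hxT T hT)
    rw [Real.log_div hK.ne' hT.ne'] at h2
    linarith
  have hlogr : ∀ᶠ T in atTop, -Real.log (x T) ≤ -Real.log (r T) :=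
    hr0.mono fun T h1 => neg_le_neg (Real.log_le_log h1 (hrx T))
  have hconv : ∀ᶠ T in atTop, (1 - x T) * -Real.log (r T) ≤ d * E T + C := by
    filter_upwards [hr0, hxlt, eventually_ge_atTop 1] with T h1 h2 h3
    have := hC.2 (γ T) (r T) h1 ((hrx T).trans h2.le) (hrofReal T).le (hEfin T h3)
    rwa [← hx, ← hE] at this
  have hconst : ∀ c : ℝ, Tendsto (fun T => c / Real.log T) atTop (𝓝 0) := fun c =>
    tendsto_const_nhds.div_atTop hL
  have hbase : Tendsto (fun T => (Real.log T - Real.log K) / Real.log T) atTop (𝓝 1) := by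
    have h1 : Tendsto (fun T => 1 - Real.log K / Real.log T) atTop (𝓝 (1 - 0)) :=
      tendsto_const_nhds.sub (hconst _)
    rw [sub_zero] at h1
    refine h1.congr' (hL0.mono fun T hT => ?_)
    beta_reduce
    rw [sub_div, div_self hT.ne']
  -- The lower bound is the converse combined with `-log R ≥ log T - log K`; the upper bound is
  -- `hup`, with a rate `1 / v` slightly below `d`.
  have hElim : Tendsto (fun T => E T / Real.log T) atTop (𝓝 (1 / d)) := by
    refine tendsto_order.2 ⟨fun u hu => ?_, fun u hu => ?_⟩
    · have h1 : Tendsto (fun T => ((1 - x T) * ((Real.log T - Real.log K) / Real.log T) -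
          C / Real.log T) / d) atTop (𝓝 (((1 - 0) * 1 - 0) / d)) :=
        (((tendsto_const_nhds.sub hxlim).mul hbase).sub (hconst C)).div_const d
      rw [sub_zero, sub_zero, mul_one] at h1
      filter_upwards [h1.eventually (lt_mem_nhds hu), hlogx, hlogr, hconv, hL0, hxlt]
        with T h2 h3 h4 h5 h6 h7
      refine lt_of_lt_of_le h2 ?_
      rw [← mul_div_assoc, ← sub_div, div_le_iff₀ hd, div_mul_eq_mul_div,
        div_le_div_iff_of_pos_right h6]
      have h8 := mul_le_mul_of_nonneg_left (h3.trans h4) (sub_nonneg.2 h7.le)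
      linarith
    · obtain ⟨v, hv1, hv2⟩ := exists_between hu
      have hv0 : 0 < v := lt_trans (by positivity) hv1
      obtain ⟨C', hC'⟩ := hup (1 / v) (by positivity) ((one_div_lt hv0 hd).2 hv1)
      have h1 : Tendsto (fun T => v + |C'| / Real.log T) atTop (𝓝 (v + 0)) :=
        tendsto_const_nhds.add (hconst _)
      rw [add_zero] at h1
      filter_upwards [h1.eventually (gt_mem_nhds hv2), hL0, eventually_ge_atTop 1] with T h2 h3 h4
      refine lt_of_le_of_lt ?_ h2
      rw [div_le_iff₀ h3, add_mul, div_mul_cancel₀ _ h3.ne', hE]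
      refine ENNReal.toReal_le_of_le_ofReal (by positivity) ((hC' T h4).trans ?_)
      refine ENNReal.ofReal_le_ofReal ?_
      rw [div_div_eq_mul_div, div_one, mul_comm]
      gcongr
      exact le_abs_self C'
  -- The converse is read backwards: knowing the expected time, it bounds `-log R` from above, so
  -- the risk cannot be much smaller than `1 / T`.
  have hrlim : Tendsto (fun T => -Real.log (r T) / Real.log T) atTop (𝓝 1) := by
    have h1 : Tendsto (fun T => (d * (E T / Real.log T) + C / Real.log T) / (1 - x T)) atTop
        (𝓝 ((d * (1 / d) + 0) / (1 - 0))) :=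
      ((hElim.const_mul d).add (hconst C)).div (tendsto_const_nhds.sub hxlim) (by norm_num)
    rw [mul_one_div_cancel hd.ne', add_zero, sub_zero, div_one] at h1
    refine tendsto_of_tendsto_of_tendsto_of_le_of_le' hbase h1 ?_ ?_
    · filter_upwards [hlogx, hlogr, hL0] with T h2 h3 h4
      exact div_le_div_of_nonneg_right (h2.trans h3) h4.le
    · filter_upwards [hconv, hxlt, hL0] with T h2 h3 h4
      rw [le_div_iff₀ (sub_pos.2 h3), ← mul_div_assoc, ← add_div, div_mul_eq_mul_div, mul_comm]
      exact div_le_div_of_nonneg_right h2 h4.le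
  have hxl : Tendsto (fun T => -Real.log (x T) / Real.log T) atTop (𝓝 1) := by
    refine tendsto_of_tendsto_of_tendsto_of_le_of_le' hbase hrlim ?_ ?_
    · filter_upwards [hlogx, hL0] with T h2 h4
      exact div_le_div_of_nonneg_right h2 h4.le
    · filter_upwards [hlogr, hL0] with T h2 h4
      exact div_le_div_of_nonneg_right h2 h4.le
  have hd1 : (0 : ℝ) < 1 / d := by positivity
  have hEcoe : ∀ᶠ T in atTop, (m.expectedTime (γ T) i : EReal) = (E T : EReal) := by
    filter_upwards [eventually_ge_atTop 1] with T hT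
    rw [hE, EReal.coe_ennreal_toReal (hEfin T hT)]
  have hdiv : ∀ f : ℝ → ℝ, Tendsto (fun T => f T / Real.log T) atTop (𝓝 1) →
      Tendsto (fun T => f T / d / Real.log T) atTop (𝓝 (1 / d)) := fun f hf =>
    (hf.div_const d).congr fun T => by rw [div_right_comm]
  -- the infimum over a class of tests
  have hinf : ∀ (S : ℝ → Set (SequentialTest M U Y)) (y s : ℝ → ℝ), (∀ T, γ T ∈ S T) →
      Tendsto y atTop (𝓝 0) → Tendsto (fun T => -Real.log (s T) / Real.log T) atTop (𝓝 1) →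
      (∀ᶠ T in atTop, 0 < s T ∧ s T ≤ 1) →
      (∀ T, ∀ γ' ∈ S T, (m.maxError γ').toReal ≤ y T ∧ m.risk γ' i ≤ ENNReal.ofReal (s T)) →
      AsympEq atTop (fun T : ℝ => (m.expectedTime (γ T) i : EReal))
        (fun T => ((⨅ γ' ∈ S T, m.expectedTime γ' i : ENNReal) : EReal)) := by
    intro S y s hmem hy hs hs01 hS
    have hle : ∀ T, ⨅ γ' ∈ S T, m.expectedTime γ' i ≤ m.expectedTime (γ T) i := fun T =>
      iInf₂_le (γ T) (hmem T)
    refine asympEq_of_tendsto_div (F := E)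
      (G := fun T => (⨅ γ' ∈ S T, m.expectedTime γ' i).toReal) (L := Real.log) hd1 hEcoe ?_ hElim ?_
    · filter_upwards [eventually_ge_atTop 1] with T hT
      rw [EReal.coe_ennreal_toReal (ne_top_of_le_ne_top (hEfin T hT) (hle T))]
    -- The converse holds for every competitor with the common bounds `y T` and `s T`, hence for the
    -- infimum; the upper bound is the value at `γ T` itself.
    · have h1 : Tendsto (fun T => ((1 - y T) * (-Real.log (s T) / Real.log T) -
          C / Real.log T) / d) atTop (𝓝 (((1 - 0) * 1 - 0) / d)) :=
        (((tendsto_const_nhds.sub hy).mul hs).sub (hconst C)).div_const d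
      rw [sub_zero, sub_zero, mul_one] at h1
      refine tendsto_of_tendsto_of_tendsto_of_le_of_le' h1 hElim ?_ ?_
      · filter_upwards [hs01, hL0, eventually_ge_atTop 1] with T h2 h3 h4
        rw [← mul_div_assoc, ← sub_div, div_right_comm]
        refine div_le_div_of_nonneg_right ?_ h3.le
        rw [← ENNReal.ofReal_le_iff_le_toReal (ne_top_of_le_ne_top (hEfin T h4) (hle T))]
        exact le_iInf₂ fun γ' hγ' => hC.ofReal_le hd h2.1 h2.2 (hS T γ' hγ').2 (hS T γ' hγ').1
      · filter_upwards [hL0, eventually_ge_atTop 1] with T h3 h4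
        refine div_le_div_of_nonneg_right ?_ h3.le
        rw [hE]
        exact ENNReal.toReal_mono (hEfin T h4) (hle T)
  refine ⟨?_, ?_, ?_, ?_⟩
  · refine asympEq_of_tendsto_div (L := Real.log) hd1 hEcoe ?_ hElim (hdiv _ hxl)
    filter_upwards [hr0] with T h1
    rw [hxofReal, negLogDiv_ofReal (h1.trans_le (hrx T))]
  · refine hinf _ x x (fun T => le_refl (m.maxError (γ T))) hxlim hxl ?_ fun T γ' hγ' => ?_
    · filter_upwards [hr0, hxlt] with T h1 h2
      exact ⟨h1.trans_le (hrx T), h2.le⟩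
    · have h1 : m.maxError γ' ≤ m.maxError (γ T) := hγ'
      refine ⟨?_, ?_⟩
      · rw [hx]; exact ENNReal.toReal_mono (hxtop T) h1
      · rw [← hxofReal]; exact (m.risk_le_maxError γ' i).trans h1
  · refine asympEq_of_tendsto_div (L := Real.log) hd1 hEcoe ?_ hElim (hdiv _ hrlim)
    filter_upwards [hr0] with T h1
    rw [hrofReal, negLogDiv_ofReal h1]
  -- A risk class does not bound the error probability directly, but this probability is at most the
  -- sum of the `M` risks, each at most `x T`.
  · refine hinf _ (fun T => M * x T) r (fun T k => le_refl (m.risk (γ T) k)) ?_ hrlim ?_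
      fun T γ' hγ' => ?_
    · simpa using hxlim.const_mul (M : ℝ)
    · filter_upwards [hr0, hxlt] with T h1 h2
      exact ⟨h1, (hrx T).trans h2.le⟩
    · have h1 : ∀ k, m.risk γ' k ≤ m.risk (γ T) k := hγ'
      refine ⟨?_, ?_⟩
      · refine ENNReal.toReal_le_of_le_ofReal (mul_nonneg M.cast_nonneg (hx0 T))
          ((m.maxError_le_sum_risk γ').trans ?_)
        refine (Finset.sum_le_card_nsmul _ _ (m.maxError (γ T)) fun k _ =>
          (h1 k).trans (m.risk_le_maxError _ k)).trans_eq ?_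
        rw [Finset.card_univ, Fintype.card_fin, nsmul_eq_mul, ENNReal.ofReal_mul M.cast_nonneg,
          ENNReal.ofReal_natCast, hxofReal]
      · rw [← hrofReal]; exact h1 i

end SensingModel

end ControlledSensing

end

/-! ### Assembly of the theorem -/

theorem mainTheorem2 {M : ℕ} (hM : 2 ≤ M) {U Y : Type*}
    [Fintype U] [Nonempty U] [MeasurableSpace U] [MeasurableSingletonClass U]
    [Fintype Y] [MeasurableSpace Y] [MeasurableSingletonClass Y]
    (m : SensingModel M U Y)
    (hdist : ∀ i j : Fin M, i ≠ j → ∃ u y', m.p i u y' ≠ m.p j u y') :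
    -- the maxima that define the coefficients are attained and positive
    (∀ i, 0 < m.optCoeff i ∧ ∃ q, m.IsOptimalControl i q ∧ m.objective i q = m.optCoeff i) ∧
    -- converse
    (∀ γ : ℕ → SequentialTest M U Y, Tendsto (fun k => m.maxError (γ k)) atTop (𝓝 0) →
      ∀ i, ∃ ε : ℕ → ℝ, Tendsto ε atTop (𝓝 0) ∧ ∀ᶠ k in atTop,
        negLogDiv (m.risk (γ k) i) (m.optCoeff i) * ((1 + ε k : ℝ) : EReal)
            ≤ (m.expectedTime (γ k) i : EReal) ∧
        negLogDiv (m.maxError (γ k)) (m.optCoeff i) * ((1 + ε k : ℝ) : EReal)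
            ≤ negLogDiv (m.risk (γ k) i) (m.optCoeff i) * ((1 + ε k : ℝ) : EReal)) ∧
    -- the proposed test: termination and error probability
    (∀ a : ℝ, 1 < a → ∀ qs : Fin M → Y → PMF U, (∀ i, m.IsOptimalControl i (qs i)) →
      ∀ φ est, m.IsProposedPolicy a qs φ est → ∀ T : ℝ, 0 < T →
        (∀ i, ∀ᵐ ω ∂(m.law φ i), (m.thresholdTest φ est T).N ω < ⊤) ∧
        m.maxError (m.thresholdTest φ est T) ≤ ENNReal.ofReal (((M : ℝ) - 1) / T)) ∧
    -- the proposed test: asymptotic optimality, for `a` sufficiently close to `1`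
    (∃ a₀ : ℝ, 1 < a₀ ∧ ∀ a : ℝ, 1 < a → a < a₀ →
      ∀ qs : Fin M → Y → PMF U, (∀ i, m.IsOptimalControl i (qs i)) →
      ∀ φ est, m.IsProposedPolicy a qs φ est → ∀ i,
        AsympEq atTop
          (fun T : ℝ => (m.expectedTime (m.thresholdTest φ est T) i : EReal))
          (fun T => negLogDiv (m.maxError (m.thresholdTest φ est T)) (m.optCoeff i)) ∧
        AsympEq atTop
          (fun T : ℝ => (m.expectedTime (m.thresholdTest φ est T) i : EReal))
          (fun T => ((⨅ γ ∈ m.errorClass (m.maxError (m.thresholdTest φ est T)),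
            m.expectedTime γ i : ENNReal) : EReal)) ∧
        AsympEq atTop
          (fun T : ℝ => (m.expectedTime (m.thresholdTest φ est T) i : EReal))
          (fun T => negLogDiv (m.risk (m.thresholdTest φ est T) i) (m.optCoeff i)) ∧
        AsympEq atTop
          (fun T : ℝ => (m.expectedTime (m.thresholdTest φ est T) i : EReal))
          (fun T => ((⨅ γ ∈ m.riskClass (m.risk (m.thresholdTest φ est T)),
            m.expectedTime γ i : ENNReal) : EReal))) := by
  classical
  refine ⟨fun i => ?_, fun γ hγ i => SensingModel.exists_converse_seq hM m (SensingModel.optCoeff_pos hM m hdist i) γ hγ,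
    fun a ha qs _ φ est hφ T hT => ⟨fun i => hφ.ae_N_lt_top hM hdist ha hT i,
      SensingModel.maxError_thresholdTest_le m φ est hT⟩, ?_⟩
  · obtain ⟨q, hq⟩ := SensingModel.exists_isOptimalControl hM m i
    exact ⟨SensingModel.optCoeff_pos hM m hdist i, q, hq, hq.objective_eq⟩
  obtain ⟨σ, hσ0, hσ1, hσ⟩ := SensingModel.exists_common_rate hM m hdist
  -- The largest exploration ratio with `a ^ 4 * σ ≤ 1`, as the fourth-power decay of the estimation
  -- error requires; it depends on the model only through `σ`.
  refine ⟨σ ^ (-(1 / 4) : ℝ), Real.one_lt_rpow_of_pos_of_lt_one_of_neg hσ0 hσ1 (by norm_num),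
    fun a ha ha₀ qs hqs φ est hφ i => ?_⟩
  have haσ : a ^ 4 * σ ≤ 1 := by
    have h1 : a ^ 4 ≤ (σ ^ (-(1 / 4) : ℝ)) ^ 4 := pow_le_pow_left₀ (by linarith) ha₀.le 4
    have h2 : (σ ^ (-(1 / 4) : ℝ)) ^ 4 = σ⁻¹ := by
      rw [← Real.rpow_natCast, ← Real.rpow_mul hσ0.le, ← Real.rpow_neg_one]
      norm_num
    rw [h2] at h1
    exact (mul_le_mul_of_nonneg_right h1 hσ0.le).trans_eq (inv_mul_cancel₀ hσ0.ne')
  obtain ⟨C, hC⟩ : ∃ C, m.IsConverseConst i C := m.exists_converse hM i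
  have hM' : (2 : ℝ) ≤ M := by exact_mod_cast hM
  exact SensingModel.asympEq_of_expectedTime_le m hC (SensingModel.optCoeff_pos hM m hdist i)
    (fun T => m.thresholdTest φ est T) (by linarith : 0 < (M : ℝ) - 1)
    (fun T hT => SensingModel.maxError_thresholdTest_le m φ est hT)
    fun d hd0 hd => hφ.exists_expectedTime_le hM ha hσ0 hσ1 haσ
      (fun j hj n => hσ a qs φ est hφ i j hj n) hd0 ((hqs i).objective_eq ▸ hd)
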